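/- **Notation.** Let $(A_0,A_1)$ be a compatible couple of (real or complex) quasi-Banach spaces, both continuously embedded in a Hausdorff topological vector space, with $A_0\cap A_1\neq\{0\}$, and for $f\in A_0+A_1$, $t>0$ let $$K(t,f)=K(t,f;A_0,A_1)=\inf\{\|f_0\|_{A_0}+t\|f_1\|_{A_1}: f=f_0+f_1,\ f_i\in A_i\}.$$ $\|\cdot\|_{q,(\alpha,\beta)}$ is the usual (quasi-)norm of $L_q(\alpha,\beta)$, $0<q\le\infty$, and $1/\infty=0$. A positive Lebesgue measurable function $b$ on $(0,\infty)$ is slowly varying ($b\in SV$) if for each $\varepsilon>0$ the function $t^{\varepsilon}b(t)$ is equivalent (up to constant factors) to a non-decreasing function and $t^{-\varepsilon}b(t)$ is equivalent to a non-increasing function. For $0\le\theta\le1$, $0<s,r,q\le\infty$ and positive weights $a,b,c$ on $(0,\infty)$, the spaces $\bar A_{\theta,q;b}=(A_0,A_1)_{\theta,q;b}$ (also written with the subscript $\theta,q,b$), $\bar A^{\mathcal L}_{\theta,r,b,q,a}$, $\bar A^{\mathcal L,\mathcal L}_{\theta,s,c,r,b,q,a}$, $\bar A^{\mathcal L,\mathcal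 R}_{\theta,s,c,r,b,q,a}$ consist of all $f\in A_0+A_1$ for which, respectively, the following (quasi-)norms are finite: $$\|u^{-\theta-1/q}b(u)K(u,f)\|_{q,(0,\infty)},\qquad \Big\|t^{-1/r}b(t)\,\|u^{-\theta-1/q}a(u)K(u,f)\|_{q,(0,t)}\Big\|_{r,(0,\infty)},$$ $$\Big\|t^{-1/s}c(t)\,\big\|u^{-1/r}b(u)\,\|v^{-\theta-1/q}a(v)K(v,f)\|_{q,(0,u)}\big\|_{r,(0,t)}\Big\|_{s,(0,\infty)},$$ $$\Big\|t^{-1/s}c(t)\,\big\|u^{-1/r}b(u)\,\|v^{-\theta-1/q}a(v)K(v,f)\|_{q,(t,u)}\big\|_{r,(t,\infty)}\Big\|_{s,(0,\infty)}.$$ Equality of spaces means equality as sets with equivalent (quasi-)norms. **Theorem 34.** Let $0<\theta_0<1$, $0<r,r_0,q_0,r_1,q_1\le\infty$, $a,a_0,b_0,a_1,b_1\in SV$, and suppose $$\|s^{-1/r_0}b_0(s)\|_{r_0,(1,\infty)}<\infty,\quad \|s^{-1/r_1}b_1(s)\|_{r_1,(1,\infty)}<\infty,\quad \Big\|s^{-1/r_1}b_1(s)\|u^{-1/q_1}a_1(u)\|_{q_1,(0,s)}\Big\|_{r_1,(0,1)}<\infty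 .$$ Put $$\chi_0(t)=a_0(t)\,\|s^{-1/r_0}b_0(s)\|_{r_0,(t,\infty)},$$ $$\chi_1(t)=\Big\|s^{-1/r_1}b_1(s)\|u^{-1/q_1}a_1(u)\|_{q_1,(0,s)}\Big\|_{r_1,(0,t)}+\|s^{-1/r_1}b_1(s)\|_{r_1,(t,\infty)}\,\|u^{-1/q_1}a_1(u)\|_{q_1,(0,t)},$$ $$\rho(t)=t^{1-\theta_0}\frac{\chi_0(t)}{\chi_1(t)},$$ and for $0\le\theta\le1$ put $a^{\#}=\chi_0^{1-\theta}\chi_1^{\theta}\,(a\circ\rho)$ and $\eta=(1-\theta)\theta_0+\theta$. (i) If $0<\theta<1$, then $$\big(\bar A^{\mathcal L}_{\theta_0,r_0,b_0,q_0,a_0},\bar A^{\mathcal L}_{1,r_1,b_1,q_1,a_1}\big)_{\theta,r,a}=\bar A_{\eta,r;a^{\#}}.$$ (ii) If $\|s^{-1/r}a(s)\|_{r,(1,\infty)}<\infty$, then $$\big(\bar A^{\mathcal L}_{\theta_0,r_0,b_0,q_0,a_0},\bar A^{\mathcal L}_{1,r_1,b_1,q_1,a_1}\big)_{0,r,a}=\bar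 A^{\mathcal L}_{\theta_0,r,B_0,q_0,a_0}\cap\bar A^{\mathcal L,\mathcal L}_{\theta_0,r,a\circ\rho,r_0,b_0,q_0,a_0},$$ where $B_0(t)=\|s^{-1/r_0}b_0(s)\|_{r_0,(t,\infty)}\,a(\rho(t))$. (iii) If $\|s^{-1/r}a(s)\|_{r,(0,1)}<\infty$, then $$\big(\bar A^{\mathcal L}_{\theta_0,r_0,b_0,q_0,a_0},\bar A^{\mathcal L}_{1,r_1,b_1,q_1,a_1}\big)_{1,r,a}=\bar A_{1,r;a^{\#}}\cap\bar A^{\mathcal L,\mathcal R}_{1,r,a\circ\rho,r_1,b_1,q_1,a_1},$$ where $a^{\#}$ is taken with $\theta=1$, i.e. $a^{\#}=\chi_1\,(a\circ\rho)$. -/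

import Mathlib

open MeasureTheory Set Filter Topology
open scoped ENNReal NNReal

namespace RealInterp

noncomputable section

/-! ## Quasi-Banach spaces inside a topological vector space, and compatible couples

A quasi-normed space `X` contained in an ambient vector space `V` is represented by its quasi-norm,
extended by the value `∞` to the vectors outside `X`; so `X = {f | N f < ∞}`. -/

/-- The underlying set of the space with extended quasi-norm `N`. -/
def space {V : Type*} (N : V → ℝ≥0∞) : Set V := {f | N f < ∞}

/-- `N` is the (extended) quasi-norm of a quasi-Banach space that is continuously embedded in the
topological vector space `V`. -/
structure IsQuasiBanach (𝕜 : Type*) [RCLike 𝕜] {V : Type*} [AddCommGroup V] [Module 𝕜 V]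
    [TopologicalSpace V] (N : V → ℝ≥0∞) : Prop where
  smul : ∀ (c : 𝕜) (f : V), N (c • f) = ‖c‖ₑ * N f
  eq_zero : ∀ f : V, N f = 0 → f = 0
  add_le : ∃ C : ℝ≥0, ∀ f g : V, N (f + g) ≤ C * (N f + N g)
  complete : ∀ u : ℕ → V, (∀ n, u n ∈ space N) →
    (∀ ε : ℝ≥0∞, 0 < ε → ∃ M, ∀ m ≥ M, ∀ n ≥ M, N (u m - u n) < ε) →
    ∃ f ∈ space N, Tendsto (fun n => N (u n - f)) atTop (𝓝 0)
  embedded : ∀ U ∈ 𝓝 (0 : V), ∃ δ : ℝ≥0∞, 0 < δ ∧ ∀ f, N f < δ → f ∈ U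

/-- `(A₀, A₁)` is a compatible couple of quasi-Banach spaces (both continuously embedded in the
space `V`, which is taken to be a Hausdorff topological vector space) with `A₀ ∩ A₁ ≠ {0}`. -/
structure IsCompatibleCouple (𝕜 : Type*) [RCLike 𝕜] {V : Type*} [AddCommGroup V] [Module 𝕜 V]
    [TopologicalSpace V] (A₀ A₁ : V → ℝ≥0∞) : Prop where
  left : IsQuasiBanach 𝕜 A₀
  right : IsQuasiBanach 𝕜 A₁
  nontrivial : ∃ f ∈ space A₀ ∩ space A₁, f ≠ 0

/-- The continuous embedding `X ⊂ Y`. -/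
def Embeds {V : Type*} (X Y : V → ℝ≥0∞) : Prop :=
  space X ⊆ space Y ∧ ∃ C : ℝ≥0, ∀ f ∈ space X, Y f ≤ C * X f

/-- `X = Y`: the two spaces coincide as sets and their quasi-norms are equivalent. -/
def SameSpace {V : Type*} (X Y : V → ℝ≥0∞) : Prop := Embeds X Y ∧ Embeds Y X

/-- The intersection of two spaces, with the quasi-norm `max (‖f‖_X, ‖f‖_Y)`. -/
def inter {V : Type*} (X Y : V → ℝ≥0∞) : V → ℝ≥0∞ := fun f => max (X f) (Y f)

/-! ## Slowly varying functions -/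

/-- Equivalence `f ≈ g` on `(0, ∞)`. -/
def Equivalent (f g : ℝ → ℝ) : Prop :=
  ∃ C : ℝ, 0 < C ∧ ∀ t, 0 < t → f t ≤ C * g t ∧ g t ≤ C * f t

/-- Slowly varying functions on `(0, ∞)`; values outside `(0, ∞)` are irrelevant. -/
structure SlowlyVarying (b : ℝ → ℝ) : Prop where
  pos : ∀ t, 0 < t → 0 < b t
  measurable : AEMeasurable b (volume.restrict (Ioi 0))
  incr : ∀ ε : ℝ, 0 < ε → ∃ g : ℝ → ℝ, (∀ t, 0 < t → 0 < g t) ∧ MonotoneOn g (Ioi 0) ∧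
    Equivalent (fun t => t ^ ε * b t) g
  decr : ∀ ε : ℝ, 0 < ε → ∃ g : ℝ → ℝ, (∀ t, 0 < t → 0 < g t) ∧ AntitoneOn g (Ioi 0) ∧
    Equivalent (fun t => t ^ (-ε) * b t) g

/-! ## Weighted Lebesgue quasi-norms -/

/-- `‖ u ^ (l - 1/q) * w u * F u ‖_{q, I}`, the quasi-norm in `L_q` on `I ⊆ (0, ∞)`
(`1 / q.toReal = 0` for `q = ∞`). -/
def wnorm (q : ℝ≥0∞) (I : Set ℝ) (l : ℝ) (w : ℝ → ℝ) (F : ℝ → ℝ≥0∞) : ℝ≥0∞ :=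
  eLpNorm (fun u => ENNReal.ofReal (u ^ (l - 1 / q.toReal) * w u) * F u) q (volume.restrict I)

/-- `‖ u ^ (-1/q) * w u ‖_{q, I}`. -/
def wt (q : ℝ≥0∞) (I : Set ℝ) (w : ℝ → ℝ) : ℝ≥0∞ := wnorm q I 0 w (fun _ => 1)

/-! ## The K-functional and the interpolation spaces -/

section Spaces

variable {V : Type*} [AddCommGroup V]

/-- Peetre's K-functional `K(t, f; A₀, A₁)`. It is `∞` exactly when `f ∉ A₀ + A₁` (for `t > 0`), so
for such `f` all the quasi-norms below are `∞` too. -/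
def K (A₀ A₁ : V → ℝ≥0∞) (t : ℝ) (f : V) : ℝ≥0∞ :=
  ⨅ (f₀ : V) (f₁ : V) (_ : f = f₀ + f₁), A₀ f₀ + ENNReal.ofReal t * A₁ f₁

/-- The standard space `(A₀, A₁)_{θ,q;b}`. -/
def std (A₀ A₁ : V → ℝ≥0∞) (θ : ℝ) (q : ℝ≥0∞) (b : ℝ → ℝ) : V → ℝ≥0∞ := fun f =>
  wnorm q (Ioi 0) (-θ) b (fun u => K A₀ A₁ u f)

/-- The limiting space `(A₀, A₁)^L_{θ,r,b,q,a}`. -/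
def spaceL (A₀ A₁ : V → ℝ≥0∞) (θ : ℝ) (r : ℝ≥0∞) (b : ℝ → ℝ) (q : ℝ≥0∞) (a : ℝ → ℝ) :
    V → ℝ≥0∞ := fun f =>
  wnorm r (Ioi 0) 0 b fun t => wnorm q (Ioo 0 t) (-θ) a fun u => K A₀ A₁ u f

/-- The extremal space `(A₀, A₁)^{L,L}_{θ,s,c,r,b,q,a}`. -/
def spaceLL (A₀ A₁ : V → ℝ≥0∞) (θ : ℝ) (s : ℝ≥0∞) (c : ℝ → ℝ) (r : ℝ≥0∞) (b : ℝ → ℝ)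
    (q : ℝ≥0∞) (a : ℝ → ℝ) : V → ℝ≥0∞ := fun f =>
  wnorm s (Ioi 0) 0 c fun t => wnorm r (Ioo 0 t) 0 b fun u =>
    wnorm q (Ioo 0 u) (-θ) a fun v => K A₀ A₁ v f

/-- The extremal space `(A₀, A₁)^{L,R}_{θ,s,c,r,b,q,a}`. -/
def spaceLR (A₀ A₁ : V → ℝ≥0∞) (θ : ℝ) (s : ℝ≥0∞) (c : ℝ → ℝ) (r : ℝ≥0∞) (b : ℝ → ℝ)
    (q : ℝ≥0∞) (a : ℝ → ℝ) : V → ℝ≥0∞ := fun f =>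
  wnorm s (Ioi 0) 0 c fun t => wnorm r (Ioi t) 0 b fun u =>
    wnorm q (Ioo t u) (-θ) a fun v => K A₀ A₁ v f

end Spaces

/-! ## The auxiliary functions

The quasi-norms below are finite for every `t > 0` under the hypotheses of the theorem, so that
`ENNReal.toReal` is just the passage to real numbers. -/

/-- `χ₀(t) = a₀(t) ‖s^{-1/r₀} b₀(s)‖_{r₀,(t,∞)}`. -/
def chi₀ (r₀ : ℝ≥0∞) (b₀ a₀ : ℝ → ℝ) : ℝ → ℝ := fun t => a₀ t * (wt r₀ (Ioi t) b₀).toReal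

/-- `χ₁(t) = ‖s^{-1/r₁} b₁(s) ‖u^{-1/q₁} a₁(u)‖_{q₁,(0,s)}‖_{r₁,(0,t)}
  + ‖s^{-1/r₁} b₁(s)‖_{r₁,(t,∞)} ‖u^{-1/q₁} a₁(u)‖_{q₁,(0,t)}`. -/
def chi₁ (r₁ : ℝ≥0∞) (b₁ : ℝ → ℝ) (q₁ : ℝ≥0∞) (a₁ : ℝ → ℝ) : ℝ → ℝ := fun t =>
  (wnorm r₁ (Ioo 0 t) 0 b₁ fun s => wt q₁ (Ioo 0 s) a₁).toReal
    + (wt r₁ (Ioi t) b₁).toReal * (wt q₁ (Ioo 0 t) a₁).toReal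

/-- `ρ(t) = t^{1-θ₀} χ₀(t) / χ₁(t)`. -/
def rho (θ₀ : ℝ) (χ₀ χ₁ : ℝ → ℝ) : ℝ → ℝ := fun t => t ^ (1 - θ₀) * (χ₀ t / χ₁ t)

/-- `a^# = χ₀^{1-θ} χ₁^θ (a ∘ ρ)`. -/
def sharp (θ : ℝ) (χ₀ χ₁ ρ a : ℝ → ℝ) : ℝ → ℝ := fun t =>
  χ₀ t ^ (1 - θ) * χ₁ t ^ θ * a (ρ t)

/-- `B₀(t) = ‖s^{-1/r₀} b₀(s)‖_{r₀,(t,∞)} a(ρ(t))`. -/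
def bigB₀ (r₀ : ℝ≥0∞) (b₀ ρ a : ℝ → ℝ) : ℝ → ℝ := fun t => (wt r₀ (Ioi t) b₀).toReal * a (ρ t)

end

end RealInterp

/-! The substitution $t=e^x$ turns the quasi-norms into translation-invariant $L_q(dx)$ norms. The
slowly varying weights become functions growing more slowly than any exponential (`SV`), and
$k(x)=K(e^x,f)$ becomes a non-decreasing function with $e^{-x}k(x)$ non-increasing (`IsK`). All of
these have regular growth (`Reg`): values at bounded distance are comparable. Hence a value is
controlled by the norm over an adjacent unit interval, and sampling at integers supplies measurable
substitutes. Every constant is chosen before $k$, so the estimates are uniform in $f$.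

The core is a Holmstedt-type formula, `K_limiting_equiv`: at $\rho(t)$ the K-functional of the two
limiting spaces is equivalent to $S=P_0+Q_0+\rho R_1$. Here $P_0$ is the first norm cut off at $t$,
$Q_0(t)$ is its inner norm at $t$ times the tail of $b_0$, and $R_1$ is the part of the second norm
beyond $t$. For the upper bound, a nearly optimal decomposition $f=f_0+f_1$ at $e^t$ for the
original couple is used: the K-functional of $f_0$ is bounded by $k(\min(u,t))$, while that of $f_1$
is linear below $t$ and bounded by $k$ above it (`N₀_le`, `ρ_mul_N₁_le`). For the lower bound, $S$
is quasi-subadditive and is dominated by either norm, the second one multiplied by $\rho$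
(`S_le_add`, `S_le_N₀`, `S_le_N₁`).

Since $\rho$ is $e^{(1-\theta_0)x}$ times a slowly varying factor, $\log\rho$ is coarsely affine,
and the interpolation norm becomes $\|\rho^{-\tau}(a\circ\rho)S\|_r$ (`L_comp_equiv`, `std_equiv`).
Hardy's inequalities compare it with the pointwise term $T=e^{-\theta_0 t}\chi_0k\lesssim Q_0$. The
terms $P_0,Q_0$ reduce to $T$ when $\tau>0$, and $\rho R_1$ does when $\tau<1$. So only $T$ is left
for $0<\tau<1$, the terms $Q_0,P_0$ for $\tau=0$, and $T,R_1$ for $\tau=1$: these are the three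
cases. -/

namespace RealInterp

noncomputable section

/-! ## Exponential weights on the line -/

/-- The exponential `x ↦ exp (γ x)` with values in `[0, ∞]`. -/
def E (γ x : ℝ) : ℝ≥0∞ := ENNReal.ofReal (Real.exp (γ * x))

theorem E_pos (γ x : ℝ) : 0 < E γ x := ENNReal.ofReal_pos.2 (Real.exp_pos _)

theorem E_ne_zero (γ x : ℝ) : E γ x ≠ 0 := (E_pos γ x).ne'

theorem E_ne_top (γ x : ℝ) : E γ x ≠ ∞ := ENNReal.ofReal_ne_top

theorem E_add_right (γ x y : ℝ) : E γ (x + y) = E γ x * E γ y := by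
  rw [E, E, E, ← ENNReal.ofReal_mul (Real.exp_pos _).le, ← Real.exp_add, mul_add]

theorem E_add_left (γ δ x : ℝ) : E (γ + δ) x = E γ x * E δ x := by
  rw [E, E, E, ← ENNReal.ofReal_mul (Real.exp_pos _).le, ← Real.exp_add, add_mul]

@[simp] theorem E_zero_left (x : ℝ) : E 0 x = 1 := by simp [E]

@[simp] theorem E_zero_right (γ : ℝ) : E γ 0 = 1 := by simp [E]

theorem E_neg_right (γ x : ℝ) : E γ (-x) = E (-γ) x := by simp [E]

theorem E_sub_right (γ x y : ℝ) : E γ (x - y) = E γ x * E (-γ) y := by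
  rw [sub_eq_add_neg, E_add_right, E_neg_right]

theorem E_mul_neg (γ x : ℝ) : E γ x * E (-γ) x = 1 := by
  rw [← E_add_left]; simp

theorem E_rpow (γ x p : ℝ) : E γ x ^ p = E (p * γ) x := by
  rw [E, E, ENNReal.ofReal_rpow_of_pos (Real.exp_pos _), ← Real.exp_mul]
  ring_nf

theorem E_le_E_left {γ δ x : ℝ} (h : γ ≤ δ) (hx : 0 ≤ x) : E γ x ≤ E δ x :=
  ENNReal.ofReal_le_ofReal (Real.exp_le_exp.2 (mul_le_mul_of_nonneg_right h hx))

theorem E_le_E_right {γ x y : ℝ} (h : 0 ≤ γ) (hx : x ≤ y) : E γ x ≤ E γ y :=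
  ENNReal.ofReal_le_ofReal (Real.exp_le_exp.2 (mul_le_mul_of_nonneg_left hx h))

theorem one_le_E {γ x : ℝ} (h : 0 ≤ γ) (hx : 0 ≤ x) : 1 ≤ E γ x := by
  simpa using E_le_E_left h hx

theorem measurable_E (γ : ℝ) : Measurable (E γ) := by
  unfold E; fun_prop

/-! ## Lebesgue quasi-norms of functions with values in `[0, ∞]` -/

/-- The quasi-norm of `φ` in `L_q` on the subset `I` of the line. -/
def L (q : ℝ≥0∞) (I : Set ℝ) (φ : ℝ → ℝ≥0∞) : ℝ≥0∞ := eLpNorm φ q (volume.restrict I)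

variable {q p : ℝ≥0∞} {I J : Set ℝ} {φ ψ w : ℝ → ℝ≥0∞}

theorem L_top : L ∞ I φ = essSup φ (volume.restrict I) := by
  simp [L, eLpNormEssSup]

theorem L_eq (h0 : q ≠ 0) (ht : q ≠ ∞) :
    L q I φ = (∫⁻ x in I, φ x ^ q.toReal) ^ (1 / q.toReal) := by
  simp [L, eLpNorm_eq_lintegral_rpow_enorm_toReal h0 ht]

theorem L_mono_ae (h : ∀ᵐ x ∂volume.restrict I, φ x ≤ ψ x) : L q I φ ≤ L q I ψ :=
  eLpNorm_mono_enorm_ae (by simpa using h)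

theorem L_mono (hI : MeasurableSet I) (h : ∀ x ∈ I, φ x ≤ ψ x) : L q I φ ≤ L q I ψ :=
  L_mono_ae ((ae_restrict_iff' hI).2 (Eventually.of_forall h))

theorem L_mono_fun (h : ∀ x, φ x ≤ ψ x) : L q I φ ≤ L q I ψ :=
  L_mono_ae (Eventually.of_forall h)

theorem L_mono_set (h : I ⊆ J) : L q I φ ≤ L q J φ :=
  eLpNorm_mono_measure _ (Measure.restrict_mono h le_rfl)

/-- K-functionals may be infinite, so infinite factors occur, and then a non-measurable function
gives only this direction. The two equalities that follow require a finite factor or a measurable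
function. -/
theorem mul_L_le (h0 : q ≠ 0) (c : ℝ≥0∞) : c * L q I φ ≤ L q I (fun x => c * φ x) := by
  by_cases ht : q = ∞
  · subst ht
    rw [L_top, L_top, ENNReal.essSup_const_mul]
  · have hq : 0 < q.toReal := ENNReal.toReal_pos h0 ht
    rw [L_eq h0 ht, L_eq h0 ht]
    have : c = (c ^ q.toReal) ^ (1 / q.toReal) := by
      rw [← ENNReal.rpow_mul, mul_one_div_cancel hq.ne', ENNReal.rpow_one]
    conv_lhs => rw [this]
    rw [← ENNReal.mul_rpow_of_nonneg _ _ (by positivity)]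
    gcongr
    simp_rw [ENNReal.mul_rpow_of_nonneg _ _ hq.le]
    exact lintegral_const_mul_le _ _

theorem L_mul (h0 : q ≠ 0) {c : ℝ≥0∞} (hc : c ≠ ∞) :
    L q I (fun x => c * φ x) = c * L q I φ := by
  by_cases ht : q = ∞
  · subst ht
    rw [L_top, L_top, ENNReal.essSup_const_mul]
  · have hq : 0 < q.toReal := ENNReal.toReal_pos h0 ht
    rw [L_eq h0 ht, L_eq h0 ht]
    simp_rw [ENNReal.mul_rpow_of_nonneg _ _ hq.le]
    rw [lintegral_const_mul' _ _ (ENNReal.rpow_ne_top_of_nonneg hq.le hc),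
      ENNReal.mul_rpow_of_nonneg _ _ (by positivity), ← ENNReal.rpow_mul,
      mul_one_div_cancel hq.ne', ENNReal.rpow_one]

theorem L_mul_of_measurable (h0 : q ≠ 0) (c : ℝ≥0∞) (hφ : Measurable φ) :
    L q I (fun x => c * φ x) = c * L q I φ := by
  by_cases ht : q = ∞
  · subst ht
    rw [L_top, L_top, ENNReal.essSup_const_mul]
  · have hq : 0 < q.toReal := ENNReal.toReal_pos h0 ht
    rw [L_eq h0 ht, L_eq h0 ht]
    simp_rw [ENNReal.mul_rpow_of_nonneg _ _ hq.le]
    rw [lintegral_const_mul _ (hφ.pow_const _),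
      ENNReal.mul_rpow_of_nonneg _ _ (by positivity), ← ENNReal.rpow_mul,
      mul_one_div_cancel hq.ne', ENNReal.rpow_one]

theorem L_le_mul (h0 : q ≠ 0) (hI : MeasurableSet I) {c : ℝ≥0∞} (hc : c ≠ ∞)
    (h : ∀ x ∈ I, φ x ≤ c * ψ x) : L q I φ ≤ c * L q I ψ :=
  (L_mono hI h).trans (L_mul h0 hc).le

theorem L_unit_const (h0 : q ≠ 0) (x : ℝ) (c : ℝ≥0∞) : L q (Ioo x (x + 1)) (fun _ => c) = c := by
  have hμ : (volume.restrict (Ioo x (x + 1))) univ = 1 := by simp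
  rw [L, eLpNorm_const c h0 (by intro h; rw [h] at hμ; simp at hμ), hμ]
  simp

theorem L_comp_add (h : ℝ) : L q ((fun x => x + h) ⁻¹' I) (fun x => φ (x + h)) = L q I φ := by
  have e : MeasurableEmbedding (fun x : ℝ => x + h) := measurableEmbedding_addRight h
  have := e.eLpNorm_map_measure (g := φ) (p := q)
    (μ := volume.restrict ((fun x => x + h) ⁻¹' I))
  rw [← e.restrict_map, map_add_right_eq_self] at this
  exact this.symm

theorem L_comp_neg : L q (Neg.neg ⁻¹' I) (fun x => φ (-x)) = L q I φ := by
  have e : MeasurableEmbedding (fun x : ℝ => -x) := (MeasurableEquiv.neg ℝ).measurableEmbedding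
  have := e.eLpNorm_map_measure (g := φ) (p := q)
    (μ := volume.restrict (Neg.neg ⁻¹' I))
  rw [← e.restrict_map] at this
  rw [show Measure.map (fun x : ℝ => -x) volume = volume from Measure.map_neg_eq_self _] at this
  exact this.symm

theorem L_Iio_add (x h : ℝ) : L q (Iio (x + h)) φ = L q (Iio x) (fun u => φ (u + h)) := by
  rw [← L_comp_add (φ := φ) (I := Iio (x + h)) h]; simp

theorem L_Ioi_add (x h : ℝ) : L q (Ioi (x + h)) φ = L q (Ioi x) (fun u => φ (u + h)) := by
  rw [← L_comp_add (φ := φ) (I := Ioi (x + h)) h]; simp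

theorem L_Ioi_neg (x : ℝ) : L q (Ioi (-x)) φ = L q (Iio x) (fun u => φ (-u)) := by
  rw [← L_comp_neg (φ := φ) (I := Ioi (-x))]; simp

theorem L_Iio_neg (x : ℝ) : L q (Iio (-x)) φ = L q (Ioi x) (fun u => φ (-u)) := by
  rw [← L_comp_neg (φ := φ) (I := Iio (-x))]; simp

theorem L_univ_neg : L q univ φ = L q univ (fun u => φ (-u)) := by
  rw [← L_comp_neg (φ := φ) (I := univ)]; simp

/-- Powers are quasi-subadditive. -/
theorem exists_rpow_add_le (r : ℝ) (hr : 0 ≤ r) :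
    ∃ C : ℝ≥0, ∀ x y : ℝ≥0∞, (x + y) ^ r ≤ C * (x ^ r + y ^ r) := by
  refine ⟨2 ^ r, fun x y => ?_⟩
  rw [ENNReal.coe_rpow_of_nonneg _ hr]
  have h : x + y ≤ 2 * max x y := by
    rw [two_mul]; exact add_le_add (le_max_left _ _) (le_max_right _ _)
  calc (x + y) ^ r ≤ (2 * max x y) ^ r := by gcongr
    _ = 2 ^ r * max x y ^ r := ENNReal.mul_rpow_of_nonneg _ _ hr
    _ ≤ 2 ^ r * (x ^ r + y ^ r) := by
      gcongr
      rcases le_total x y with h | h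
      · rw [max_eq_right h]; exact le_add_self
      · rw [max_eq_left h]; exact le_self_add

theorem L_union_le (h0 : q ≠ 0) : ∃ C : ℝ≥0, ∀ (I J : Set ℝ) (φ : ℝ → ℝ≥0∞),
    L q (I ∪ J) φ ≤ C * (L q I φ + L q J φ) := by
  by_cases ht : q = ∞
  · subst ht
    refine ⟨1, fun I J φ => ?_⟩
    simp_rw [L_top]
    rw [ENNReal.coe_one, one_mul]
    refine essSup_le_of_ae_le _ ?_
    have hI : ∀ᵐ x ∂volume.restrict I, φ x ≤
        essSup φ (volume.restrict I) + essSup φ (volume.restrict J) :=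
      (ENNReal.ae_le_essSup φ).mono fun x hx => hx.trans le_self_add
    have hJ : ∀ᵐ x ∂volume.restrict J, φ x ≤
        essSup φ (volume.restrict I) + essSup φ (volume.restrict J) :=
      (ENNReal.ae_le_essSup φ).mono fun x hx => hx.trans le_add_self
    exact (ae_restrict_union_iff I J _).2 ⟨hI, hJ⟩
  · have hq : 0 < q.toReal := ENNReal.toReal_pos h0 ht
    obtain ⟨C, hC⟩ := exists_rpow_add_le (1 / q.toReal) (by positivity)
    refine ⟨C, fun I J φ => ?_⟩
    rw [L_eq h0 ht, L_eq h0 ht, L_eq h0 ht]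
    refine le_trans ?_ (hC _ _)
    gcongr
    exact lintegral_union_le _ _ _

/-- One measurable summand suffices, because the integral of the powers is then additive. -/
theorem L_add_le (h0 : q ≠ 0) : ∃ C : ℝ≥0, ∀ (I : Set ℝ) (φ ψ : ℝ → ℝ≥0∞), Measurable φ →
    L q I (fun x => φ x + ψ x) ≤ C * (L q I φ + L q I ψ) := by
  by_cases ht : q = ∞
  · subst ht
    refine ⟨1, fun I φ ψ _ => ?_⟩
    simp_rw [L_top]
    rw [ENNReal.coe_one, one_mul]
    refine essSup_le_of_ae_le _ ?_
    filter_upwards [ENNReal.ae_le_essSup (μ := volume.restrict I) φ,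
      ENNReal.ae_le_essSup (μ := volume.restrict I) ψ] with x h1 h2
    exact add_le_add h1 h2
  · have hq : 0 < q.toReal := ENNReal.toReal_pos h0 ht
    obtain ⟨C, hC⟩ := exists_rpow_add_le (1 / q.toReal) (by positivity)
    obtain ⟨D, hD⟩ := exists_rpow_add_le q.toReal hq.le
    refine ⟨D ^ (1 / q.toReal) * C, fun I φ ψ hφ => ?_⟩
    rw [L_eq h0 ht, L_eq h0 ht, L_eq h0 ht, ENNReal.coe_mul, mul_assoc,
      ENNReal.coe_rpow_of_nonneg _ (by positivity)]
    refine le_trans ?_ (mul_le_mul_right (hC _ _) _)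
    rw [← ENNReal.mul_rpow_of_nonneg _ _ (by positivity), ← lintegral_add_left (hφ.pow_const _),
      ← lintegral_const_mul' _ _ ENNReal.coe_ne_top]
    gcongr
    exact hD _ _

/-! ## Functions of regular growth -/

/-- `w y / w x` lies between `C⁻¹ exp (α (y - x))` and `C exp (β (y - x))` for `x ≤ y`. -/
def Reg (C : ℝ≥0) (α β : ℝ) (w : ℝ → ℝ≥0∞) : Prop :=
  ∀ x y, x ≤ y → w y ≤ C * E β (y - x) * w x ∧ w x ≤ C * E (-α) (y - x) * w y

theorem Reg.weaken {C C' : ℝ≥0} {α β α' β' : ℝ} (h : Reg C α β w) (hC : C ≤ C') (hα : α' ≤ α)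
    (hβ : β ≤ β') : Reg C' α' β' w := by
  intro x y hxy
  obtain ⟨h1, h2⟩ := h x y hxy
  have h3 : E β (y - x) ≤ E β' (y - x) := E_le_E_left hβ (by linarith)
  have h4 : E (-α) (y - x) ≤ E (-α') (y - x) := E_le_E_left (by linarith) (by linarith)
  have h5 : (C : ℝ≥0∞) ≤ C' := by exact_mod_cast hC
  exact ⟨h1.trans (by gcongr), h2.trans (by gcongr)⟩

theorem reg_E (γ : ℝ) : Reg 1 γ γ (E γ) := by
  intro x y _
  rw [ENNReal.coe_one, one_mul, one_mul, ← E_add_right, ← E_neg_right, ← E_add_right]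
  constructor <;> apply le_of_eq <;> ring_nf

theorem Reg.mul {C D : ℝ≥0} {α β γ δ : ℝ} (h : Reg C α β φ) (h' : Reg D γ δ ψ) :
    Reg (C * D) (α + γ) (β + δ) (fun x => φ x * ψ x) := by
  intro x y hxy
  obtain ⟨h1, h2⟩ := h x y hxy
  obtain ⟨h3, h4⟩ := h' x y hxy
  rw [E_add_left, neg_add, E_add_left, ENNReal.coe_mul]
  refine ⟨(mul_le_mul' h1 h3).trans (le_of_eq (by ring)),
    (mul_le_mul' h2 h4).trans (le_of_eq (by ring))⟩

theorem Reg.add {C D : ℝ≥0} {α β : ℝ} (h : Reg C α β φ) (h' : Reg D α β ψ) :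
    Reg (max C D) α β (fun x => φ x + ψ x) := by
  intro x y hxy
  obtain ⟨h1, h2⟩ := h.weaken (le_max_left C D) le_rfl le_rfl x y hxy
  obtain ⟨h3, h4⟩ := h'.weaken (le_max_right C D) le_rfl le_rfl x y hxy
  exact ⟨(add_le_add h1 h3).trans (mul_add _ _ _).ge, (add_le_add h2 h4).trans (mul_add _ _ _).ge⟩

theorem Reg.rpow {C : ℝ≥0} {α β : ℝ} (h : Reg C α β φ) {s : ℝ} (hs : 0 ≤ s) :
    Reg (C ^ s) (s * α) (s * β) (fun x => φ x ^ s) := by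
  intro x y hxy
  obtain ⟨h1, h2⟩ := h x y hxy
  rw [ENNReal.coe_rpow_of_nonneg _ hs, ← E_rpow, ← mul_neg, ← E_rpow,
    ← ENNReal.mul_rpow_of_nonneg _ _ hs, ← ENNReal.mul_rpow_of_nonneg _ _ hs,
    ← ENNReal.mul_rpow_of_nonneg _ _ hs, ← ENNReal.mul_rpow_of_nonneg _ _ hs]
  exact ⟨ENNReal.rpow_le_rpow h1 hs, ENNReal.rpow_le_rpow h2 hs⟩

theorem inv_le_mul_inv_of_le_mul {a b c : ℝ≥0∞} (h0 : c ≠ 0) (ht : c ≠ ∞) (h : a ≤ c * b) :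
    b⁻¹ ≤ c * a⁻¹ := by
  have := ENNReal.inv_le_inv.2 h
  rw [ENNReal.mul_inv (Or.inl h0) (Or.inl ht)] at this
  calc b⁻¹ = c * (c⁻¹ * b⁻¹) := by rw [← mul_assoc, ENNReal.mul_inv_cancel h0 ht, one_mul]
    _ ≤ _ := by gcongr

theorem Reg.inv {C : ℝ≥0} {α β : ℝ} (h : Reg C α β φ) :
    Reg (max C 1) (-β) (-α) (fun x => (φ x)⁻¹) := by
  intro x y hxy
  -- Passing to `max C 1` makes the constant nonzero, as inversion in $[0,\infty]$ requires.
  obtain ⟨h1, h2⟩ := h.weaken (le_max_left C 1) le_rfl le_rfl x y hxy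
  have hC : ((max C 1 : ℝ≥0) : ℝ≥0∞) ≠ 0 := by
    simp
  rw [neg_neg]
  exact ⟨inv_le_mul_inv_of_le_mul (mul_ne_zero hC (E_ne_zero _ _))
      (ENNReal.mul_ne_top ENNReal.coe_ne_top (E_ne_top _ _)) h2,
    inv_le_mul_inv_of_le_mul (mul_ne_zero hC (E_ne_zero _ _))
      (ENNReal.mul_ne_top ENNReal.coe_ne_top (E_ne_top _ _)) h1⟩

theorem Reg.neg {C : ℝ≥0} {α β : ℝ} (h : Reg C α β φ) :
    Reg C (-β) (-α) (fun x => φ (-x)) := by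
  intro x y hxy
  obtain ⟨h1, h2⟩ := h (-y) (-x) (by linarith)
  rw [show -x - -y = y - x by ring] at h1 h2
  rw [neg_neg]
  exact ⟨h2, h1⟩

/-- Moving the endpoint by $y-x$ amounts to translating the function by $y-x$, and regular growth
compares a function with its translate by a factor depending on $y-x$ alone. -/
theorem Reg.L_Iio {C : ℝ≥0} {α β : ℝ} (h0 : q ≠ 0) (h : Reg C α β φ) :
    Reg C α β (fun x => L q (Iio x) φ) := by
  intro x y hxy
  have key : L q (Iio y) φ = L q (Iio x) (fun u => φ (u + (y - x))) := by
    rw [← L_Iio_add]; congr 2; ring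
  have hu : ∀ u, u + (y - x) - u = y - x := fun u => by ring
  constructor
  · dsimp only
    rw [key]
    refine L_le_mul h0 measurableSet_Iio (ENNReal.mul_ne_top ENNReal.coe_ne_top (E_ne_top _ _))
      fun u _ => ?_
    have := (h u (u + (y - x)) (by linarith)).1
    rwa [hu] at this
  · dsimp only
    rw [key]
    refine L_le_mul h0 measurableSet_Iio (ENNReal.mul_ne_top ENNReal.coe_ne_top (E_ne_top _ _))
      fun u _ => ?_
    have := (h u (u + (y - x)) (by linarith)).2
    rwa [hu] at this

theorem Reg.L_Ioi {C : ℝ≥0} {α β : ℝ} (h0 : q ≠ 0) (h : Reg C α β φ) :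
    Reg C α β (fun x => L q (Ioi x) φ) := by
  have := (h.neg.L_Iio h0).neg
  simp_rw [← L_Ioi_neg, neg_neg] at this
  exact this

/-- A constant comparing the values of a regular function at points at distance at most `M`. -/
theorem Reg.comparable (C : ℝ≥0) (α β M : ℝ) : ∃ D : ℝ≥0, ∀ φ, Reg C α β φ →
    ∀ x y, |x - y| ≤ M → φ x ≤ D * φ y := by
  refine ⟨C * (Real.exp ((|α| + |β|) * M)).toNNReal, fun φ h x y hxy => ?_⟩
  have aux : ∀ γ d : ℝ, |γ| ≤ |α| + |β| → 0 ≤ d → d ≤ M →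
      (C : ℝ≥0∞) * E γ d ≤ ↑(C * (Real.exp ((|α| + |β|) * M)).toNNReal) := by
    intro γ d hγ hd hM
    rw [ENNReal.coe_mul]
    refine mul_le_mul_right (ENNReal.ofReal_le_ofReal (Real.exp_le_exp.2 ?_)) _
    calc γ * d ≤ |γ| * d := mul_le_mul_of_nonneg_right (le_abs_self _) hd
      _ ≤ _ := mul_le_mul hγ hM hd (by positivity)
  rcases le_total x y with hle | hle
  · rw [abs_sub_comm, abs_of_nonneg (by linarith)] at hxy
    refine (h x y hle).2.trans (mul_le_mul_left (aux _ _ ?_ (by linarith) hxy) _)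
    rw [abs_neg]; linarith [abs_nonneg β]
  · rw [abs_of_nonneg (by linarith)] at hxy
    refine (h y x hle).1.trans (mul_le_mul_left (aux _ _ ?_ (by linarith) hxy) _)
    linarith [abs_nonneg α]

/-- A constant has norm equal to itself on a unit interval for every exponent, and regular growth
makes the function nearly constant there. -/
theorem Reg.le_L_Ioo (h0 : q ≠ 0) (C : ℝ≥0) (α β : ℝ) : ∃ D : ℝ≥0, ∀ φ, Reg C α β φ →
    ∀ x, φ x ≤ D * L q (Ioo x (x + 1)) φ := by
  obtain ⟨D, hD⟩ := Reg.comparable C α β 1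
  refine ⟨D, fun φ h x => ?_⟩
  calc φ x = L q (Ioo x (x + 1)) (fun _ => φ x) := (L_unit_const h0 x _).symm
    _ ≤ _ := L_le_mul h0 measurableSet_Ioo ENNReal.coe_ne_top fun u hu => hD φ h x u (by
        rw [abs_sub_comm, abs_le]; constructor <;> linarith [hu.1, hu.2])

theorem Reg.le_L_Ioi (h0 : q ≠ 0) (C : ℝ≥0) (α β : ℝ) : ∃ D : ℝ≥0, ∀ φ, Reg C α β φ →
    ∀ x, φ x ≤ D * L q (Ioi x) φ := by
  obtain ⟨D, hD⟩ := Reg.le_L_Ioo h0 C α β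
  exact ⟨D, fun φ h x => (hD φ h x).trans (mul_le_mul_right (L_mono_set Ioo_subset_Ioi_self) _)⟩

theorem Reg.le_L_Iio (h0 : q ≠ 0) (C : ℝ≥0) (α β : ℝ) : ∃ D : ℝ≥0, ∀ φ, Reg C α β φ →
    ∀ x, φ x ≤ D * L q (Iio x) φ := by
  obtain ⟨D, hD⟩ := Reg.le_L_Ioi h0 C (-β) (-α)
  refine ⟨D, fun φ h x => ?_⟩
  have := hD _ h.neg (-x)
  rw [← L_Iio_neg, neg_neg] at this
  exact this

theorem lintegral_E_Iio_ne_top {γ : ℝ} (hγ : 0 < γ) : ∫⁻ x in Iio 0, E γ x ≠ ∞ := by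
  have h : IntegrableOn (fun x : ℝ => Real.exp (γ * x)) (Iio 0) :=
    (integrableOn_exp_mul_Iic hγ 0).mono_set Iio_subset_Iic_self
  have := h.2
  rw [HasFiniteIntegral] at this
  refine ne_of_lt (lt_of_le_of_lt (le_of_eq ?_) this)
  refine lintegral_congr fun x => ?_
  rw [E, Real.enorm_eq_ofReal (Real.exp_pos _).le]

theorem L_E_Iio_zero_ne_top (h0 : q ≠ 0) {γ : ℝ} (hγ : 0 < γ) : L q (Iio 0) (E γ) ≠ ∞ := by
  by_cases ht : q = ∞
  · subst ht
    rw [L_top]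
    refine ne_of_lt (lt_of_le_of_lt (essSup_le_of_ae_le 1 ?_) ENNReal.one_lt_top)
    refine (ae_restrict_iff' measurableSet_Iio).2 (Eventually.of_forall fun x hx => ?_)
    have hx' : x < 0 := hx
    simpa using E_le_E_right hγ.le hx'.le
  · have hq : 0 < q.toReal := ENNReal.toReal_pos h0 ht
    rw [L_eq h0 ht]
    refine ENNReal.rpow_ne_top_of_nonneg (by positivity) ?_
    simp_rw [E_rpow]
    exact lintegral_E_Iio_ne_top (by positivity)

theorem L_E_Iio_le (h0 : q ≠ 0) {γ : ℝ} (hγ : 0 < γ) :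
    ∃ D : ℝ≥0, ∀ x, L q (Iio x) (E γ) ≤ D * E γ x := by
  refine ⟨(L q (Iio 0) (E γ)).toNNReal, fun x => ?_⟩
  rw [ENNReal.coe_toNNReal (L_E_Iio_zero_ne_top h0 hγ)]
  calc L q (Iio x) (E γ) = L q (Iio (0 + x)) (E γ) := by rw [zero_add]
    _ = L q (Iio 0) (fun u => E γ (u + x)) := L_Iio_add 0 x
    _ = L q (Iio 0) (fun u => E γ x * E γ u) := by simp_rw [E_add_right, mul_comm]
    _ = E γ x * L q (Iio 0) (E γ) := L_mul h0 (E_ne_top _ _)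
    _ ≤ _ := (mul_comm _ _).le

/-- A positive lower growth rate gives $\varphi(u)\lesssim e^{-\alpha(x-u)}\varphi(x)$ for $u<x$, so
the norm is governed by the endpoint. -/
theorem Reg.L_Iio_le (h0 : q ≠ 0) (C : ℝ≥0) {α : ℝ} (β : ℝ) (hα : 0 < α) :
    ∃ D : ℝ≥0, ∀ φ, Reg C α β φ → ∀ x, L q (Iio x) φ ≤ D * φ x := by
  obtain ⟨D, hD⟩ := L_E_Iio_le h0 hα
  refine ⟨C * D, fun φ h x => ?_⟩
  have hb : ∀ u ∈ Iio x, φ u ≤ (C * E (-α) x * φ x) * E α u := fun u hu => by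
    have := (h u x (le_of_lt hu)).2
    rw [E_sub_right, neg_neg] at this
    exact this.trans (le_of_eq (by ring))
  calc L q (Iio x) φ ≤ L q (Iio x) (fun u => (C * E (-α) x * φ x) * E α u) :=
        L_mono measurableSet_Iio hb
    -- The factor may be infinite; measurability of the exponential is what allows it to be taken
    -- out.
    _ = (C * E (-α) x * φ x) * L q (Iio x) (E α) := L_mul_of_measurable h0 _ (measurable_E _)
    _ ≤ (C * E (-α) x * φ x) * (D * E α x) := by gcongr; exact hD x
    _ = ↑(C * D) * φ x * (E α x * E (-α) x) := by push_cast; ring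
    _ = _ := by rw [E_mul_neg, mul_one]

theorem Reg.L_Ioi_le (h0 : q ≠ 0) (C : ℝ≥0) (α : ℝ) {β : ℝ} (hβ : β < 0) :
    ∃ D : ℝ≥0, ∀ φ, Reg C α β φ → ∀ x, L q (Ioi x) φ ≤ D * φ x := by
  obtain ⟨D, hD⟩ := Reg.L_Iio_le h0 C (-α) (neg_pos.2 hβ)
  refine ⟨D, fun φ h x => ?_⟩
  have := hD _ h.neg (-x)
  rw [← L_Ioi_neg, neg_neg] at this
  exact this

/-! ### Measurable substitutes -/

theorem measurable_comp_floor {X : Type*} [MeasurableSpace X] (f : ℝ → X) :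
    Measurable (fun x : ℝ => f ⌊x⌋) :=
  (measurable_from_top (f := fun n : ℤ => f n)).comp Int.measurable_floor

theorem abs_sub_floor_le (x : ℝ) : |x - (⌊x⌋ : ℤ)| ≤ 1 := by
  rw [abs_le]; constructor <;> linarith [Int.floor_le x, Int.lt_floor_add_one x]

/-- Any function of $\lfloor x\rfloor$ is measurable, and rounding moves the argument by at most
one. -/
theorem Reg.floor (C : ℝ≥0) (α β : ℝ) : ∃ D : ℝ≥0, ∀ φ, Reg C α β φ →
    ∀ x : ℝ, φ x ≤ D * φ ⌊x⌋ ∧ φ ⌊x⌋ ≤ D * φ x := by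
  obtain ⟨D, hD⟩ := Reg.comparable C α β 1
  exact ⟨D, fun φ h x => ⟨hD φ h _ _ (abs_sub_floor_le x),
    hD φ h _ _ (by rw [abs_sub_comm]; exact abs_sub_floor_le x)⟩⟩

/-- The weight is sampled at integers to make the first summand measurable; `m` will be a monotone
inner norm. The factor `max D 1` is at least one so that it can be put on `ψ` as well. -/
theorem Reg.L_mul_add_le (h0 : q ≠ 0) (C : ℝ≥0) (α β : ℝ) : ∃ D : ℝ≥0,
    ∀ I, MeasurableSet I → ∀ w, Reg C α β w → ∀ m : ℝ → ℝ≥0∞, Measurable m → ∀ ψ : ℝ → ℝ≥0∞,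
    L q I (fun x => w x * m x + ψ x) ≤ D * (L q I (fun x => w x * m x) + L q I ψ) := by
  obtain ⟨D, hD⟩ := Reg.floor C α β
  obtain ⟨B, hB⟩ := L_add_le h0
  refine ⟨(max D 1) * B * (max D 1), fun I hI w h m hm ψ => ?_⟩
  have hD1 : (D : ℝ≥0∞) ≤ ↑(max D 1) := by exact_mod_cast le_max_left _ _
  have h11 : (1 : ℝ≥0∞) ≤ ↑(max D 1) := by exact_mod_cast le_max_right _ _
  have hmeas : Measurable (fun x : ℝ => w ⌊x⌋ * m x) := (measurable_comp_floor w).mul hm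
  calc L q I (fun x => w x * m x + ψ x)
      ≤ ↑(max D 1) * L q I (fun x => w ⌊x⌋ * m x + ψ x) := by
        refine L_le_mul h0 hI ENNReal.coe_ne_top fun x _ => ?_
        rw [mul_add, ← mul_assoc]
        refine add_le_add (mul_le_mul_left ((hD w h x).1.trans (by gcongr)) _) ?_
        exact le_mul_of_one_le_left' h11
    _ ≤ ↑(max D 1) * (B * (L q I (fun x => w ⌊x⌋ * m x) + L q I ψ)) := by
        gcongr; exact hB I _ ψ hmeas
    _ ≤ ↑(max D 1) * (B * (↑(max D 1) * L q I (fun x => w x * m x) + ↑(max D 1) * L q I ψ)) := by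
        gcongr
        · refine L_le_mul h0 hI ENNReal.coe_ne_top fun x _ => ?_
          rw [← mul_assoc]
          exact mul_le_mul_left ((hD w h x).2.trans (by gcongr)) _
        · exact le_mul_of_one_le_left' h11
    _ = _ := by push_cast; ring

theorem Reg.L_add_le (h0 : q ≠ 0) (C : ℝ≥0) (α β : ℝ) : ∃ D : ℝ≥0,
    ∀ I, MeasurableSet I → ∀ φ, Reg C α β φ → ∀ ψ : ℝ → ℝ≥0∞,
    L q I (fun x => φ x + ψ x) ≤ D * (L q I φ + L q I ψ) := by
  obtain ⟨D, hD⟩ := Reg.L_mul_add_le h0 C α β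
  refine ⟨D, fun I hI φ h ψ => ?_⟩
  simpa using hD I hI φ h (fun _ => 1) measurable_const ψ

/-! ### Hardy's inequalities -/

theorem lintegral_Ioi_E (γ u : ℝ) :
    ∫⁻ t in Ioi u, E (-γ) t = E (-γ) u * ∫⁻ t in Iio 0, E γ t := by
  have h := fun u => L_eq (q := 1) (I := Ioi u) (φ := E (-γ)) one_ne_zero ENNReal.one_ne_top
  have h' := L_eq (q := 1) (I := Iio 0) (φ := E γ) one_ne_zero ENNReal.one_ne_top
  simp only [ENNReal.toReal_one, ENNReal.rpow_one, div_one] at h h'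
  rw [← h, ← h']
  calc L 1 (Ioi u) (E (-γ)) = L 1 (Ioi (0 + u)) (E (-γ)) := by rw [zero_add]
    _ = L 1 (Ioi 0) (fun t => E (-γ) (t + u)) := L_Ioi_add 0 u
    _ = L 1 (Ioi 0) (fun t => E (-γ) u * E (-γ) t) := by simp_rw [E_add_right, mul_comm]
    _ = E (-γ) u * L 1 (Ioi 0) (E (-γ)) := L_mul one_ne_zero (E_ne_top _ _)
    _ = E (-γ) u * L 1 (Iio 0) (E γ) := by
      rw [← neg_zero, L_Ioi_neg, neg_zero]
      simp_rw [E_neg_right, neg_neg]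

/-- With equal inner and outer exponents the $q$-th power is a double integral over $u<t$, and
Tonelli's theorem leaves the exponential integral as constant. No convexity enters, so $q<1$ is
allowed. -/
theorem L_hardy_pow (h0 : q ≠ 0) {γ : ℝ} (hγ : 0 < γ) : ∃ D : ℝ≥0, ∀ g, Measurable g →
    L q univ (fun t => E (-γ) t * L q (Iio t) (fun u => E γ u * g u)) ≤ D * L q univ g := by
  by_cases ht : q = ∞
  · subst ht
    refine ⟨1, fun g _ => ?_⟩
    rw [ENNReal.coe_one, one_mul, L_top (I := univ)]
    refine essSup_le_of_ae_le _ (Eventually.of_forall fun t => ?_)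
    calc E (-γ) t * L ∞ (Iio t) (fun u => E γ u * g u)
        ≤ E (-γ) t * L ∞ (Iio t) (fun u => E γ t * g u) := by
          gcongr
          exact L_mono measurableSet_Iio fun u hu =>
            mul_le_mul_left (E_le_E_right hγ.le (le_of_lt hu)) _
      _ = (E γ t * E (-γ) t) * L ∞ (Iio t) g := by
          rw [L_mul h0 (E_ne_top _ _)]; ring
      _ ≤ L ∞ univ g := by
          rw [E_mul_neg, one_mul]; exact L_mono_set (subset_univ _)
  · have hq : 0 < q.toReal := ENNReal.toReal_pos h0 ht
    set s := q.toReal with hs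
    have hfin := lintegral_E_Iio_ne_top (γ := s * γ) (by positivity)
    refine ⟨((∫⁻ t in Iio 0, E (s * γ) t) ^ (1 / s)).toNNReal, fun g hg => ?_⟩
    rw [ENNReal.coe_toNNReal (ENNReal.rpow_ne_top_of_nonneg (by positivity) hfin),
      L_eq h0 ht, L_eq h0 ht (φ := g), ← hs, ← ENNReal.mul_rpow_of_nonneg _ _ (by positivity)]
    gcongr
    simp only [Measure.restrict_univ]
    have e1 : ∀ t, (E (-γ) t * L q (Iio t) (fun u => E γ u * g u)) ^ s =
        ∫⁻ u, (Iio t).indicator (fun u => E (-(s * γ)) t * (E (s * γ) u * g u ^ s)) u := by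
      intro t
      rw [lintegral_indicator measurableSet_Iio, lintegral_const_mul' _ _ (E_ne_top _ _),
        L_eq h0 ht, ENNReal.mul_rpow_of_nonneg _ _ hq.le, ← ENNReal.rpow_mul, ← hs,
        one_div_mul_cancel hq.ne', ENNReal.rpow_one, E_rpow, mul_neg]
      simp_rw [ENNReal.mul_rpow_of_nonneg _ _ hq.le, E_rpow]
    simp_rw [e1]
    have hmeas : Measurable (Function.uncurry fun t u : ℝ => (Iio t).indicator
        (fun u => E (-(s * γ)) t * (E (s * γ) u * g u ^ s)) u) := by
      have : (Function.uncurry fun t u : ℝ => (Iio t).indicator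
          (fun u => E (-(s * γ)) t * (E (s * γ) u * g u ^ s)) u) =
          {z : ℝ × ℝ | z.2 < z.1}.indicator
            (fun z => E (-(s * γ)) z.1 * (E (s * γ) z.2 * g z.2 ^ s)) := by
        ext z; rcases z with ⟨t, u⟩; simp [indicator]
      rw [this]
      refine Measurable.indicator ?_ (measurableSet_lt measurable_snd measurable_fst)
      exact ((measurable_E _).comp measurable_fst).mul (((measurable_E _).comp measurable_snd).mul
        ((hg.comp measurable_snd).pow_const _))
    rw [lintegral_lintegral_swap hmeas.aemeasurable]
    have e2 : ∀ u, ∫⁻ t, (Iio t).indicator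
        (fun u => E (-(s * γ)) t * (E (s * γ) u * g u ^ s)) u =
        (∫⁻ t in Iio 0, E (s * γ) t) * g u ^ s := by
      intro u
      have : ∀ t, (Iio t).indicator (fun u => E (-(s * γ)) t * (E (s * γ) u * g u ^ s)) u =
          (Ioi u).indicator (fun t => E (-(s * γ)) t * (E (s * γ) u * g u ^ s)) t := by
        intro t; simp [indicator]
      simp_rw [this]
      rw [lintegral_indicator measurableSet_Ioi, lintegral_mul_const _ (measurable_E _),
        lintegral_Ioi_E]
      calc E (-(s * γ)) u * (∫⁻ t in Iio 0, E (s * γ) t) * (E (s * γ) u * g u ^ s)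
          = (E (s * γ) u * E (-(s * γ)) u) * ((∫⁻ t in Iio 0, E (s * γ) t) * g u ^ s) := by ring
        _ = _ := by rw [E_mul_neg, one_mul]
    simp_rw [e2]
    rw [lintegral_const_mul' _ _ hfin]

/-- The exponents `p` and `q` are unrelated: regular growth bounds each value of the integrand by an
$L_q$ norm, after which only an exponential remains inside the $L_p$ norm. -/
theorem L_hardy_Iio (h0 : q ≠ 0) (h0' : p ≠ 0) (C : ℝ≥0) (α β γ : ℝ) (D : ℝ≥0) (δ : ℝ)
    (hδ : δ < 0) : ∃ B : ℝ≥0, ∀ v φ, Reg C α β φ → Reg D γ δ v →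
    L q univ (fun t => v t * L p (Iio t) φ) ≤ B * L q univ (fun t => v t * φ t) := by
  -- Half of the decay rate of the weight makes the inner $L_p$ norm converge; the other half is
  -- kept for `L_hardy_pow`.
  obtain ⟨ε, hε⟩ : ∃ ε : ℝ, ε = -δ / 2 := ⟨_, rfl⟩
  have hε0 : 0 < ε := by rw [hε]; linarith
  obtain ⟨B₁, hB₁⟩ := Reg.le_L_Iio h0 (1 * (D * C)) (ε + (γ + α)) (ε + (δ + β))
  obtain ⟨B₂, hB₂⟩ := L_E_Iio_le h0' hε0
  obtain ⟨B₃, hB₃⟩ := L_hardy_pow h0 hε0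
  obtain ⟨B₄, hB₄⟩ := Reg.floor (D * C) (γ + α) (δ + β)
  refine ⟨D * B₁ * B₂ * B₄ * B₃ * B₄, fun v φ hφ hv => ?_⟩
  obtain ⟨g, hg⟩ : ∃ g : ℝ → ℝ≥0∞, g = fun t => v t * φ t := ⟨_, rfl⟩
  have hgr : Reg (D * C) (γ + α) (δ + β) g := hg ▸ hv.mul hφ
  rw [← hg]
  have hpt : ∀ t, v t * L p (Iio t) φ ≤
      (D * B₁ * B₂) * (E (-ε) t * L q (Iio t) (fun u => E ε u * g u)) := by
    intro t
    have hin : ∀ u ∈ Iio t, v t * φ u ≤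
        (D * B₁ * E δ t * L q (Iio t) (fun u => E ε u * g u)) * E ε u := by
      intro u hu
      have h1 := (hv u t (le_of_lt hu)).1
      have h2 : E ε u * g u ≤ B₁ * L q (Iio t) (fun u => E ε u * g u) := by
        have h3 := hB₁ _ ((reg_E ε).mul hgr) u
        refine h3.trans ?_
        gcongr
        exact L_mono_set (Iio_subset_Iio (le_of_lt hu))
      calc v t * φ u ≤ D * E δ (t - u) * v u * φ u := by gcongr
        _ = D * E δ t * E ε u * (E ε u * g u) := by
          rw [E_sub_right, hg, show -δ = ε + ε by rw [hε]; ring, E_add_left]; ring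
        _ ≤ D * E δ t * E ε u * (B₁ * L q (Iio t) (fun u => E ε u * g u)) := by gcongr
        _ = _ := by ring
    calc v t * L p (Iio t) φ ≤ L p (Iio t) (fun u => v t * φ u) := mul_L_le h0' _
      _ ≤ L p (Iio t) (fun u => (D * B₁ * E δ t * L q (Iio t) (fun u => E ε u * g u)) * E ε u) :=
          L_mono measurableSet_Iio hin
      _ = (D * B₁ * E δ t * L q (Iio t) (fun u => E ε u * g u)) * L p (Iio t) (E ε) :=
          L_mul_of_measurable h0' _ (measurable_E _)
      _ ≤ (D * B₁ * E δ t * L q (Iio t) (fun u => E ε u * g u)) * (B₂ * E ε t) := by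
          gcongr; exact hB₂ t
      _ = (D * B₁ * B₂) * ((E δ t * E ε t) * L q (Iio t) (fun u => E ε u * g u)) := by ring
      _ = _ := by rw [← E_add_left]; congr 4; rw [hε]; ring
  have hfl : ∀ t, L q (Iio t) (fun u => E ε u * g u) ≤
      B₄ * L q (Iio t) (fun u => E ε u * g ⌊u⌋) := fun t =>
    L_le_mul h0 measurableSet_Iio ENNReal.coe_ne_top fun u _ => by
      calc E ε u * g u ≤ E ε u * (B₄ * g ⌊u⌋) := by gcongr; exact (hB₄ g hgr u).1
        _ = _ := by ring
  calc L q univ (fun t => v t * L p (Iio t) φ)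
      ≤ ↑(D * B₁ * B₂ * B₄) * L q univ
          (fun t => E (-ε) t * L q (Iio t) (fun u => E ε u * g ⌊u⌋)) := by
        refine L_le_mul h0 MeasurableSet.univ ENNReal.coe_ne_top fun t _ => (hpt t).trans ?_
        push_cast
        calc (D * B₁ * B₂) * (E (-ε) t * L q (Iio t) (fun u => E ε u * g u))
            ≤ (D * B₁ * B₂) * (E (-ε) t * (B₄ * L q (Iio t) (fun u => E ε u * g ⌊u⌋))) := by
              gcongr; exact hfl t
          _ = _ := by ring
    _ ≤ ↑(D * B₁ * B₂ * B₄) * (B₃ * L q univ (fun u : ℝ => g ⌊u⌋)) := by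
        gcongr; exact hB₃ _ (measurable_comp_floor g)
    _ ≤ ↑(D * B₁ * B₂ * B₄) * (B₃ * (B₄ * L q univ g)) := by
        gcongr
        exact L_le_mul h0 MeasurableSet.univ ENNReal.coe_ne_top fun u _ => (hB₄ g hgr u).2
    _ = _ := by push_cast; ring

theorem L_hardy_Ioi (h0 : q ≠ 0) (h0' : p ≠ 0) (C : ℝ≥0) (α β : ℝ) (D : ℝ≥0) (γ δ : ℝ)
    (hγ : 0 < γ) : ∃ B : ℝ≥0, ∀ v φ, Reg C α β φ → Reg D γ δ v →
    L q univ (fun t => v t * L p (Ioi t) φ) ≤ B * L q univ (fun t => v t * φ t) := by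
  obtain ⟨B, hB⟩ := L_hardy_Iio h0 h0' C (-β) (-α) (-δ) D (-γ) (by linarith)
  refine ⟨B, fun v φ hφ hv => ?_⟩
  have := hB _ _ hφ.neg hv.neg
  rw [L_univ_neg, L_univ_neg (φ := fun t => v t * φ t)]
  simpa only [L_Ioi_neg] using this

/-! ### Change of variables -/

/-- By Tonelli's theorem, it is enough that a given $u$ lies in the window of $x$ only for $x$ in a
set of measure at most $2\ell$. -/
theorem L_unit_windows_le (h0 : q ≠ 0) {S : ℝ → ℝ} (hS : Measurable S) (ℓ : ℝ)
    (hℓ : ∀ x y, |S x - S y| ≤ 1 → |x - y| ≤ ℓ) : ∃ N : ℝ≥0, ∀ ψ : ℝ → ℝ≥0∞, Measurable ψ →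
    L q univ (fun x => L q (Ioo (S x) (S x + 1)) ψ) ≤ N * L q univ ψ := by
  by_cases ht : q = ∞
  · subst ht
    refine ⟨1, fun ψ _ => ?_⟩
    rw [ENNReal.coe_one, one_mul, L_top (I := univ)]
    exact essSup_le_of_ae_le _ (Eventually.of_forall fun x => L_mono_set (subset_univ _))
  · have hq : 0 < q.toReal := ENNReal.toReal_pos h0 ht
    set s := q.toReal with hs
    refine ⟨((ENNReal.ofReal (2 * ℓ)) ^ (1 / s)).toNNReal, fun ψ hψ => ?_⟩
    rw [ENNReal.coe_toNNReal (ENNReal.rpow_ne_top_of_nonneg (by positivity) ENNReal.ofReal_ne_top),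
      L_eq h0 ht, L_eq h0 ht (φ := ψ), ← hs, ← ENNReal.mul_rpow_of_nonneg _ _ (by positivity)]
    gcongr
    simp only [Measure.restrict_univ]
    have e1 : ∀ x, L q (Ioo (S x) (S x + 1)) ψ ^ s =
        ∫⁻ u, (Ioo (S x) (S x + 1)).indicator (fun u => ψ u ^ s) u := by
      intro x
      rw [lintegral_indicator measurableSet_Ioo, L_eq h0 ht, ← ENNReal.rpow_mul, ← hs,
        one_div_mul_cancel hq.ne', ENNReal.rpow_one]
    simp_rw [e1]
    have hmeas : Measurable (Function.uncurry fun x u : ℝ =>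
        (Ioo (S x) (S x + 1)).indicator (fun u => ψ u ^ s) u) := by
      have : (Function.uncurry fun x u : ℝ =>
          (Ioo (S x) (S x + 1)).indicator (fun u => ψ u ^ s) u) =
          ({z : ℝ × ℝ | S z.1 < z.2} ∩ {z : ℝ × ℝ | z.2 < S z.1 + 1}).indicator
            (fun z => ψ z.2 ^ s) := by
        ext z; rcases z with ⟨t, u⟩; simp [indicator]
      rw [this]
      have h1 : Measurable fun z : ℝ × ℝ => S z.1 := hS.comp measurable_fst
      refine Measurable.indicator ((hψ.comp measurable_snd).pow_const _)
        ((measurableSet_lt h1 measurable_snd).inter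
          (measurableSet_lt measurable_snd (h1.add_const 1)))
    rw [lintegral_lintegral_swap hmeas.aemeasurable, ← lintegral_const_mul _ (hψ.pow_const _)]
    refine lintegral_mono fun u => ?_
    have hset : MeasurableSet {x | u ∈ Ioo (S x) (S x + 1)} :=
      (measurableSet_lt hS measurable_const).inter
        (measurableSet_lt measurable_const (hS.add_const 1))
    have : ∀ x, (Ioo (S x) (S x + 1)).indicator (fun u => ψ u ^ s) u =
        {x | u ∈ Ioo (S x) (S x + 1)}.indicator (fun _ => ψ u ^ s) x := by
      intro x; simp [indicator]
    simp_rw [this]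
    rw [lintegral_indicator hset, setLIntegral_const, mul_comm]
    gcongr
    rcases eq_empty_or_nonempty {x | u ∈ Ioo (S x) (S x + 1)} with he | ⟨x₀, hx₀⟩
    · rw [he]; simp
    · have hsub : {x | u ∈ Ioo (S x) (S x + 1)} ⊆ Icc (x₀ - ℓ) (x₀ + ℓ) := by
        intro x hx
        have h1 : S x < u ∧ u < S x + 1 := hx
        have h2 : S x₀ < u ∧ u < S x₀ + 1 := hx₀
        have := abs_le.1 (hℓ x x₀ (by rw [abs_le]; constructor <;> linarith))
        constructor <;> linarith
      refine (measure_mono hsub).trans (le_of_eq ?_)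
      rw [Real.volume_Icc]; congr 1; ring

/-- No continuity or monotonicity of `R` is available. The value at `R x` is replaced by a norm over
the unit window at `R ⌊x⌋`, and the lower growth bound limits the overlap of these windows. -/
theorem L_comp_le (h0 : q ≠ 0) (C : ℝ≥0) (α β : ℝ) {R : ℝ → ℝ} {δ M : ℝ} (hδ : 0 < δ)
    (hlow : ∀ x y, x ≤ y → δ * (y - x) - M ≤ R y - R x)
    (hloc : ∀ x y, |x - y| ≤ 1 → |R x - R y| ≤ M) :
    ∃ D : ℝ≥0, ∀ φ, Reg C α β φ → L q univ (fun x => φ (R x)) ≤ D * L q univ φ := by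
  -- Growth at rate $\delta$ up to an error $M$ bounds $|\lfloor x\rfloor-\lfloor y\rfloor|$ by
  -- $(1+M)/\delta$; the final 1 accounts for the rounding.
  have hℓ : ∀ x y : ℝ, |R ⌊x⌋ - R ⌊y⌋| ≤ 1 → |x - y| ≤ (1 + M) / δ + 1 := by
    have aux : ∀ x y : ℝ, x ≤ y → |R ⌊x⌋ - R ⌊y⌋| ≤ 1 → y - x ≤ (1 + M) / δ + 1 := by
      intro x y hxy h
      have h1 := hlow ⌊x⌋ ⌊y⌋ (by exact_mod_cast Int.floor_mono hxy)
      have h2 := abs_le.1 h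
      have h3 : ((⌊y⌋ : ℝ) - ⌊x⌋) ≤ (1 + M) / δ := by
        rw [le_div_iff₀ hδ]; nlinarith [h2.1, h2.2]
      linarith [Int.floor_le x, Int.lt_floor_add_one y]
    intro x y h
    rcases le_total x y with hxy | hxy
    · rw [abs_sub_comm, abs_of_nonneg (by linarith)]; exact aux x y hxy h
    · rw [abs_of_nonneg (by linarith)]; exact aux y x hxy (by rwa [abs_sub_comm])
  obtain ⟨N, hN⟩ := L_unit_windows_le h0 (measurable_comp_floor R) _ hℓ
  obtain ⟨B₁, hB₁⟩ := Reg.comparable C α β M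
  obtain ⟨B₂, hB₂⟩ := Reg.le_L_Ioo h0 C α β
  obtain ⟨B₃, hB₃⟩ := Reg.floor C α β
  refine ⟨B₁ * B₂ * B₃ * N * B₃, fun φ h => ?_⟩
  calc L q univ (fun x => φ (R x))
      ≤ ↑(B₁ * B₂ * B₃) * L q univ
          (fun x : ℝ => L q (Ioo (R ⌊x⌋) (R ⌊x⌋ + 1)) (fun u => φ ⌊u⌋)) := by
        refine L_le_mul h0 MeasurableSet.univ ENNReal.coe_ne_top fun x _ => ?_
        calc φ (R x) ≤ B₁ * φ (R ⌊x⌋) := hB₁ φ h _ _ (hloc _ _ (abs_sub_floor_le x))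
          _ ≤ B₁ * (B₂ * L q (Ioo (R ⌊x⌋) (R ⌊x⌋ + 1)) φ) := by gcongr; exact hB₂ φ h _
          _ ≤ B₁ * (B₂ * (B₃ * L q (Ioo (R ⌊x⌋) (R ⌊x⌋ + 1)) (fun u => φ ⌊u⌋))) := by
            gcongr
            exact L_le_mul h0 measurableSet_Ioo ENNReal.coe_ne_top fun u _ => (hB₃ φ h u).1
          _ = _ := by push_cast; ring
    _ ≤ ↑(B₁ * B₂ * B₃) * (N * L q univ (fun u : ℝ => φ ⌊u⌋)) := by
        gcongr; exact hN _ (measurable_comp_floor φ)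
    _ ≤ ↑(B₁ * B₂ * B₃) * (N * (B₃ * L q univ φ)) := by
        gcongr
        exact L_le_mul h0 MeasurableSet.univ ENNReal.coe_ne_top fun u _ => (hB₃ φ h u).2
    _ = _ := by push_cast; ring

/-- Coarse affine growth: `R y - R x` lies between `δ (y - x) - M` and `D (y - x) + M`. -/
structure CoarseGrowth (R : ℝ → ℝ) (δ D M : ℝ) : Prop where
  pos : 0 < δ
  le : δ ≤ D
  nonneg : 0 ≤ M
  low : ∀ x y, x ≤ y → δ * (y - x) - M ≤ R y - R x
  up : ∀ x y, x ≤ y → R y - R x ≤ D * (y - x) + M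

namespace CoarseGrowth

variable {R : ℝ → ℝ} {δ D M : ℝ}

theorem abs_sub_le (h : CoarseGrowth R δ D M) {x y : ℝ} (hxy : x ≤ y) :
    |R y - R x| ≤ D * (y - x) + M := by
  have h1 := h.low x y hxy
  have h2 := h.up x y hxy
  have h3 : 0 ≤ δ * (y - x) := mul_nonneg h.pos.le (by linarith)
  have h4 : 0 ≤ D * (y - x) := mul_nonneg (h.pos.le.trans h.le) (by linarith)
  rw [abs_le]; constructor <;> linarith

theorem abs_sub_le_of_abs_le (h : CoarseGrowth R δ D M) {x y : ℝ} (hxy : |x - y| ≤ 1) :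
    |R x - R y| ≤ D + M := by
  have hD : 0 ≤ D := h.pos.le.trans h.le
  rcases le_total x y with hle | hle
  · rw [abs_sub_comm] at hxy ⊢
    refine (h.abs_sub_le hle).trans ?_
    nlinarith [le_abs_self (y - x)]
  · refine (h.abs_sub_le hle).trans ?_
    nlinarith [le_abs_self (x - y)]

/-- Since `R` may step back by as much as $M$, the growth exponents are taken symmetric and the
distance $|Ry-Rx|$ is used. -/
theorem reg_comp (h : CoarseGrowth R δ D M) {C : ℝ≥0} {m : ℝ} (hm : 0 ≤ m)
    (hφ : Reg C (-m) m φ) : Reg (C * (Real.exp (m * M)).toNNReal) (-(m * D)) (m * D)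
      (fun x => φ (R x)) := by
  have key : ∀ s t : ℝ, φ s ≤ C * E m |s - t| * φ t := by
    intro s t
    rcases le_total s t with hst | hst
    · have := (hφ s t hst).2
      rwa [neg_neg, ← abs_of_nonneg (sub_nonneg.2 hst), abs_sub_comm] at this
    · have := (hφ t s hst).1
      rwa [← abs_of_nonneg (sub_nonneg.2 hst)] at this
  have hE : ∀ x y : ℝ, x ≤ y → C * E m |R y - R x| ≤
      ↑(C * (Real.exp (m * M)).toNNReal) * E (m * D) (y - x) := by
    intro x y hxy
    rw [ENNReal.coe_mul, mul_assoc]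
    gcongr
    calc E m |R y - R x| ≤ E m (D * (y - x) + M) := E_le_E_right hm (h.abs_sub_le hxy)
      _ = E m M * E (m * D) (y - x) := by
        rw [E_add_right, mul_comm]; congr 1; simp only [E]; ring_nf
      _ = _ := rfl
  intro x y hxy
  rw [neg_neg]
  refine ⟨(key _ _).trans (mul_le_mul_left (hE x y hxy) _),
    (key _ _).trans (mul_le_mul_left ?_ _)⟩
  rw [abs_sub_comm]; exact hE x y hxy

/-- Near the supremum of $\{R\le t\}$ there is $s$ with $R(s)\le t<R(s+1)$, and a unit step raises
`R` by at most $D+M$. -/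
theorem exists_near (h : CoarseGrowth R δ D M) (t : ℝ) : ∃ s, |R s - t| ≤ D + M := by
  have hδ := h.pos
  have hne : {s | R s ≤ t}.Nonempty := by
    refine ⟨min 0 ((t - R 0 - M) / δ), ?_⟩
    have h1 := h.low (min 0 ((t - R 0 - M) / δ)) 0 (min_le_left _ _)
    have h2 : δ * min 0 ((t - R 0 - M) / δ) ≤ t - R 0 - M := by
      calc δ * min 0 ((t - R 0 - M) / δ) ≤ δ * ((t - R 0 - M) / δ) :=
            mul_le_mul_of_nonneg_left (min_le_right _ _) hδ.le
        _ = _ := by field_simp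
    show R _ ≤ t
    linarith
  have hbdd : BddAbove {s | R s ≤ t} := by
    refine ⟨max 0 ((t - R 0 + M) / δ), fun s hs => ?_⟩
    have hs' : R s ≤ t := hs
    rcases le_total s 0 with h0 | h0
    · exact h0.trans (le_max_left _ _)
    · refine le_trans ?_ (le_max_right _ _)
      rw [le_div_iff₀ hδ]
      linarith [h.low 0 s h0]
  obtain ⟨s, hs, hs'⟩ := exists_lt_of_lt_csSup hne
    (show sSup {s | R s ≤ t} - 1 < sSup {s | R s ≤ t} by linarith)
  have hs1 : R s ≤ t := hs
  have hs2 : t < R (s + 1) := by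
    by_contra hcon
    have := le_csSup hbdd (show s + 1 ∈ {s | R s ≤ t} from not_lt.1 hcon)
    linarith
  have hs3 := h.up s (s + 1) (by linarith)
  refine ⟨s + 1, ?_⟩
  rw [abs_le]; constructor <;> linarith [h.nonneg, h.pos, h.le]

/-- The reverse inequality applies `L_comp_le` to a coarse inverse $\tau$ of `R` and to
$\varphi\circ R$, as $R\circ\tau$ stays at bounded distance from the identity. -/
theorem L_comp_equiv (h : CoarseGrowth R δ D M) (h0 : q ≠ 0) (C : ℝ≥0) (α β : ℝ) :
    ∃ B : ℝ≥0, ∀ φ, Reg C α β φ → L q univ (fun x => φ (R x)) ≤ B * L q univ φ ∧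
      L q univ φ ≤ B * L q univ (fun x => φ (R x)) := by
  have hδ := h.pos
  have hD : 0 < D := h.pos.trans_le h.le
  have hM := h.nonneg
  obtain ⟨B₁, hB₁⟩ := L_comp_le (M := D + M) h0 C α β hδ
    (fun x y hxy => by linarith [h.low x y hxy]) (fun x y hxy => h.abs_sub_le_of_abs_le hxy)
  choose τ hτ using h.exists_near
  -- Two displacements $|R\tau(t)-t|\le D+M$, one growth error $M$, and 1 for points at distance at
  -- most one.
  set c : ℝ := 2 * (D + M) + M + 1 with hc
  have hc0 : 0 ≤ c := by positivity
  have hτ' : ∀ t t', t ≤ t' → τ t' < τ t → δ * (τ t - τ t') ≤ c - (t' - t) := by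
    intro t t' _ hlt
    have h1 := h.low _ _ hlt.le
    have h2 := abs_le.1 (hτ t)
    have h3 := abs_le.1 (hτ t')
    rw [hc]; linarith [h2.1, h2.2, h3.1, h3.2]
  have hlow : ∀ t t', t ≤ t' → 1 / D * (t' - t) - (c / D + c / δ) ≤ τ t' - τ t := by
    intro t t' htt
    rcases le_or_gt (τ t) (τ t') with hle | hlt
    · have h1 := h.up _ _ hle
      have h2 := abs_le.1 (hτ t)
      have h3 := abs_le.1 (hτ t')
      have h4 : 1 / D * (t' - t) - c / D ≤ τ t' - τ t := by
        rw [div_mul_eq_mul_div, one_mul, ← sub_div, div_le_iff₀ hD]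
        rw [hc]; linarith [h2.1, h2.2, h3.1, h3.2]
      have : 0 ≤ c / δ := by positivity
      linarith
    · have h1 := hτ' t t' htt hlt
      have h4 : τ t - τ t' ≤ c / δ := by
        rw [le_div_iff₀ hδ]; linarith
      have h5 : 1 / D * (t' - t) ≤ c / D := by
        rw [div_mul_eq_mul_div, one_mul]
        gcongr
        linarith [mul_pos hδ (sub_pos.2 hlt)]
      linarith
  have hloc : ∀ t t', |t - t'| ≤ 1 → |τ t - τ t'| ≤ c / δ := by
    intro t t' htt
    have h2 := abs_le.1 (hτ t)
    have h3 := abs_le.1 (hτ t')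
    have h4 := abs_le.1 htt
    rw [le_div_iff₀ hδ]
    rcases le_total (τ t) (τ t') with hle | hle
    · have h1 := h.low _ _ hle
      rw [abs_sub_comm, abs_of_nonneg (by linarith), hc]; linarith [h2.1, h2.2, h3.1, h3.2]
    · have h1 := h.low _ _ hle
      rw [abs_of_nonneg (by linarith), hc]; linarith [h2.1, h2.2, h3.1, h3.2]
  have hm : (0 : ℝ) ≤ |α| + |β| := by positivity
  obtain ⟨m, hmdef⟩ : ∃ m : ℝ, m = |α| + |β| := ⟨_, rfl⟩
  rw [← hmdef] at hm
  obtain ⟨C', hC'⟩ : ∃ C' : ℝ≥0, C' = C * (Real.exp (m * M)).toNNReal := ⟨_, rfl⟩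
  obtain ⟨B₂, hB₂⟩ := L_comp_le (M := c / D + c / δ) h0 C' (-(m * D)) (m * D)
    (R := τ) (by positivity) hlow
    (fun t t' htt => (hloc t t' htt).trans (by have : 0 ≤ c / D := by positivity
                                               linarith))
  obtain ⟨B₃, hB₃⟩ := Reg.comparable C α β (D + M)
  refine ⟨max B₁ (B₃ * B₂), fun φ hφ => ⟨(hB₁ φ hφ).trans ?_, ?_⟩⟩
  · gcongr; exact le_max_left _ _
  · have hφ' : Reg C (-m) m φ := hφ.weaken le_rfl
      (by linarith [neg_abs_le α, abs_nonneg β]) (by linarith [le_abs_self β, abs_nonneg α])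
    have hreg := h.reg_comp hm hφ'
    rw [← hC'] at hreg
    calc L q univ φ ≤ B₃ * L q univ (fun t => φ (R (τ t))) :=
          L_le_mul h0 MeasurableSet.univ ENNReal.coe_ne_top fun t _ =>
            hB₃ φ hφ _ _ (by rw [abs_sub_comm]; exact hτ t)
      _ ≤ B₃ * (B₂ * L q univ (fun x => φ (R x))) := 
          mul_le_mul_right (hB₂ (fun x => φ (R x)) hreg) _
      _ = ↑(B₃ * B₂) * L q univ (fun x => φ (R x)) := by push_cast; ring
      _ ≤ _ := mul_le_mul_left (ENNReal.coe_le_coe.2 (le_max_right _ _)) _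

end CoarseGrowth

/-! ### Possibly infinite factors, and endpoints of intervals. -/

theorem Reg.const_mul {C : ℝ≥0} {α β : ℝ} (h : Reg C α β w) (c : ℝ≥0∞) :
    Reg C α β (fun x => c * w x) := by
  intro x y hxy
  obtain ⟨h1, h2⟩ := h x y hxy
  exact ⟨(mul_le_mul_right h1 c).trans (le_of_eq (by ring)),
    (mul_le_mul_right h2 c).trans (le_of_eq (by ring))⟩

/-- The factor may be infinite and the function non-measurable, so homogeneity is recovered up to a
constant by sampling at integers. -/
theorem Reg.L_const_mul_le (h0 : q ≠ 0) (C : ℝ≥0) (α β : ℝ) : ∃ D : ℝ≥0,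
    ∀ w, Reg C α β w → ∀ (I : Set ℝ), MeasurableSet I → ∀ c : ℝ≥0∞,
    L q I (fun x => c * w x) ≤ D * (c * L q I w) := by
  obtain ⟨D, hD⟩ := Reg.floor C α β
  refine ⟨D * D, fun w h I hI c => ?_⟩
  calc L q I (fun x => c * w x) ≤ D * L q I (fun x : ℝ => c * w ⌊x⌋) :=
        L_le_mul h0 hI ENNReal.coe_ne_top fun x _ =>
          (mul_le_mul_right (hD w h x).1 c).trans (le_of_eq (by ring))
    _ = D * (c * L q I (fun x : ℝ => w ⌊x⌋)) := by
        rw [L_mul_of_measurable h0 c (measurable_comp_floor w)]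
    _ ≤ D * (c * (D * L q I w)) := by
        gcongr
        exact L_le_mul h0 hI ENNReal.coe_ne_top fun x _ => (hD w h x).2
    _ = _ := by push_cast; ring

theorem L_Ici (x : ℝ) : L q (Ici x) φ = L q (Ioi x) φ := by
  rw [L, L, Measure.restrict_congr_set Ioi_ae_eq_Ici]

theorem L_Ico (x y : ℝ) : L q (Ico x y) φ = L q (Ioo x y) φ := by
  rw [L, L, Measure.restrict_congr_set Ioo_ae_eq_Ico]

/-! ## Slowly varying weights on the line -/

/-- Positive finite functions on the line whose growth is slower than every exponential. -/
structure SV (w : ℝ → ℝ≥0∞) : Prop where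
  ne_zero : ∀ x, w x ≠ 0
  ne_top : ∀ x, w x ≠ ∞
  reg : ∀ ε : ℝ, 0 < ε → ∃ C : ℝ≥0, Reg C (-ε) ε w

theorem SV.mul (h : SV φ) (h' : SV ψ) : SV (fun x => φ x * ψ x) where
  ne_zero x := mul_ne_zero (h.ne_zero x) (h'.ne_zero x)
  ne_top x := ENNReal.mul_ne_top (h.ne_top x) (h'.ne_top x)
  reg ε hε := by
    obtain ⟨C, hC⟩ := h.reg (ε / 2) (by linarith)
    obtain ⟨D, hD⟩ := h'.reg (ε / 2) (by linarith)
    exact ⟨_, (hC.mul hD).weaken le_rfl (by linarith) (by linarith)⟩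

theorem SV.add (h : SV φ) (h' : SV ψ) : SV (fun x => φ x + ψ x) where
  ne_zero x := by simp [h.ne_zero x]
  ne_top x := ENNReal.add_ne_top.2 ⟨h.ne_top x, h'.ne_top x⟩
  reg ε hε := by
    obtain ⟨C, hC⟩ := h.reg ε hε
    obtain ⟨D, hD⟩ := h'.reg ε hε
    exact ⟨_, hC.add hD⟩

theorem SV.inv (h : SV φ) : SV (fun x => (φ x)⁻¹) where
  ne_zero x := ENNReal.inv_ne_zero.2 (h.ne_top x)
  ne_top x := ENNReal.inv_ne_top.2 (h.ne_zero x)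
  reg ε hε := by
    obtain ⟨C, hC⟩ := h.reg ε hε
    have := hC.inv
    rw [neg_neg] at this
    exact ⟨_, this⟩

theorem SV.exists_le_L_Iio (h : SV w) (h0 : q ≠ 0) :
    ∃ D : ℝ≥0, ∀ x, w x ≤ D * L q (Iio x) w := by
  obtain ⟨C, hC⟩ := h.reg 1 one_pos
  obtain ⟨D, hD⟩ := Reg.le_L_Iio h0 C (-1) 1
  exact ⟨D, hD w hC⟩

theorem SV.exists_le_L_Ioi (h : SV w) (h0 : q ≠ 0) :
    ∃ D : ℝ≥0, ∀ x, w x ≤ D * L q (Ioi x) w := by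
  obtain ⟨C, hC⟩ := h.reg 1 one_pos
  obtain ⟨D, hD⟩ := Reg.le_L_Ioi h0 C (-1) 1
  exact ⟨D, hD w hC⟩

theorem SV.L_Iio (h : SV w) (h0 : q ≠ 0) (hfin : ∀ x, L q (Iio x) w ≠ ∞) :
    SV (fun x => L q (Iio x) w) where
  ne_zero x hx := by
    obtain ⟨D, hD⟩ := h.exists_le_L_Iio h0
    have := hD x
    rw [hx, mul_zero] at this
    exact h.ne_zero x (le_antisymm this zero_le)
  ne_top := hfin
  reg ε hε := by
    obtain ⟨C, hC⟩ := h.reg ε hε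
    exact ⟨C, hC.L_Iio h0⟩

theorem SV.L_Ioi (h : SV w) (h0 : q ≠ 0) (hfin : ∀ x, L q (Ioi x) w ≠ ∞) :
    SV (fun x => L q (Ioi x) w) where
  ne_zero x hx := by
    obtain ⟨D, hD⟩ := h.exists_le_L_Ioi h0
    have := hD x
    rw [hx, mul_zero] at this
    exact h.ne_zero x (le_antisymm this zero_le)
  ne_top := hfin
  reg ε hε := by
    obtain ⟨C, hC⟩ := h.reg ε hε
    exact ⟨C, hC.L_Ioi h0⟩

theorem Reg.ne_top_of_ne_top {C : ℝ≥0} {α β : ℝ} (h : Reg C α β w) {x : ℝ} (hx : w x ≠ ∞) (y : ℝ) :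
    w y ≠ ∞ := by
  obtain ⟨D, hD⟩ := Reg.comparable C α β |y - x|
  exact ne_top_of_le_ne_top (ENNReal.mul_ne_top ENNReal.coe_ne_top hx) (hD w h y x le_rfl)

/-- An exponential times a slowly varying weight. -/
theorem SV.E_mul_reg (h : SV w) (γ : ℝ) {ε : ℝ} (hε : 0 < ε) :
    ∃ C : ℝ≥0, Reg C (γ - ε) (γ + ε) (fun x => E γ x * w x) := by
  obtain ⟨C, hC⟩ := h.reg ε hε
  exact ⟨_, (reg_E γ).mul hC⟩

/-! ## Quasi-concave functions -/

/-- Quasi-concavity of `t ↦ K(t, f)` in the variable `x = log t`. -/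
structure IsK (k : ℝ → ℝ≥0∞) : Prop where
  mono : Monotone k
  le : ∀ x y, x ≤ y → k y ≤ E 1 (y - x) * k x

theorem IsK.reg {k : ℝ → ℝ≥0∞} (h : IsK k) : Reg 1 0 1 k := by
  intro x y hxy
  simpa using ⟨h.le x y hxy, h.mono hxy⟩

/-! ## The two limiting spaces as function lattices -/

/-- Parameters of the two limiting spaces, in the variable `x = log t`. -/
structure Params where
  θ : ℝ
  θ_pos : 0 < θ
  θ_lt : θ < 1
  r₀ : ℝ≥0∞
  q₀ : ℝ≥0∞
  r₁ : ℝ≥0∞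
  q₁ : ℝ≥0∞
  hr₀ : r₀ ≠ 0
  hq₀ : q₀ ≠ 0
  hr₁ : r₁ ≠ 0
  hq₁ : q₁ ≠ 0
  a₀ : ℝ → ℝ≥0∞
  b₀ : ℝ → ℝ≥0∞
  a₁ : ℝ → ℝ≥0∞
  b₁ : ℝ → ℝ≥0∞
  sv_a₀ : SV a₀
  sv_b₀ : SV b₀
  sv_a₁ : SV a₁
  sv_b₁ : SV b₁
  fin_b₀ : L r₀ (Ioi 0) b₀ ≠ ∞
  fin_b₁ : L r₁ (Ioi 0) b₁ ≠ ∞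
  fin_a₁ : L r₁ (Iio 0) (fun s => b₁ s * L q₁ (Iio s) a₁) ≠ ∞

namespace Params

variable (P : Params)

/-- The tail norm of `b₀`. -/
def β₀ (t : ℝ) : ℝ≥0∞ := L P.r₀ (Ioi t) P.b₀
/-- The tail norm of `b₁`. -/
def β₁ (t : ℝ) : ℝ≥0∞ := L P.r₁ (Ioi t) P.b₁
/-- The norm of `a₁` near zero. -/
def α₁ (t : ℝ) : ℝ≥0∞ := L P.q₁ (Iio t) P.a₁
/-- The iterated norm of `a₁` and `b₁` near zero. -/
def γ₁ (t : ℝ) : ℝ≥0∞ := L P.r₁ (Iio t) (fun s => P.b₁ s * P.α₁ s)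
/-- The weight `χ₀`. -/
def X₀ (t : ℝ) : ℝ≥0∞ := P.a₀ t * P.β₀ t
/-- The weight `χ₁`. -/
def X₁ (t : ℝ) : ℝ≥0∞ := P.γ₁ t + P.β₁ t * P.α₁ t
/-- The function `ρ`. -/
def ρ (t : ℝ) : ℝ≥0∞ := E (1 - P.θ) t * (P.X₀ t * (P.X₁ t)⁻¹)

theorem sv_β₀ : SV P.β₀ := by
  refine P.sv_b₀.L_Ioi P.hr₀ fun x => ?_
  obtain ⟨C, hC⟩ := P.sv_b₀.reg 1 one_pos
  exact (hC.L_Ioi P.hr₀).ne_top_of_ne_top P.fin_b₀ x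

theorem sv_β₁ : SV P.β₁ := by
  refine P.sv_b₁.L_Ioi P.hr₁ fun x => ?_
  obtain ⟨C, hC⟩ := P.sv_b₁.reg 1 one_pos
  exact (hC.L_Ioi P.hr₁).ne_top_of_ne_top P.fin_b₁ x

/-- Finiteness of the inner norm of $a_1$ is forced by `fin_a₁`: the value of $b_1\alpha_1$ at 0 is
bounded by its norm over $(-\infty,0)$. -/
theorem sv_α₁ : SV P.α₁ := by
  obtain ⟨C, hC⟩ := P.sv_a₁.reg 1 one_pos
  obtain ⟨D, hD⟩ := P.sv_b₁.reg 1 one_pos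
  have hα := hC.L_Iio P.hq₁
  refine P.sv_a₁.L_Iio P.hq₁ fun x => ?_
  refine hα.ne_top_of_ne_top (x := 0) (fun htop => ?_) x
  obtain ⟨B, hB⟩ := Reg.le_L_Iio P.hr₁ (D * C) (-1 + -1) (1 + 1)
  have h1 := hB _ (hD.mul hα) 0
  rw [htop, ENNReal.mul_top (P.sv_b₁.ne_zero 0), top_le_iff] at h1
  exact ENNReal.mul_ne_top ENNReal.coe_ne_top P.fin_a₁ h1

theorem sv_γ₁ : SV P.γ₁ := by
  have h := P.sv_b₁.mul P.sv_α₁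
  refine h.L_Iio P.hr₁ fun x => ?_
  obtain ⟨C, hC⟩ := h.reg 1 one_pos
  exact (hC.L_Iio P.hr₁).ne_top_of_ne_top (x := 0) P.fin_a₁ x

theorem sv_X₀ : SV P.X₀ := P.sv_a₀.mul P.sv_β₀

theorem sv_X₁ : SV P.X₁ := P.sv_γ₁.add (P.sv_β₁.mul P.sv_α₁)

theorem ρ_ne_zero (t : ℝ) : P.ρ t ≠ 0 :=
  mul_ne_zero (E_ne_zero _ _) ((P.sv_X₀.mul P.sv_X₁.inv).ne_zero t)

theorem ρ_ne_top (t : ℝ) : P.ρ t ≠ ∞ :=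
  ENNReal.mul_ne_top (E_ne_top _ _) ((P.sv_X₀.mul P.sv_X₁.inv).ne_top t)

theorem ρ_reg {ε : ℝ} (hε : 0 < ε) : ∃ C : ℝ≥0, Reg C (1 - P.θ - ε) (1 - P.θ + ε) P.ρ :=
  (P.sv_X₀.mul P.sv_X₁.inv).E_mul_reg _ hε

/-- The inner norm of the first space. -/
def F₀ (k : ℝ → ℝ≥0∞) (t : ℝ) : ℝ≥0∞ :=
  L P.q₀ (Iio t) (fun u => E (-P.θ) u * P.a₀ u * k u)
/-- The norm of the first space. -/
def N₀ (k : ℝ → ℝ≥0∞) : ℝ≥0∞ := L P.r₀ univ (fun s => P.b₀ s * P.F₀ k s)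
/-- The norm of the first space restricted to the arguments below `t`. -/
def P₀ (k : ℝ → ℝ≥0∞) (t : ℝ) : ℝ≥0∞ := L P.r₀ (Iio t) (fun s => P.b₀ s * P.F₀ k s)
/-- The contribution of the inner norm at `t`. -/
def Q₀ (k : ℝ → ℝ≥0∞) (t : ℝ) : ℝ≥0∞ := P.β₀ t * P.F₀ k t
/-- The inner norm of the second space between `t` and `s`. -/
def G₁ (k : ℝ → ℝ≥0∞) (t s : ℝ) : ℝ≥0∞ :=
  L P.q₁ (Ioo t s) (fun u => E (-1) u * P.a₁ u * k u)
/-- The inner norm of the second space. -/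
def F₁ (k : ℝ → ℝ≥0∞) (t : ℝ) : ℝ≥0∞ :=
  L P.q₁ (Iio t) (fun u => E (-1) u * P.a₁ u * k u)
/-- The norm of the second space. -/
def N₁ (k : ℝ → ℝ≥0∞) : ℝ≥0∞ := L P.r₁ univ (fun s => P.b₁ s * P.F₁ k s)
/-- The norm of the second space restricted to the arguments above `t`. -/
def R₁ (k : ℝ → ℝ≥0∞) (t : ℝ) : ℝ≥0∞ := L P.r₁ (Ioi t) (fun s => P.b₁ s * P.G₁ k t s)

/-- The weighted function `k` itself. -/
def T (k : ℝ → ℝ≥0∞) (t : ℝ) : ℝ≥0∞ := E (-P.θ) t * P.X₀ t * k t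

variable {k : ℝ → ℝ≥0∞}

/-! ### Pointwise bounds by the norms of the two limiting spaces. -/

theorem reg_in₀ : ∃ C : ℝ≥0, ∀ k, IsK k →
    Reg C (-P.θ + -1 + 0) (-P.θ + 1 + 1) (fun u => E (-P.θ) u * P.a₀ u * k u) := by
  obtain ⟨C, hC⟩ := P.sv_a₀.reg 1 one_pos
  exact ⟨_, fun k hk => ((reg_E _).mul hC).mul hk.reg⟩

theorem reg_in₁ : ∃ C : ℝ≥0, ∀ k, IsK k →
    Reg C (-1 + -1 + 0) (-1 + 1 + 1) (fun u => E (-1) u * P.a₁ u * k u) := by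
  obtain ⟨C, hC⟩ := P.sv_a₁.reg 1 one_pos
  exact ⟨_, fun k hk => ((reg_E _).mul hC).mul hk.reg⟩

theorem F₀_mono (k : ℝ → ℝ≥0∞) : Monotone (P.F₀ k) := fun _ _ h =>
  L_mono_set (Iio_subset_Iio h)

theorem F₁_mono (k : ℝ → ℝ≥0∞) : Monotone (P.F₁ k) := fun _ _ h =>
  L_mono_set (Iio_subset_Iio h)

theorem T_le_Q₀ : ∃ D : ℝ≥0, ∀ k, IsK k → ∀ t, P.T k t ≤ D * P.Q₀ k t := by
  obtain ⟨C, hC⟩ := P.reg_in₀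
  obtain ⟨D, hD⟩ := Reg.le_L_Iio P.hq₀ C (-P.θ + -1 + 0) (-P.θ + 1 + 1)
  refine ⟨D, fun k hk t => ?_⟩
  calc P.T k t = P.β₀ t * (E (-P.θ) t * P.a₀ t * k t) := by rw [T, X₀]; ring
    _ ≤ P.β₀ t * (D * P.F₀ k t) := mul_le_mul_right (hD _ (hC k hk) t) _
    _ = _ := by rw [Q₀]; ring

theorem Q₀_le_N₀ (k : ℝ → ℝ≥0∞) (t : ℝ) : P.Q₀ k t ≤ P.N₀ k := by
  calc P.Q₀ k t = P.F₀ k t * L P.r₀ (Ioi t) P.b₀ := mul_comm _ _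
    _ ≤ L P.r₀ (Ioi t) (fun s => P.F₀ k t * P.b₀ s) := mul_L_le P.hr₀ _
    _ ≤ L P.r₀ (Ioi t) (fun s => P.b₀ s * P.F₀ k s) := L_mono measurableSet_Ioi fun s hs => by
        rw [mul_comm]; gcongr; exact P.F₀_mono k (le_of_lt hs)
    _ ≤ _ := L_mono_set (subset_univ _)

theorem P₀_le_N₀ (k : ℝ → ℝ≥0∞) (t : ℝ) : P.P₀ k t ≤ P.N₀ k := L_mono_set (subset_univ _)

theorem R₁_le_N₁ (k : ℝ → ℝ≥0∞) (t : ℝ) : P.R₁ k t ≤ P.N₁ k := by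
  refine (L_mono_fun fun s => ?_).trans (L_mono_set (subset_univ _))
  gcongr
  exact L_mono_set Ioo_subset_Iio_self

/-- As $e^{-u}k(u)$ is non-increasing, its value at $t$ can be pulled out of the inner norms up to
$s\le t$. The parts $s<t$ and $s>t$ of $N_1$ then produce the two summands of $\chi_1$. -/
theorem X₁_mul_le_N₁ (hk : IsK k) (t : ℝ) : P.X₁ t * (E (-1) t * k t) ≤ 2 * P.N₁ k := by
  have hlow : ∀ s ≤ t, (E (-1) t * k t) * P.α₁ s ≤ P.F₁ k s := by
    intro s hs
    refine (mul_L_le P.hq₁ _).trans (L_mono measurableSet_Iio fun u hu => ?_)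
    have hu' : u < s := hu
    have h1 := hk.le u t (by linarith)
    rw [E_sub_right] at h1
    calc E (-1) t * k t * P.a₁ u ≤ E (-1) t * (E 1 t * E (-1) u * k u) * P.a₁ u := by gcongr
      _ = (E 1 t * E (-1) t) * (E (-1) u * P.a₁ u * k u) := by ring
      _ = _ := by rw [E_mul_neg, one_mul]
  have h1 : (E (-1) t * k t) * P.γ₁ t ≤ P.N₁ k := by
    refine (mul_L_le P.hr₁ _).trans ((L_mono measurableSet_Iio fun s hs => ?_).trans
      (L_mono_set (subset_univ _)))
    calc E (-1) t * k t * (P.b₁ s * P.α₁ s) = P.b₁ s * ((E (-1) t * k t) * P.α₁ s) := by ring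
      _ ≤ _ := by gcongr; exact hlow s (le_of_lt hs)
  have h2 : (E (-1) t * k t) * P.α₁ t * P.β₁ t ≤ P.N₁ k := by
    refine (mul_L_le P.hr₁ _).trans ((L_mono measurableSet_Ioi fun s hs => ?_).trans
      (L_mono_set (subset_univ _)))
    rw [mul_comm]
    gcongr
    exact (hlow t le_rfl).trans (P.F₁_mono k (le_of_lt hs))
  calc P.X₁ t * (E (-1) t * k t)
      = (E (-1) t * k t) * P.γ₁ t + (E (-1) t * k t) * P.α₁ t * P.β₁ t := by rw [X₁]; ring
    _ ≤ P.N₁ k + P.N₁ k := add_le_add h1 h2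
    _ = _ := (two_mul _).symm

/-- `X₁_mul_le_N₁` bounds $k(u)$ by $2N_1e^u/\chi_1(u)$. The resulting integrands have growth rate
near $1-\theta_0>0$, so both norms collapse to the endpoint $t$, where $\beta_0w=\rho$ and
$b_0\lesssim\beta_0$. -/
theorem P₀_add_Q₀_le_N₁ : ∃ D : ℝ≥0, ∀ k, IsK k → ∀ t,
    P.P₀ k t + P.Q₀ k t ≤ D * (P.ρ t * P.N₁ k) := by
  have hθ : 0 < (1 - P.θ) / 2 := by linarith [P.θ_lt]
  have hw₁ := P.sv_a₀.mul P.sv_X₁.inv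
  obtain ⟨C, hC⟩ := hw₁.E_mul_reg (1 - P.θ) hθ
  obtain ⟨C', hC'⟩ := (P.sv_b₀.mul hw₁).E_mul_reg (1 - P.θ) hθ
  obtain ⟨D, hD⟩ := Reg.L_Iio_le P.hq₀ C (α := 1 - P.θ - (1 - P.θ) / 2)
    (1 - P.θ + (1 - P.θ) / 2) (by linarith)
  obtain ⟨D', hD'⟩ := Reg.L_Iio_le P.hr₀ C' (α := 1 - P.θ - (1 - P.θ) / 2)
    (1 - P.θ + (1 - P.θ) / 2) (by linarith)
  obtain ⟨B, hB⟩ := P.sv_b₀.exists_le_L_Ioi P.hr₀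
  refine ⟨2 * D * D' * B + 2 * D, fun k hk t => ?_⟩
  set N := P.N₁ k with hN
  set w : ℝ → ℝ≥0∞ := fun x => E (1 - P.θ) x * (P.a₀ x * (P.X₁ x)⁻¹) with hw
  have hF : ∀ s, P.F₀ k s ≤ 2 * D * N * w s := by
    intro s
    have h1 : P.F₀ k s ≤ L P.q₀ (Iio s) (fun u => (2 * N) * w u) := by
      refine L_mono_fun fun u => ?_
      have h2 := P.X₁_mul_le_N₁ hk u
      calc E (-P.θ) u * P.a₀ u * k u
          = (P.X₁ u * (P.X₁ u)⁻¹) * (E 1 u * E (-1) u) * (E (-P.θ) u * P.a₀ u * k u) := by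
            rw [E_mul_neg, ENNReal.mul_inv_cancel (P.sv_X₁.ne_zero u) (P.sv_X₁.ne_top u)]; ring
        _ = (P.X₁ u * (E (-1) u * k u)) * (E 1 u * E (-P.θ) u) * P.a₀ u * (P.X₁ u)⁻¹ := by ring
        _ ≤ (2 * N) * (E 1 u * E (-P.θ) u) * P.a₀ u * (P.X₁ u)⁻¹ := by gcongr
        _ = (2 * N) * w u := by rw [← E_add_left, hw, ← sub_eq_add_neg]; ring
    refine h1.trans ((hD _ (hC.const_mul _) s).trans (le_of_eq (by ring)))
  have hρ : P.β₀ t * w t = P.ρ t := by rw [hw, ρ, X₀]; ring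
  have hQ : P.Q₀ k t ≤ ↑(2 * D) * (P.ρ t * N) := by
    calc P.Q₀ k t ≤ P.β₀ t * (2 * D * N * w t) := by rw [Q₀]; gcongr; exact hF t
      _ = ↑(2 * D) * (P.β₀ t * w t * N) := by push_cast; ring
      _ = _ := by rw [hρ]
  have hP : P.P₀ k t ≤ ↑(2 * D * D' * B) * (P.ρ t * N) := by
    calc P.P₀ k t ≤ L P.r₀ (Iio t) (fun s => (2 * D * N) *
            (E (1 - P.θ) s * (P.b₀ s * (P.a₀ s * (P.X₁ s)⁻¹)))) := by
          refine L_mono_fun fun s => ?_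
          calc P.b₀ s * P.F₀ k s ≤ P.b₀ s * (2 * D * N * w s) := by gcongr; exact hF s
            _ = _ := by rw [hw]; ring
      _ ≤ D' * ((2 * D * N) * (E (1 - P.θ) t * (P.b₀ t * (P.a₀ t * (P.X₁ t)⁻¹)))) :=
          hD' _ (hC'.const_mul _) t
      _ = D' * (2 * D * N) * w t * P.b₀ t := by rw [hw]; ring
      _ ≤ D' * (2 * D * N) * w t * (B * P.β₀ t) := by gcongr; exact hB t
      _ = ↑(2 * D * D' * B) * (P.β₀ t * w t * N) := by push_cast; ring
      _ = _ := by rw [hρ]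
  calc P.P₀ k t + P.Q₀ k t ≤ _ := add_le_add hP hQ
    _ = _ := by push_cast; ring

/-- From $T\lesssim N_0$ the inner integrand is at most $N_0e^{(\theta_0-1)u}a_1/\chi_0$ up to a
constant. Its decay collapses the norm to $t$, and $\beta_1a_1\lesssim\beta_1\alpha_1\le\chi_1$
finishes. -/
theorem ρ_mul_R₁_le_N₀ : ∃ D : ℝ≥0, ∀ k, IsK k → ∀ t, P.ρ t * P.R₁ k t ≤ D * P.N₀ k := by
  have hθ : 0 < (1 - P.θ) / 2 := by linarith [P.θ_lt]
  obtain ⟨A, hA⟩ := P.T_le_Q₀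
  have hw₂ := P.sv_a₁.mul P.sv_X₀.inv
  obtain ⟨C, hC⟩ := hw₂.E_mul_reg (P.θ - 1) hθ
  obtain ⟨D, hD⟩ := Reg.L_Ioi_le P.hq₁ C (P.θ - 1 - (1 - P.θ) / 2)
    (β := P.θ - 1 + (1 - P.θ) / 2) (by linarith)
  obtain ⟨C', hC'⟩ := P.sv_b₁.reg 1 one_pos
  obtain ⟨D', hD'⟩ := Reg.L_const_mul_le P.hr₁ C' (-1) 1
  obtain ⟨B, hB⟩ := P.sv_a₁.exists_le_L_Iio P.hq₁
  refine ⟨D' * A * D * B, fun k hk t => ?_⟩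
  set N := P.N₀ k with hN
  set w : ℝ → ℝ≥0∞ := fun x => E (P.θ - 1) x * (P.a₁ x * (P.X₀ x)⁻¹) with hw
  have hG : ∀ s, P.G₁ k t s ≤ A * N * D * w t := by
    intro s
    have h1 : P.G₁ k t s ≤ L P.q₁ (Ioi t) (fun u => (A * N) * w u) := by
      refine (L_mono_set Ioo_subset_Ioi_self).trans (L_mono_fun fun u => ?_)
      have h2 : P.T k u ≤ A * N := (hA k hk u).trans (mul_le_mul_right (P.Q₀_le_N₀ k u) _)
      calc E (-1) u * P.a₁ u * k u
          = (P.X₀ u * (P.X₀ u)⁻¹) * (E P.θ u * E (-P.θ) u) * (E (-1) u * P.a₁ u * k u) := by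
            rw [E_mul_neg, ENNReal.mul_inv_cancel (P.sv_X₀.ne_zero u) (P.sv_X₀.ne_top u)]; ring
        _ = P.T k u * (E P.θ u * E (-1) u) * P.a₁ u * (P.X₀ u)⁻¹ := by rw [T]; ring
        _ ≤ (A * N) * (E P.θ u * E (-1) u) * P.a₁ u * (P.X₀ u)⁻¹ := by gcongr
        _ = (A * N) * w u := by rw [← E_add_left, hw, ← sub_eq_add_neg]; ring
    refine h1.trans ((hD _ (hC.const_mul _) t).trans (le_of_eq (by ring)))
  have hR : P.R₁ k t ≤ D' * ((A * N * D * w t) * P.β₁ t) := by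
    refine le_trans (L_mono_fun fun s => ?_) (hD' _ hC' (Ioi t) measurableSet_Ioi _)
    rw [mul_comm]; gcongr; exact hG s
  have hfin : P.ρ t * w t * P.β₁ t ≤ B := by
    calc P.ρ t * w t * P.β₁ t
        = (E (1 - P.θ) t * E (-(1 - P.θ)) t) * (P.X₀ t * (P.X₀ t)⁻¹) *
            ((P.X₁ t)⁻¹ * (P.a₁ t * P.β₁ t)) := by rw [hw, ρ, neg_sub]; ring
      _ = (P.X₁ t)⁻¹ * (P.a₁ t * P.β₁ t) := by
          rw [E_mul_neg, ENNReal.mul_inv_cancel (P.sv_X₀.ne_zero t) (P.sv_X₀.ne_top t)]; ring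
      _ ≤ (P.X₁ t)⁻¹ * ((B * P.α₁ t) * P.β₁ t) := by gcongr; exact hB t
      _ = B * ((P.β₁ t * P.α₁ t) * (P.X₁ t)⁻¹) := by ring
      _ ≤ B * (P.X₁ t * (P.X₁ t)⁻¹) := by gcongr; exact le_add_self
      _ = B := by rw [ENNReal.mul_inv_cancel (P.sv_X₁.ne_zero t) (P.sv_X₁.ne_top t), mul_one]
  calc P.ρ t * P.R₁ k t ≤ P.ρ t * (D' * ((A * N * D * w t) * P.β₁ t)) := by gcongr
    _ = ↑(D' * A * D) * N * (P.ρ t * w t * P.β₁ t) := by push_cast; ring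
    _ ≤ ↑(D' * A * D) * N * B := by gcongr
    _ = _ := by push_cast; ring

/-! ### Norms of the two pieces of a decomposition. -/

/-- Here `k'` is the K-functional of the piece $f_0$. Beyond $t$ its bound is constant while
$e^{-\theta_0u}$ decays, so the inner norm stops growing at a multiple of $F_0(t)$; the tail of
$b_0$ then gives $Q_0$. -/
theorem N₀_le (c : ℝ≥0) : ∃ D : ℝ≥0, ∀ k, IsK k → ∀ (t : ℝ) (k' : ℝ → ℝ≥0∞),
    (∀ u, k' u ≤ c * k (min u t)) → P.N₀ k' ≤ D * (P.P₀ k t + P.Q₀ k t) := by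
  have hθ : 0 < P.θ / 2 := by linarith [P.θ_pos]
  obtain ⟨C, hC⟩ := P.reg_in₀
  obtain ⟨A, hA⟩ := Reg.le_L_Iio P.hq₀ C (-P.θ + -1 + 0) (-P.θ + 1 + 1)
  obtain ⟨B₁, hB₁⟩ := L_union_le P.hq₀
  obtain ⟨B₂, hB₂⟩ := L_union_le P.hr₀
  obtain ⟨C', hC'⟩ := P.sv_a₀.E_mul_reg (-P.θ) hθ
  obtain ⟨D, hD⟩ := Reg.L_Ioi_le P.hq₀ C' (-P.θ - P.θ / 2) (β := -P.θ + P.θ / 2) (by linarith)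
  obtain ⟨C₂, hC₂⟩ := P.sv_b₀.reg 1 one_pos
  obtain ⟨D₂, hD₂⟩ := Reg.L_const_mul_le P.hr₀ C₂ (-1) 1
  refine ⟨B₂ * (c + D₂ * (B₁ * (c + D * c * A))), fun k hk t k' hk' => ?_⟩
  have h1 : ∀ s ≤ t, P.F₀ k' s ≤ c * P.F₀ k s := by
    intro s hs
    refine L_le_mul P.hq₀ measurableSet_Iio ENNReal.coe_ne_top fun u hu => ?_
    have hu' : u < s := hu
    have := hk' u
    rw [min_eq_left (by linarith)] at this
    calc E (-P.θ) u * P.a₀ u * k' u ≤ E (-P.θ) u * P.a₀ u * (c * k u) := by gcongr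
      _ = _ := by ring
  have h2 : ∀ s, P.F₀ k' s ≤ ↑(B₁ * (c + D * c * A)) * P.F₀ k t := by
    intro s
    have h3 : L P.q₀ (Ioi t) (fun u => E (-P.θ) u * P.a₀ u * k' u) ≤
        D * ((c * k t) * (E (-P.θ) t * P.a₀ t)) := by
      refine le_trans (L_mono measurableSet_Ioi fun u hu => ?_) (hD _ (hC'.const_mul _) t)
      have := hk' u
      rw [min_eq_right (le_of_lt hu)] at this
      rw [mul_comm]
      gcongr
    have h4 : E (-P.θ) t * P.a₀ t * k t ≤ A * P.F₀ k t := hA _ (hC k hk) t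
    calc P.F₀ k' s ≤ L P.q₀ (Iio t ∪ Ici t) (fun u => E (-P.θ) u * P.a₀ u * k' u) :=
          L_mono_set (by rw [Iio_union_Ici]; exact subset_univ _)
      _ ≤ B₁ * (P.F₀ k' t + L P.q₀ (Ici t) (fun u => E (-P.θ) u * P.a₀ u * k' u)) := hB₁ _ _ _
      _ ≤ B₁ * (c * P.F₀ k t + D * ((c * k t) * (E (-P.θ) t * P.a₀ t))) := by
          rw [L_Ici]; gcongr; exact h1 t le_rfl
      _ = B₁ * (c * P.F₀ k t + D * c * (E (-P.θ) t * P.a₀ t * k t)) := by ring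
      _ ≤ B₁ * (c * P.F₀ k t + D * c * (A * P.F₀ k t)) := by gcongr
      _ = _ := by push_cast; ring
  have h5 : P.P₀ k' t ≤ c * P.P₀ k t :=
    L_le_mul P.hr₀ measurableSet_Iio ENNReal.coe_ne_top fun s hs => by
      calc P.b₀ s * P.F₀ k' s ≤ P.b₀ s * (c * P.F₀ k s) := by
            gcongr; exact h1 s (le_of_lt hs)
        _ = _ := by ring
  have h6 : L P.r₀ (Ioi t) (fun s => P.b₀ s * P.F₀ k' s) ≤
      ↑(D₂ * (B₁ * (c + D * c * A))) * P.Q₀ k t := by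
    calc L P.r₀ (Ioi t) (fun s => P.b₀ s * P.F₀ k' s)
        ≤ L P.r₀ (Ioi t) (fun s => (↑(B₁ * (c + D * c * A)) * P.F₀ k t) * P.b₀ s) :=
          L_mono_fun fun s => by rw [mul_comm]; gcongr; exact h2 s
      _ ≤ D₂ * ((↑(B₁ * (c + D * c * A)) * P.F₀ k t) * P.β₀ t) :=
          hD₂ _ hC₂ _ measurableSet_Ioi _
      _ = _ := by rw [Q₀]; push_cast; ring
  calc P.N₀ k' = L P.r₀ (Iio t ∪ Ici t) (fun s => P.b₀ s * P.F₀ k' s) := by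
        rw [Iio_union_Ici]; rfl
    _ ≤ B₂ * (P.P₀ k' t + L P.r₀ (Ici t) (fun s => P.b₀ s * P.F₀ k' s)) := hB₂ _ _ _
    _ ≤ B₂ * (c * P.P₀ k t + ↑(D₂ * (B₁ * (c + D * c * A))) * P.Q₀ k t) := by
        rw [L_Ici]; gcongr
    _ ≤ B₂ * ((c + ↑(D₂ * (B₁ * (c + D * c * A)))) * P.P₀ k t +
          (c + ↑(D₂ * (B₁ * (c + D * c * A)))) * P.Q₀ k t) := by
        gcongr
        · exact le_self_add
        · exact le_add_self
    _ = _ := by push_cast; ring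

/-- Here `k'` is the K-functional of the piece $f_1$. Below $t$, $e^{-u}k'(u)$ is at most a multiple
of $e^{-t}k(t)$, which contributes $e^{-t}k(t)\chi_1(t)$; multiplied by $\rho$ this is $T\lesssim
Q_0$. The part above $t$ gives $R_1$. -/
theorem ρ_mul_N₁_le (c : ℝ≥0) : ∃ D : ℝ≥0, ∀ k, IsK k → ∀ (t : ℝ) (k' : ℝ → ℝ≥0∞),
    (∀ u ≤ t, k' u ≤ c * (E 1 (u - t) * k t)) → (∀ u ≥ t, k' u ≤ c * k u) →
    P.ρ t * P.N₁ k' ≤ D * (P.Q₀ k t + P.ρ t * P.R₁ k t) := by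
  obtain ⟨A, hA⟩ := P.T_le_Q₀
  obtain ⟨B₁, hB₁⟩ := L_union_le P.hq₁
  obtain ⟨B₂, hB₂⟩ := L_union_le P.hr₁
  obtain ⟨C₁, hC₁⟩ := P.sv_a₁.reg 1 one_pos
  obtain ⟨D₁, hD₁⟩ := Reg.L_const_mul_le P.hq₁ C₁ (-1) 1
  obtain ⟨C₂, hC₂⟩ := P.sv_b₁.reg 1 one_pos
  obtain ⟨D₂, hD₂⟩ := Reg.L_const_mul_le P.hr₁ C₂ (-1) 1
  obtain ⟨C₃, hC₃⟩ := (P.sv_b₁.mul P.sv_α₁).reg 1 one_pos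
  obtain ⟨D₃, hD₃⟩ := Reg.L_const_mul_le P.hr₁ C₃ (-1) 1
  obtain ⟨D₄, hD₄⟩ := Reg.L_mul_add_le P.hr₁ C₂ (-1) 1
  have key : ∃ D : ℝ≥0, ∀ k, IsK k → ∀ (t : ℝ) (k' : ℝ → ℝ≥0∞),
      (∀ u ≤ t, k' u ≤ c * (E 1 (u - t) * k t)) → (∀ u ≥ t, k' u ≤ c * k u) →
      P.N₁ k' ≤ D * ((E (-1) t * k t) * P.X₁ t + P.R₁ k t) := by
    refine ⟨B₂ * (D₃ * D₁ * c + D₄ * (D₂ * B₁ * D₁ * c + B₁ * c)),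
      fun k hk t k' hk₁ hk₂ => ?_⟩
    obtain ⟨κ, hκ⟩ : ∃ κ, κ = E (-1) t * k t := ⟨_, rfl⟩
    rw [← hκ]
    have h1 : ∀ s ≤ t, P.F₁ k' s ≤ ↑(D₁ * c) * (κ * P.α₁ s) := by
      intro s hs
      calc P.F₁ k' s ≤ L P.q₁ (Iio s) (fun u => (c * κ) * P.a₁ u) := by
            refine L_mono measurableSet_Iio fun u hu => ?_
            have hu' : u < s := hu
            have := hk₁ u (by linarith)
            rw [E_sub_right] at this
            calc E (-1) u * P.a₁ u * k' u
                ≤ E (-1) u * P.a₁ u * (c * (E 1 u * E (-1) t * k t)) := by gcongr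
              _ = (E 1 u * E (-1) u) * ((c * (E (-1) t * k t)) * P.a₁ u) := by ring
              _ = _ := by rw [E_mul_neg, one_mul, hκ]
        _ ≤ D₁ * ((c * κ) * P.α₁ s) := hD₁ _ hC₁ _ measurableSet_Iio _
        _ = _ := by push_cast; ring
    have h2 : ∀ s > t, P.F₁ k' s ≤
        ↑(B₁ * D₁ * c) * (κ * P.α₁ t) + ↑(B₁ * c) * P.G₁ k t s := by
      intro s hs
      calc P.F₁ k' s = L P.q₁ (Iio t ∪ Ico t s) (fun u => E (-1) u * P.a₁ u * k' u) := by
            rw [Iio_union_Ico_eq_Iio (le_of_lt hs)]; rfl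
        _ ≤ B₁ * (P.F₁ k' t + L P.q₁ (Ico t s) (fun u => E (-1) u * P.a₁ u * k' u)) := hB₁ _ _ _
        _ ≤ B₁ * (↑(D₁ * c) * (κ * P.α₁ t) + c * P.G₁ k t s) := by
            rw [L_Ico]
            gcongr
            · exact h1 t le_rfl
            · refine L_le_mul P.hq₁ measurableSet_Ioo ENNReal.coe_ne_top fun u hu => ?_
              calc E (-1) u * P.a₁ u * k' u ≤ E (-1) u * P.a₁ u * (c * k u) := by
                    gcongr; exact hk₂ u (le_of_lt hu.1)
                _ = _ := by ring
        _ = _ := by push_cast; ring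
    have h3 : L P.r₁ (Iio t) (fun s => P.b₁ s * P.F₁ k' s) ≤
        ↑(D₃ * D₁ * c) * (κ * P.γ₁ t) := by
      calc L P.r₁ (Iio t) (fun s => P.b₁ s * P.F₁ k' s)
          ≤ L P.r₁ (Iio t) (fun s => (↑(D₁ * c) * κ) * (P.b₁ s * P.α₁ s)) := by
            refine L_mono measurableSet_Iio fun s hs => ?_
            calc P.b₁ s * P.F₁ k' s ≤ P.b₁ s * (↑(D₁ * c) * (κ * P.α₁ s)) := by
                  gcongr; exact h1 s (le_of_lt hs)
              _ = _ := by ring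
        _ ≤ D₃ * ((↑(D₁ * c) * κ) * P.γ₁ t) := hD₃ _ hC₃ _ measurableSet_Iio _
        _ = _ := by push_cast; ring
    have h4 : L P.r₁ (Ioi t) (fun s => P.b₁ s * P.F₁ k' s) ≤
        D₄ * (↑(D₂ * B₁ * D₁ * c) * (κ * (P.β₁ t * P.α₁ t)) + ↑(B₁ * c) * P.R₁ k t) := by
      calc L P.r₁ (Ioi t) (fun s => P.b₁ s * P.F₁ k' s)
          ≤ L P.r₁ (Ioi t) (fun s => P.b₁ s * (↑(B₁ * D₁ * c) * (κ * P.α₁ t)) +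
              ↑(B₁ * c) * (P.b₁ s * P.G₁ k t s)) := by
            refine L_mono measurableSet_Ioi fun s hs => ?_
            refine (mul_le_mul_right (h2 s hs) _).trans (le_of_eq (by ring))
        _ ≤ D₄ * (L P.r₁ (Ioi t) (fun s => P.b₁ s * (↑(B₁ * D₁ * c) * (κ * P.α₁ t))) +
              L P.r₁ (Ioi t) (fun s => ↑(B₁ * c) * (P.b₁ s * P.G₁ k t s))) :=
            hD₄ _ measurableSet_Ioi _ hC₂ _ measurable_const _
        _ ≤ D₄ * (D₂ * ((↑(B₁ * D₁ * c) * (κ * P.α₁ t)) * P.β₁ t) + ↑(B₁ * c) * P.R₁ k t) := by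
            rw [L_mul P.hr₁ ENNReal.coe_ne_top]
            simp_rw [mul_comm (P.b₁ _) (↑(B₁ * D₁ * c) * (κ * P.α₁ t))]
            gcongr
            · exact hD₂ _ hC₂ _ measurableSet_Ioi _
            · exact le_rfl
        _ = _ := by push_cast; ring
    calc P.N₁ k' = L P.r₁ (Iio t ∪ Ici t) (fun s => P.b₁ s * P.F₁ k' s) := by
          rw [Iio_union_Ici]; rfl
      _ ≤ B₂ * (L P.r₁ (Iio t) (fun s => P.b₁ s * P.F₁ k' s) +
            L P.r₁ (Ici t) (fun s => P.b₁ s * P.F₁ k' s)) := hB₂ _ _ _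
      _ ≤ B₂ * (↑(D₃ * D₁ * c) * (κ * P.γ₁ t) +
            D₄ * (↑(D₂ * B₁ * D₁ * c) * (κ * (P.β₁ t * P.α₁ t)) + ↑(B₁ * c) * P.R₁ k t)) := by
          rw [L_Ici]; gcongr
      _ ≤ B₂ * (↑(D₃ * D₁ * c) * (κ * P.X₁ t + P.R₁ k t) +
            D₄ * (↑(D₂ * B₁ * D₁ * c) * (κ * P.X₁ t + P.R₁ k t) +
              ↑(B₁ * c) * (κ * P.X₁ t + P.R₁ k t))) := by
          have e1 : κ * P.γ₁ t ≤ κ * P.X₁ t + P.R₁ k t :=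
            le_trans (mul_le_mul_right le_self_add _) le_self_add
          have e2 : κ * (P.β₁ t * P.α₁ t) ≤ κ * P.X₁ t + P.R₁ k t :=
            le_trans (mul_le_mul_right le_add_self _) le_self_add
          gcongr
          exact le_add_self
      _ = _ := by push_cast; ring
  obtain ⟨D, hD⟩ := key
  refine ⟨D * max A 1, fun k hk t k' hk₁ hk₂ => ?_⟩
  have hT : P.ρ t * ((E (-1) t * k t) * P.X₁ t) = P.T k t := by
    calc P.ρ t * ((E (-1) t * k t) * P.X₁ t)
        = (E (1 - P.θ) t * E (-1) t) * P.X₀ t * k t * (P.X₁ t * (P.X₁ t)⁻¹) := by rw [ρ]; ring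
      _ = _ := by
        rw [ENNReal.mul_inv_cancel (P.sv_X₁.ne_zero t) (P.sv_X₁.ne_top t), mul_one, T,
          ← E_add_left]
        congr 3; ring
  calc P.ρ t * P.N₁ k' ≤ P.ρ t * (D * ((E (-1) t * k t) * P.X₁ t + P.R₁ k t)) := by
        gcongr; exact hD k hk t k' hk₁ hk₂
    _ = D * (P.ρ t * ((E (-1) t * k t) * P.X₁ t) + P.ρ t * P.R₁ k t) := by ring
    _ ≤ D * (↑(max A 1) * P.Q₀ k t + ↑(max A 1) * (P.ρ t * P.R₁ k t)) := by
        rw [hT]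
        refine mul_le_mul_right (add_le_add ?_ ?_) _
        · exact (hA k hk t).trans (mul_le_mul_left (ENNReal.coe_le_coe.2 (le_max_left _ _)) _)
        · exact le_mul_of_one_le_left' (by exact_mod_cast le_max_right A 1)
    _ = _ := by push_cast; ring

end Params

end

/-! ### The functional `S` and its bounds by the two limiting norms. -/

noncomputable section

namespace Params

variable (P : Params) {r : ℝ≥0∞}

/-- The norm of the couple of limiting spaces that describes their K-functional at `ρ t`. -/
def S (k : ℝ → ℝ≥0∞) (t : ℝ) : ℝ≥0∞ := P.P₀ k t + P.Q₀ k t + P.ρ t * P.R₁ k t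

/-- The inner norms are monotone in their upper limit, hence measurable, which is what the outer
quasi-triangle inequality needs. -/
theorem S_le_add (c : ℝ≥0) : ∃ D : ℝ≥0, ∀ k k₀ k₁, IsK k₀ → IsK k₁ →
    (∀ u, k u ≤ c * (k₀ u + k₁ u)) → ∀ t, P.S k t ≤ D * (P.S k₀ t + P.S k₁ t) := by
  obtain ⟨C₀, hC₀⟩ := P.reg_in₀
  obtain ⟨D₀, hD₀⟩ := Reg.L_add_le P.hq₀ C₀ (-P.θ + -1 + 0) (-P.θ + 1 + 1)
  obtain ⟨C₁, hC₁⟩ := P.reg_in₁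
  obtain ⟨D₁, hD₁⟩ := Reg.L_add_le P.hq₁ C₁ (-1 + -1 + 0) (-1 + 1 + 1)
  obtain ⟨C₂, hC₂⟩ := P.sv_b₀.reg 1 one_pos
  obtain ⟨D₂, hD₂⟩ := Reg.L_mul_add_le P.hr₀ C₂ (-1) 1
  obtain ⟨C₃, hC₃⟩ := P.sv_b₁.reg 1 one_pos
  obtain ⟨D₃, hD₃⟩ := Reg.L_mul_add_le P.hr₁ C₃ (-1) 1
  obtain ⟨M, hM⟩ : ∃ M : ℝ≥0, M = c * D₀ * D₂ + c * D₀ + c * D₁ * D₃ := ⟨_, rfl⟩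
  refine ⟨M, fun k k₀ k₁ hk₀ hk₁ hk t => ?_⟩
  have hF : ∀ s, P.F₀ k s ≤ ↑(c * D₀) * (P.F₀ k₀ s + P.F₀ k₁ s) := by
    intro s
    calc P.F₀ k s ≤ c * L P.q₀ (Iio s) (fun u => E (-P.θ) u * P.a₀ u * k₀ u +
            E (-P.θ) u * P.a₀ u * k₁ u) := by
          refine L_le_mul P.hq₀ measurableSet_Iio ENNReal.coe_ne_top fun u _ => ?_
          exact (mul_le_mul_right (hk u) _).trans (le_of_eq (by ring))
      _ ≤ c * (D₀ * (P.F₀ k₀ s + P.F₀ k₁ s)) :=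
          mul_le_mul_right (hD₀ _ measurableSet_Iio _ (hC₀ k₀ hk₀) _) _
      _ = _ := by push_cast; ring
  have hG : ∀ s, P.G₁ k t s ≤ ↑(c * D₁) * (P.G₁ k₀ t s + P.G₁ k₁ t s) := by
    intro s
    calc P.G₁ k t s ≤ c * L P.q₁ (Ioo t s) (fun u => E (-1) u * P.a₁ u * k₀ u +
            E (-1) u * P.a₁ u * k₁ u) := by
          refine L_le_mul P.hq₁ measurableSet_Ioo ENNReal.coe_ne_top fun u _ => ?_
          exact (mul_le_mul_right (hk u) _).trans (le_of_eq (by ring))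
      _ ≤ c * (D₁ * (P.G₁ k₀ t s + P.G₁ k₁ t s)) :=
          mul_le_mul_right (hD₁ _ measurableSet_Ioo _ (hC₁ k₀ hk₀) _) _
      _ = _ := by push_cast; ring
  have hP : P.P₀ k t ≤ ↑(c * D₀ * D₂) * (P.P₀ k₀ t + P.P₀ k₁ t) := by
    calc P.P₀ k t ≤ ↑(c * D₀) * L P.r₀ (Iio t) (fun s => P.b₀ s * P.F₀ k₀ s +
            P.b₀ s * P.F₀ k₁ s) := by
          refine L_le_mul P.hr₀ measurableSet_Iio ENNReal.coe_ne_top fun s _ => ?_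
          exact (mul_le_mul_right (hF s) _).trans (le_of_eq (by ring))
      _ ≤ ↑(c * D₀) * (D₂ * (P.P₀ k₀ t + P.P₀ k₁ t)) :=
          mul_le_mul_right (hD₂ _ measurableSet_Iio _ hC₂ _ (P.F₀_mono k₀).measurable _) _
      _ = _ := by push_cast; ring
  have hR : P.R₁ k t ≤ ↑(c * D₁ * D₃) * (P.R₁ k₀ t + P.R₁ k₁ t) := by
    have hm : Monotone (P.G₁ k₀ t) := fun _ _ h => L_mono_set (Ioo_subset_Ioo_right h)
    calc P.R₁ k t ≤ ↑(c * D₁) * L P.r₁ (Ioi t) (fun s => P.b₁ s * P.G₁ k₀ t s +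
            P.b₁ s * P.G₁ k₁ t s) := by
          refine L_le_mul P.hr₁ measurableSet_Ioi ENNReal.coe_ne_top fun s _ => ?_
          exact (mul_le_mul_right (hG s) _).trans (le_of_eq (by ring))
      _ ≤ ↑(c * D₁) * (D₃ * (P.R₁ k₀ t + P.R₁ k₁ t)) :=
          mul_le_mul_right (hD₃ _ measurableSet_Ioi _ hC₃ _ hm.measurable _) _
      _ = _ := by push_cast; ring
  have hQ : P.Q₀ k t ≤ ↑(c * D₀) * (P.Q₀ k₀ t + P.Q₀ k₁ t) :=
    (mul_le_mul_right (hF t) _).trans (le_of_eq (by rw [Q₀, Q₀]; ring))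
  have m1 : (↑(c * D₀ * D₂) : ℝ≥0∞) ≤ M :=
    ENNReal.coe_le_coe.2 (by rw [hM, add_assoc]; exact le_self_add)
  have m2 : (↑(c * D₀) : ℝ≥0∞) ≤ M :=
    ENNReal.coe_le_coe.2 (by rw [hM]; exact le_add_self.trans le_self_add)
  have m3 : (↑(c * D₁ * D₃) : ℝ≥0∞) ≤ M := ENNReal.coe_le_coe.2 (by rw [hM]; exact le_add_self)
  calc P.S k t ≤ ↑(c * D₀ * D₂) * (P.P₀ k₀ t + P.P₀ k₁ t) + ↑(c * D₀) * (P.Q₀ k₀ t + P.Q₀ k₁ t)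
        + P.ρ t * (↑(c * D₁ * D₃) * (P.R₁ k₀ t + P.R₁ k₁ t)) :=
        add_le_add (add_le_add hP hQ) (mul_le_mul_right hR _)
    _ ≤ M * (P.P₀ k₀ t + P.P₀ k₁ t) + M * (P.Q₀ k₀ t + P.Q₀ k₁ t)
        + P.ρ t * (M * (P.R₁ k₀ t + P.R₁ k₁ t)) := by gcongr
    _ = _ := by rw [S, S]; ring

theorem S_le_N₀ : ∃ D : ℝ≥0, ∀ k, IsK k → ∀ t, P.S k t ≤ D * P.N₀ k := by
  obtain ⟨D, hD⟩ := P.ρ_mul_R₁_le_N₀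
  refine ⟨1 + 1 + D, fun k hk t => ?_⟩
  calc P.S k t ≤ P.N₀ k + P.N₀ k + D * P.N₀ k :=
        add_le_add (add_le_add (P.P₀_le_N₀ k t) (P.Q₀_le_N₀ k t)) (hD k hk t)
    _ = _ := by push_cast; ring

theorem S_le_N₁ : ∃ D : ℝ≥0, ∀ k, IsK k → ∀ t, P.S k t ≤ D * (P.ρ t * P.N₁ k) := by
  obtain ⟨D, hD⟩ := P.P₀_add_Q₀_le_N₁
  refine ⟨D + 1, fun k hk t => ?_⟩
  calc P.S k t ≤ D * (P.ρ t * P.N₁ k) + P.ρ t * P.N₁ k :=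
        add_le_add (hD k hk t) (mul_le_mul_right (P.R₁_le_N₁ k t) _)
    _ = _ := by push_cast; ring

/-! ### Weighted norms -/

theorem ρ_rpow_neg_mul_reg {W : ℝ → ℝ≥0∞} (hW : SV W) {τ : ℝ} (hτ : 0 < τ) :
    ∃ (C : ℝ≥0) (α β : ℝ), β < 0 ∧ Reg C α β (fun t => P.ρ t ^ (-τ) * W t) := by
  have hθ : 0 < (1 - P.θ) / 2 := by linarith [P.θ_lt]
  obtain ⟨C, hC⟩ := P.ρ_reg hθ
  have hd : 0 < τ * ((1 - P.θ) / 2) := mul_pos hτ hθ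
  -- The weight `W` may use up only half of the decay $\tau(1-\theta)/2$ guaranteed by the power of
  -- $\rho$.
  obtain ⟨D, hD⟩ := hW.reg (τ * ((1 - P.θ) / 2) / 2) (by linarith)
  have h := (hC.inv.rpow hτ.le).mul hD
  simp_rw [ENNReal.inv_rpow, ← ENNReal.rpow_neg] at h
  exact ⟨_, _, _, by nlinarith, h⟩

theorem ρ_rpow_mul_reg {W : ℝ → ℝ≥0∞} (hW : SV W) {σ : ℝ} (hσ : 0 < σ) :
    ∃ (C : ℝ≥0) (α β : ℝ), 0 < α ∧ Reg C α β (fun t => P.ρ t ^ σ * W t) := by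
  have hθ : 0 < (1 - P.θ) / 2 := by linarith [P.θ_lt]
  obtain ⟨C, hC⟩ := P.ρ_reg hθ
  have hd : 0 < σ * ((1 - P.θ) / 2) := mul_pos hσ hθ
  obtain ⟨D, hD⟩ := hW.reg (σ * ((1 - P.θ) / 2) / 2) (by linarith)
  exact ⟨_, _, _, by nlinarith, (hC.rpow hσ.le).mul hD⟩

/-- For $\tau>0$ the outer weight $\rho^{-\tau}W\beta_0$ decays exponentially, so Hardy's inequality
replaces the inner norm by its integrand. -/
theorem L_Q₀_le (hr : r ≠ 0) {W : ℝ → ℝ≥0∞} (hW : SV W) {τ : ℝ} (hτ : 0 < τ) :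
    ∃ D : ℝ≥0, ∀ k, IsK k → L r univ (fun t => P.ρ t ^ (-τ) * W t * P.Q₀ k t) ≤
      D * L r univ (fun t => P.ρ t ^ (-τ) * W t * P.T k t) := by
  obtain ⟨C, α, β, hβ, hC⟩ := P.ρ_rpow_neg_mul_reg (hW.mul P.sv_β₀) hτ
  obtain ⟨C', hC'⟩ := P.reg_in₀
  obtain ⟨D, hD⟩ := L_hardy_Iio (p := P.q₀) hr P.hq₀ C' (-P.θ + -1 + 0) (-P.θ + 1 + 1) α C β hβ
  refine ⟨D, fun k hk => ?_⟩
  have := hD _ _ (hC' k hk) hC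
  have e1 : ∀ t, P.ρ t ^ (-τ) * W t * P.Q₀ k t = P.ρ t ^ (-τ) * (W t * P.β₀ t) *
      L P.q₀ (Iio t) (fun u => E (-P.θ) u * P.a₀ u * k u) := fun t => by
    rw [Q₀, F₀]; ring
  have e2 : ∀ t, P.ρ t ^ (-τ) * W t * P.T k t = P.ρ t ^ (-τ) * (W t * P.β₀ t) *
      (E (-P.θ) t * P.a₀ t * k t) := fun t => by
    rw [T, X₀]; ring
  simp_rw [e1, e2]
  exact this

/-- Hardy's inequality removes the outer norm in $P_0$; what remains is
$b_0F_0\lesssim\beta_0F_0=Q_0$. -/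
theorem L_P₀_le (hr : r ≠ 0) {W : ℝ → ℝ≥0∞} (hW : SV W) {τ : ℝ} (hτ : 0 < τ) :
    ∃ D : ℝ≥0, ∀ k, IsK k → L r univ (fun t => P.ρ t ^ (-τ) * W t * P.P₀ k t) ≤
      D * L r univ (fun t => P.ρ t ^ (-τ) * W t * P.T k t) := by
  obtain ⟨A, hA⟩ := P.L_Q₀_le hr hW hτ
  obtain ⟨C, α, β, hβ, hC⟩ := P.ρ_rpow_neg_mul_reg hW hτ
  obtain ⟨C', hC'⟩ := P.reg_in₀
  obtain ⟨C'', hC''⟩ := P.sv_b₀.reg 1 one_pos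
  obtain ⟨D, hD⟩ := L_hardy_Iio (p := P.r₀) hr P.hr₀ (C'' * C') (-1 + (-P.θ + -1 + 0))
    (1 + (-P.θ + 1 + 1)) α C β hβ
  obtain ⟨B, hB⟩ := P.sv_b₀.exists_le_L_Ioi P.hr₀
  refine ⟨D * B * A, fun k hk => ?_⟩
  calc L r univ (fun t => P.ρ t ^ (-τ) * W t * P.P₀ k t)
      ≤ D * L r univ (fun t => P.ρ t ^ (-τ) * W t * (P.b₀ t * P.F₀ k t)) :=
        hD _ _ (hC''.mul ((hC' k hk).L_Iio P.hq₀)) hC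
    _ ≤ D * (B * L r univ (fun t => P.ρ t ^ (-τ) * W t * P.Q₀ k t)) := by
        refine mul_le_mul_right (L_le_mul hr MeasurableSet.univ ENNReal.coe_ne_top
          fun t _ => ?_) _
        calc P.ρ t ^ (-τ) * W t * (P.b₀ t * P.F₀ k t)
            ≤ P.ρ t ^ (-τ) * W t * ((B * P.β₀ t) * P.F₀ k t) :=
              mul_le_mul_right (mul_le_mul_left (hB t) _) _
          _ = _ := by rw [Q₀]; ring
    _ ≤ D * (B * (A * L r univ (fun t => P.ρ t ^ (-τ) * W t * P.T k t))) :=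
        mul_le_mul_right (mul_le_mul_right (hA k hk) _) _
    _ = _ := by push_cast; ring

theorem ρ_mul_X₁ (t : ℝ) : P.ρ t * (E (-1) t * P.X₁ t) = E (-P.θ) t * P.X₀ t := by
  calc P.ρ t * (E (-1) t * P.X₁ t)
      = (E (1 - P.θ) t * E (-1) t) * P.X₀ t * (P.X₁ t * (P.X₁ t)⁻¹) := by rw [ρ]; ring
    _ = _ := by
      rw [ENNReal.mul_inv_cancel (P.sv_X₁.ne_zero t) (P.sv_X₁.ne_top t), mul_one, ← E_add_left]
      congr 2; ring

/-- Extending the inner norm to $(t,\infty)$ makes it independent of $s$ and leaves $\beta_1$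
outside. The weight $\rho^{1-\tau}W\beta_1$ grows when $\tau<1$, so Hardy's inequality on tails
applies. -/
theorem L_R₁_le (hr : r ≠ 0) {W : ℝ → ℝ≥0∞} (hW : SV W) {τ : ℝ} (hτ : τ < 1) :
    ∃ D : ℝ≥0, ∀ k, IsK k → L r univ (fun t => P.ρ t ^ (-τ) * W t * (P.ρ t * P.R₁ k t)) ≤
      D * L r univ (fun t => P.ρ t ^ (-τ) * W t * P.T k t) := by
  obtain ⟨C, α, β, hα, hC⟩ := P.ρ_rpow_mul_reg (hW.mul P.sv_β₁) (sub_pos.2 hτ)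
  obtain ⟨C', hC'⟩ := P.reg_in₁
  obtain ⟨D, hD⟩ := L_hardy_Ioi (p := P.q₁) hr P.hq₁ C' (-1 + -1 + 0) (-1 + 1 + 1) C α β hα
  obtain ⟨B, hB⟩ := P.sv_a₁.exists_le_L_Iio P.hq₁
  obtain ⟨C'', hC''⟩ := P.sv_b₁.reg 1 one_pos
  obtain ⟨B', hB'⟩ := Reg.L_const_mul_le P.hr₁ C'' (-1) 1
  have hρ : ∀ t, P.ρ t ^ (-τ) * P.ρ t = P.ρ t ^ (1 - τ) := fun t => by
    rw [sub_eq_neg_add, ENNReal.rpow_add _ _ (P.ρ_ne_zero t) (P.ρ_ne_top t), ENNReal.rpow_one]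
  refine ⟨B' * D * B, fun k hk => ?_⟩
  set H : ℝ → ℝ≥0∞ := fun t => L P.q₁ (Ioi t) (fun u => E (-1) u * P.a₁ u * k u) with hH
  have hR : ∀ t, P.R₁ k t ≤ B' * (H t * P.β₁ t) := by
    intro t
    refine le_trans (L_mono_fun fun s => ?_) (hB' _ hC'' (Ioi t) measurableSet_Ioi _)
    rw [mul_comm]
    exact mul_le_mul_left (L_mono_set Ioo_subset_Ioi_self) _
  calc L r univ (fun t => P.ρ t ^ (-τ) * W t * (P.ρ t * P.R₁ k t))
      ≤ B' * L r univ (fun t => P.ρ t ^ (1 - τ) * (W t * P.β₁ t) * H t) := by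
        refine L_le_mul hr MeasurableSet.univ ENNReal.coe_ne_top fun t _ => ?_
        calc P.ρ t ^ (-τ) * W t * (P.ρ t * P.R₁ k t)
            ≤ P.ρ t ^ (-τ) * W t * (P.ρ t * (B' * (H t * P.β₁ t))) :=
              mul_le_mul_right (mul_le_mul_right (hR t) _) _
          _ = B' * ((P.ρ t ^ (-τ) * P.ρ t) * (W t * P.β₁ t) * H t) := by ring
          _ = _ := by rw [hρ]
    _ ≤ B' * (D * L r univ (fun t => P.ρ t ^ (1 - τ) * (W t * P.β₁ t) *
          (E (-1) t * P.a₁ t * k t))) := mul_le_mul_right (hD _ _ (hC' k hk) hC) _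
    _ ≤ B' * (D * (B * L r univ (fun t => P.ρ t ^ (-τ) * W t * P.T k t))) := by
        refine mul_le_mul_right (mul_le_mul_right (L_le_mul hr MeasurableSet.univ
          ENNReal.coe_ne_top fun t _ => ?_) _) _
        have hX : P.β₁ t * P.a₁ t ≤ B * P.X₁ t := by
          calc P.β₁ t * P.a₁ t ≤ P.β₁ t * (B * P.α₁ t) := mul_le_mul_right (hB t) _
            _ = B * (P.β₁ t * P.α₁ t) := by ring
            _ ≤ _ := mul_le_mul_right le_add_self _
        calc P.ρ t ^ (1 - τ) * (W t * P.β₁ t) * (E (-1) t * P.a₁ t * k t)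
            = (P.ρ t ^ (-τ) * P.ρ t) * (W t * E (-1) t * k t) * (P.β₁ t * P.a₁ t) := by
              rw [hρ]; ring
          _ ≤ (P.ρ t ^ (-τ) * P.ρ t) * (W t * E (-1) t * k t) * (B * P.X₁ t) :=
              mul_le_mul_right hX _
          _ = B * (P.ρ t ^ (-τ) * W t * ((P.ρ t * (E (-1) t * P.X₁ t)) * k t)) := by ring
          _ = _ := by rw [ρ_mul_X₁, T]
    _ = _ := by push_cast; ring

/-- $P_0$ and $F_0$ are monotone and can be split off in turn; the last summand, with $R_1$, needs
no measurability. -/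
theorem L_S_le (hr : r ≠ 0) {W : ℝ → ℝ≥0∞} (hW : SV W) {τ : ℝ} (hτ : 0 ≤ τ) :
    ∃ D : ℝ≥0, ∀ k, L r univ (fun t => P.ρ t ^ (-τ) * W t * P.S k t) ≤
      D * (L r univ (fun t => P.ρ t ^ (-τ) * W t * P.P₀ k t) +
        L r univ (fun t => P.ρ t ^ (-τ) * W t * P.Q₀ k t) +
        L r univ (fun t => P.ρ t ^ (-τ) * W t * (P.ρ t * P.R₁ k t))) := by
  obtain ⟨C, hC⟩ := P.ρ_reg one_pos
  obtain ⟨C₁, hC₁⟩ := hW.reg 1 one_pos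
  obtain ⟨C₂, hC₂⟩ := P.sv_β₀.reg 1 one_pos
  have hv := (hC.inv.rpow hτ).mul hC₁
  simp_rw [ENNReal.inv_rpow, ← ENNReal.rpow_neg] at hv
  have hv' := hv.mul hC₂
  obtain ⟨D, hD⟩ := Reg.L_mul_add_le hr _ _ _ |>.imp fun D h => h univ MeasurableSet.univ _ hv
  obtain ⟨D', hD'⟩ := Reg.L_mul_add_le hr _ _ _ |>.imp fun D h => h univ MeasurableSet.univ _ hv'
  refine ⟨D * max D' 1, fun k => ?_⟩
  have hPm : Monotone (P.P₀ k) := fun _ _ h => L_mono_set (Iio_subset_Iio h)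
  have e1 : ∀ t, P.ρ t ^ (-τ) * W t * P.Q₀ k t = P.ρ t ^ (-τ) * W t * P.β₀ t * P.F₀ k t :=
    fun t => by rw [Q₀]; ring
  calc L r univ (fun t => P.ρ t ^ (-τ) * W t * P.S k t)
      = L r univ (fun t => P.ρ t ^ (-τ) * W t * P.P₀ k t +
          (P.ρ t ^ (-τ) * W t * P.β₀ t * P.F₀ k t +
            P.ρ t ^ (-τ) * W t * (P.ρ t * P.R₁ k t))) := by
        congr 1; ext t; rw [S, Q₀]; ring
    _ ≤ D * (L r univ (fun t => P.ρ t ^ (-τ) * W t * P.P₀ k t) +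
          L r univ (fun t => P.ρ t ^ (-τ) * W t * P.β₀ t * P.F₀ k t +
            P.ρ t ^ (-τ) * W t * (P.ρ t * P.R₁ k t))) := hD _ hPm.measurable _
    _ ≤ D * (↑(max D' 1) * L r univ (fun t => P.ρ t ^ (-τ) * W t * P.P₀ k t) +
          ↑(max D' 1) * (L r univ (fun t => P.ρ t ^ (-τ) * W t * P.β₀ t * P.F₀ k t) +
            L r univ (fun t => P.ρ t ^ (-τ) * W t * (P.ρ t * P.R₁ k t)))) := by
        refine mul_le_mul_right (add_le_add ?_ ?_) _
        · exact le_mul_of_one_le_left' (by exact_mod_cast le_max_right D' 1)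
        · exact (hD' _ (P.F₀_mono k).measurable _).trans
            (mul_le_mul_left (ENNReal.coe_le_coe.2 (le_max_left _ _)) _)
    _ = _ := by simp_rw [e1]; push_cast; ring

theorem L_T_le_L_S (hr : r ≠ 0) (W : ℝ → ℝ≥0∞) : ∃ D : ℝ≥0, ∀ k, IsK k →
    L r univ (fun t => W t * P.T k t) ≤ D * L r univ (fun t => W t * P.S k t) := by
  obtain ⟨D, hD⟩ := P.T_le_Q₀
  refine ⟨D, fun k hk => L_le_mul hr MeasurableSet.univ ENNReal.coe_ne_top fun t _ => ?_⟩
  calc W t * P.T k t ≤ W t * (D * P.Q₀ k t) := mul_le_mul_right (hD k hk t) _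
    _ = D * (W t * P.Q₀ k t) := by ring
    _ ≤ _ := mul_le_mul_right (mul_le_mul_right (le_add_self.trans le_self_add) _) _

theorem L_S_equiv_of_lt (hr : r ≠ 0) {W : ℝ → ℝ≥0∞} (hW : SV W) {τ : ℝ} (hτ : 0 < τ)
    (hτ' : τ < 1) : ∃ D : ℝ≥0, ∀ k, IsK k →
    L r univ (fun t => P.ρ t ^ (-τ) * W t * P.S k t) ≤
      D * L r univ (fun t => P.ρ t ^ (-τ) * W t * P.T k t) ∧
    L r univ (fun t => P.ρ t ^ (-τ) * W t * P.T k t) ≤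
      D * L r univ (fun t => P.ρ t ^ (-τ) * W t * P.S k t) := by
  obtain ⟨D, hD⟩ := P.L_S_le hr hW hτ.le
  obtain ⟨D₁, hD₁⟩ := P.L_P₀_le hr hW hτ
  obtain ⟨D₂, hD₂⟩ := P.L_Q₀_le hr hW hτ
  obtain ⟨D₃, hD₃⟩ := P.L_R₁_le hr hW hτ'
  obtain ⟨D₄, hD₄⟩ := P.L_T_le_L_S hr (fun t => P.ρ t ^ (-τ) * W t)
  refine ⟨max (D * (D₁ + D₂ + D₃)) D₄, fun k hk => ⟨?_, ?_⟩⟩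
  · refine le_trans ?_ (mul_le_mul_left (ENNReal.coe_le_coe.2 (le_max_left _ _)) _)
    refine (hD k).trans ((mul_le_mul_right
      (add_le_add (add_le_add (hD₁ k hk) (hD₂ k hk)) (hD₃ k hk)) _).trans (le_of_eq ?_))
    push_cast; ring
  · exact (hD₄ k hk).trans (mul_le_mul_left (ENNReal.coe_le_coe.2 (le_max_right _ _)) _)

/-- Without a negative power of $\rho$ the terms $P_0$ and $Q_0$ must be kept, but $\rho R_1$ still
reduces to $T\lesssim Q_0$. -/
theorem L_S_equiv_zero (hr : r ≠ 0) {W : ℝ → ℝ≥0∞} (hW : SV W) : ∃ D : ℝ≥0, ∀ k, IsK k →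
    L r univ (fun t => W t * P.S k t) ≤
      D * max (L r univ (fun t => W t * P.Q₀ k t)) (L r univ (fun t => W t * P.P₀ k t)) ∧
    max (L r univ (fun t => W t * P.Q₀ k t)) (L r univ (fun t => W t * P.P₀ k t)) ≤
      D * L r univ (fun t => W t * P.S k t) := by
  obtain ⟨D, hD⟩ := P.L_S_le hr hW le_rfl
  obtain ⟨D₁, hD₁⟩ := P.L_R₁_le hr hW one_pos
  obtain ⟨D₂, hD₂⟩ := P.T_le_Q₀
  simp only [neg_zero, ENNReal.rpow_zero, one_mul] at hD hD₁
  refine ⟨max (D * (1 + 1 + D₁ * D₂)) 1, fun k hk => ⟨?_, ?_⟩⟩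
  · refine le_trans ?_ (mul_le_mul_left (ENNReal.coe_le_coe.2 (le_max_left _ _)) _)
    have hT : L r univ (fun t => W t * P.T k t) ≤ D₂ * L r univ (fun t => W t * P.Q₀ k t) :=
      L_le_mul hr MeasurableSet.univ ENNReal.coe_ne_top fun t _ =>
        (mul_le_mul_right (hD₂ k hk t) _).trans (le_of_eq (by ring))
    obtain ⟨M, hM⟩ : ∃ M, M = max (L r univ (fun t => W t * P.Q₀ k t))
      (L r univ (fun t => W t * P.P₀ k t)) := ⟨_, rfl⟩
    have h1 : L r univ (fun t => W t * P.Q₀ k t) ≤ M := hM ▸ le_max_left _ _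
    have h2 : L r univ (fun t => W t * P.P₀ k t) ≤ M := hM ▸ le_max_right _ _
    rw [← hM]
    calc L r univ (fun t => W t * P.S k t) ≤ D * (M + M + D₁ * (D₂ * M)) :=
          (hD k).trans (mul_le_mul_right (add_le_add (add_le_add h2 h1)
            ((hD₁ k hk).trans (mul_le_mul_right (hT.trans (mul_le_mul_right h1 _)) _))) _)
      _ = _ := by push_cast; ring
  · refine le_trans ?_ (mul_le_mul_left (ENNReal.coe_le_coe.2 (le_max_right _ _)) _)
    rw [ENNReal.coe_one, one_mul]
    refine max_le (L_mono_fun fun t => mul_le_mul_right ?_ _)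
      (L_mono_fun fun t => mul_le_mul_right ?_ _)
    · exact le_add_self.trans le_self_add
    · exact le_self_add.trans le_self_add

/-- Here $P_0$ and $Q_0$ reduce to $T$, while the power of $\rho$ cancels the one in front of $R_1$
and leaves no growth for Hardy's inequality. -/
theorem L_S_equiv_one (hr : r ≠ 0) {W : ℝ → ℝ≥0∞} (hW : SV W) : ∃ D : ℝ≥0, ∀ k, IsK k →
    L r univ (fun t => P.ρ t ^ (-1 : ℝ) * W t * P.S k t) ≤
      D * max (L r univ (fun t => P.ρ t ^ (-1 : ℝ) * W t * P.T k t))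
        (L r univ (fun t => W t * P.R₁ k t)) ∧
    max (L r univ (fun t => P.ρ t ^ (-1 : ℝ) * W t * P.T k t))
        (L r univ (fun t => W t * P.R₁ k t)) ≤
      D * L r univ (fun t => P.ρ t ^ (-1 : ℝ) * W t * P.S k t) := by
  obtain ⟨D, hD⟩ := P.L_S_le hr hW zero_le_one
  obtain ⟨D₁, hD₁⟩ := P.L_P₀_le hr hW one_pos
  obtain ⟨D₂, hD₂⟩ := P.L_Q₀_le hr hW one_pos
  obtain ⟨D₄, hD₄⟩ := P.L_T_le_L_S hr (fun t => P.ρ t ^ (-1 : ℝ) * W t)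
  have hρ : ∀ t, P.ρ t ^ (-1 : ℝ) * P.ρ t = 1 := fun t => by
    rw [ENNReal.rpow_neg_one, ENNReal.inv_mul_cancel (P.ρ_ne_zero t) (P.ρ_ne_top t)]
  have e : ∀ k t, P.ρ t ^ (-1 : ℝ) * W t * (P.ρ t * P.R₁ k t) = W t * P.R₁ k t := fun k t => by
    calc P.ρ t ^ (-1 : ℝ) * W t * (P.ρ t * P.R₁ k t)
        = (P.ρ t ^ (-1 : ℝ) * P.ρ t) * (W t * P.R₁ k t) := by ring
      _ = _ := by rw [hρ, one_mul]
  refine ⟨max (D * (D₁ + D₂ + 1)) (max D₄ 1), fun k hk => ⟨?_, ?_⟩⟩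
  · refine le_trans ?_ (mul_le_mul_left (ENNReal.coe_le_coe.2 (le_max_left _ _)) _)
    obtain ⟨M, hM⟩ : ∃ M, M = max (L r univ (fun t => P.ρ t ^ (-1 : ℝ) * W t * P.T k t))
      (L r univ (fun t => W t * P.R₁ k t)) := ⟨_, rfl⟩
    have h1 : L r univ (fun t => P.ρ t ^ (-1 : ℝ) * W t * P.T k t) ≤ M := hM ▸ le_max_left _ _
    have h2 : L r univ (fun t => W t * P.R₁ k t) ≤ M := hM ▸ le_max_right _ _
    have h3 := hD k
    simp_rw [e] at h3
    rw [← hM]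
    refine h3.trans ((mul_le_mul_right (add_le_add (add_le_add
      ((hD₁ k hk).trans (mul_le_mul_right h1 _)) ((hD₂ k hk).trans (mul_le_mul_right h1 _)))
      h2) _).trans (le_of_eq ?_))
    push_cast; ring
  · refine le_trans ?_ (mul_le_mul_left (ENNReal.coe_le_coe.2 (le_max_right _ _)) _)
    refine max_le ((hD₄ k hk).trans
      (mul_le_mul_left (ENNReal.coe_le_coe.2 (le_max_left _ _)) _)) ?_
    refine le_trans ?_ (le_mul_of_one_le_left' (by exact_mod_cast le_max_right D₄ 1))
    simp_rw [← e]
    exact L_mono_fun fun t => mul_le_mul_right le_add_self _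

/-! ### The logarithm of `ρ` -/

/-- `log ρ`. -/
def logρ (t : ℝ) : ℝ := Real.log (P.ρ t).toReal

theorem ρ_toReal_pos (t : ℝ) : 0 < (P.ρ t).toReal :=
  ENNReal.toReal_pos (P.ρ_ne_zero t) (P.ρ_ne_top t)

theorem ofReal_exp_logρ (t : ℝ) : ENNReal.ofReal (Real.exp (P.logρ t)) = P.ρ t := by
  rw [logρ, Real.exp_log (P.ρ_toReal_pos t), ENNReal.ofReal_toReal (P.ρ_ne_top t)]

theorem E_logρ (γ t : ℝ) : E γ (P.logρ t) = P.ρ t ^ γ := by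
  rw [← P.ofReal_exp_logρ, ENNReal.ofReal_rpow_of_pos (Real.exp_pos _), ← Real.exp_mul, E,
    mul_comm]

theorem coarseGrowth_logρ : ∃ δ D M : ℝ, CoarseGrowth P.logρ δ D M := by
  have hθ : 0 < (1 - P.θ) / 2 := by linarith [P.θ_lt]
  obtain ⟨C, hC⟩ := P.ρ_reg hθ
  have key : ∀ x y γ d : ℝ, P.ρ x ≤ C * E γ d * P.ρ y →
      P.logρ x ≤ Real.log (max (C : ℝ) 1) + γ * d + P.logρ y := by
    intro x y γ d h
    have hC1 : (0 : ℝ) < max (C : ℝ) 1 := lt_max_of_lt_right one_pos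
    have h2 : Real.exp (P.logρ x) ≤ Real.exp (Real.log (max (C : ℝ) 1) + γ * d + P.logρ y) := by
      rw [Real.exp_add, Real.exp_add, Real.exp_log hC1, ← ENNReal.ofReal_le_ofReal_iff
        (by positivity), ENNReal.ofReal_mul (by positivity), ENNReal.ofReal_mul (by positivity),
        P.ofReal_exp_logρ, P.ofReal_exp_logρ]
      refine h.trans (mul_le_mul_left (mul_le_mul_left ?_ _) _)
      rw [← ENNReal.ofReal_coe_nnreal]
      exact ENNReal.ofReal_le_ofReal (le_max_left _ _)
    exact Real.exp_le_exp.1 h2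
  refine ⟨1 - P.θ - (1 - P.θ) / 2, 1 - P.θ + (1 - P.θ) / 2, Real.log (max (C : ℝ) 1),
    by linarith, by linarith, Real.log_nonneg (le_max_right _ _), fun x y hxy => ?_,
    fun x y hxy => ?_⟩
  · have := key _ _ _ _ (hC x y hxy).2
    linarith
  · have := key _ _ _ _ (hC x y hxy).1
    linarith

end Params

end

noncomputable section

/-! ## The K-functional -/

section KFunctional

variable {V : Type*} [AddCommGroup V] {A₀ A₁ : V → ℝ≥0∞}

theorem K_le (t : ℝ) (f₀ f₁ : V) :
    K A₀ A₁ t (f₀ + f₁) ≤ A₀ f₀ + ENNReal.ofReal t * A₁ f₁ :=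
  iInf_le_of_le f₀ (iInf_le_of_le f₁ (iInf_le_of_le rfl le_rfl))

theorem le_mul_K {c x : ℝ≥0∞} (hc : c ≠ 0) (hc' : c ≠ ∞) {t : ℝ} {f : V}
    (h : ∀ f₀ f₁, f = f₀ + f₁ → x ≤ c * (A₀ f₀ + ENNReal.ofReal t * A₁ f₁)) :
    x ≤ c * K A₀ A₁ t f := by
  rw [← ENNReal.div_le_iff' hc hc']
  refine le_iInf fun f₀ => le_iInf fun f₁ => le_iInf fun hf => ?_
  rw [ENNReal.div_le_iff' hc hc']
  exact h f₀ f₁ hf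

theorem le_add_K {a x : ℝ≥0∞} {t : ℝ} {f : V}
    (h : ∀ f₀ f₁, f = f₀ + f₁ → x ≤ a + (A₀ f₀ + ENNReal.ofReal t * A₁ f₁)) :
    x ≤ a + K A₀ A₁ t f := by
  rw [← tsub_le_iff_left]
  refine le_iInf fun f₀ => le_iInf fun f₁ => le_iInf fun hf => ?_
  rw [tsub_le_iff_left]
  exact h f₀ f₁ hf

theorem K_mono (f : V) : Monotone fun t => K A₀ A₁ t f := fun _ _ h =>
  iInf_mono fun _ => iInf_mono fun _ => iInf_mono fun _ =>
    add_le_add_right (mul_le_mul_left (ENNReal.ofReal_le_ofReal h) _) _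

theorem isK_K (A₀ A₁ : V → ℝ≥0∞) (f : V) : IsK fun x => K A₀ A₁ (Real.exp x) f where
  mono := (K_mono f).comp Real.exp_monotone
  le x y hxy := by
    refine le_mul_K (E_ne_zero _ _) (E_ne_top _ _) fun f₀ f₁ hf => ?_
    subst hf
    refine (K_le _ f₀ f₁).trans ?_
    rw [mul_add]
    refine add_le_add (le_mul_of_one_le_left' (one_le_E zero_le_one (by linarith))) ?_
    rw [← mul_assoc, E, ← ENNReal.ofReal_mul (Real.exp_pos _).le, ← Real.exp_add]
    simp

theorem K_add_le {C : ℝ≥0} (h₀ : ∀ f g, A₀ (f + g) ≤ C * (A₀ f + A₀ g))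
    (h₁ : ∀ f g, A₁ (f + g) ≤ C * (A₁ f + A₁ g)) (hC : 1 ≤ C) (t : ℝ) (f g : V) :
    K A₀ A₁ t (f + g) ≤ C * (K A₀ A₁ t f + K A₀ A₁ t g) := by
  have hC0 : (C : ℝ≥0∞) ≠ 0 := by
    simpa using (zero_lt_one.trans_le hC).ne'
  rw [← ENNReal.div_le_iff' hC0 ENNReal.coe_ne_top]
  refine le_add_K (f := g) fun g₀ g₁ hg => ?_
  rw [add_comm (K A₀ A₁ t f)]
  refine le_add_K (f := f) fun f₀ f₁ hf => ?_
  rw [ENNReal.div_le_iff' hC0 ENNReal.coe_ne_top, hf, hg, add_add_add_comm]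
  refine (K_le _ _ _).trans ((add_le_add (h₀ _ _) (mul_le_mul_right (h₁ _ _) _)).trans
    (le_of_eq (by ring)))

end KFunctional

section Couple

variable {𝕜 : Type*} [RCLike 𝕜] {V : Type*} [AddCommGroup V] [Module 𝕜 V] [TopologicalSpace V]
  {N A₀ A₁ : V → ℝ≥0∞}

theorem IsQuasiBanach.map_zero (h : IsQuasiBanach 𝕜 N) : N 0 = 0 := by
  have := h.smul 0 0
  simpa using this

theorem IsQuasiBanach.map_neg (h : IsQuasiBanach 𝕜 N) (f : V) : N (-f) = N f := by
  have := h.smul (-1) f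
  simpa using this

theorem IsCompatibleCouple.K_neg_le (h : IsCompatibleCouple 𝕜 A₀ A₁) (t : ℝ) (f : V) :
    K A₀ A₁ t (-f) ≤ K A₀ A₁ t f := by
  rw [← one_mul (K A₀ A₁ t f)]
  refine le_mul_K one_ne_zero ENNReal.one_ne_top fun f₀ f₁ hf => ?_
  rw [hf, neg_add, one_mul]
  refine (K_le _ _ _).trans ?_
  rw [h.left.map_neg, h.right.map_neg]

theorem IsCompatibleCouple.exists_K_add_le (h : IsCompatibleCouple 𝕜 A₀ A₁) :
    ∃ C : ℝ≥0, 1 ≤ C ∧ ∀ t f g, K A₀ A₁ t (f + g) ≤ C * (K A₀ A₁ t f + K A₀ A₁ t g) := by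
  obtain ⟨C₀, h₀⟩ := h.left.add_le
  obtain ⟨C₁, h₁⟩ := h.right.add_le
  refine ⟨max (max C₀ C₁) 1, le_max_right _ _, K_add_le (fun f g => (h₀ f g).trans ?_)
    (fun f g => (h₁ f g).trans ?_) (le_max_right _ _)⟩
  · exact mul_le_mul_left (ENNReal.coe_le_coe.2 ((le_max_left _ _).trans (le_max_left _ _))) _
  · exact mul_le_mul_left (ENNReal.coe_le_coe.2 ((le_max_right _ _).trans (le_max_left _ _))) _

/-- If $K$ vanishes, $f$ is a sum of two vectors in arbitrarily small neighbourhoods of 0, hence 0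
in a Hausdorff space. This covers the case in which $2K$ is not strictly above the infimum. -/
theorem IsCompatibleCouple.eq_zero_of_K_eq_zero [IsTopologicalAddGroup V] [T2Space V]
    (h : IsCompatibleCouple 𝕜 A₀ A₁) {t : ℝ} (ht : 0 < t) {f : V} (hf : K A₀ A₁ t f = 0) :
    f = 0 := by
  by_contra hne
  have hU : ({f}ᶜ : Set V) ∈ 𝓝 0 := isOpen_compl_singleton.mem_nhds (Ne.symm hne)
  obtain ⟨W, hW, hWU⟩ := exists_nhds_zero_half hU
  obtain ⟨δ₀, hδ₀, h₀⟩ := h.left.embedded W hW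
  obtain ⟨δ₁, hδ₁, h₁⟩ := h.right.embedded W hW
  have ht' : 0 < ENNReal.ofReal t := ENNReal.ofReal_pos.2 ht
  have hlt : K A₀ A₁ t f < min δ₀ (ENNReal.ofReal t * δ₁) := by
    rw [hf]; exact lt_min hδ₀ (ENNReal.mul_pos ht'.ne' hδ₁.ne')
  simp only [K, iInf_lt_iff] at hlt
  obtain ⟨f₀, f₁, hadd, hlt⟩ := hlt
  have hlt₀ : A₀ f₀ < δ₀ := (le_self_add.trans_lt hlt).trans_le (min_le_left _ _)
  have hlt₁ : ENNReal.ofReal t * A₁ f₁ < ENNReal.ofReal t * δ₁ :=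
    (le_add_self.trans_lt hlt).trans_le (min_le_right _ _)
  have hlt₁' : A₁ f₁ < δ₁ := lt_of_mul_lt_mul_left' hlt₁
  exact hWU f₀ (h₀ _ hlt₀) f₁ (h₁ _ hlt₁') hadd.symm

/-- A nearly optimal decomposition for the K-functional at `t`. -/
theorem IsCompatibleCouple.exists_decomposition [IsTopologicalAddGroup V] [T2Space V]
    (h : IsCompatibleCouple 𝕜 A₀ A₁) {t : ℝ} (ht : 0 < t) {f : V} (hf : K A₀ A₁ t f ≠ ∞) :
    ∃ f₀ f₁, f = f₀ + f₁ ∧ A₀ f₀ + ENNReal.ofReal t * A₁ f₁ ≤ 2 * K A₀ A₁ t f := by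
  by_cases h0 : K A₀ A₁ t f = 0
  · refine ⟨0, 0, by rw [h.eq_zero_of_K_eq_zero ht h0, add_zero], ?_⟩
    rw [h.left.map_zero, h.right.map_zero]; simp
  · have hlt : K A₀ A₁ t f < 2 * K A₀ A₁ t f := by
      rw [two_mul]; exact ENNReal.lt_add_right hf h0
    conv_lhs at hlt => rw [K]
    simp only [iInf_lt_iff] at hlt
    obtain ⟨f₀, f₁, hadd, hlt⟩ := hlt
    exact ⟨f₀, f₁, hadd, hlt.le⟩

/-- The K-functional of the couple of limiting spaces. -/
theorem IsCompatibleCouple.K_limiting_equiv [IsTopologicalAddGroup V] [T2Space V]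
    (h : IsCompatibleCouple 𝕜 A₀ A₁) (P : Params) (X₀ X₁ : V → ℝ≥0∞)
    (hX₀ : ∀ f, X₀ f = P.N₀ fun x => K A₀ A₁ (Real.exp x) f)
    (hX₁ : ∀ f, X₁ f = P.N₁ fun x => K A₀ A₁ (Real.exp x) f) :
    ∃ D : ℝ≥0, ∀ f t,
      K X₀ X₁ (Real.exp (P.logρ t)) f ≤ D * P.S (fun x => K A₀ A₁ (Real.exp x) f) t ∧
      P.S (fun x => K A₀ A₁ (Real.exp x) f) t ≤ D * K X₀ X₁ (Real.exp (P.logρ t)) f := by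
  obtain ⟨C, hC1, hC⟩ := h.exists_K_add_le
  -- One constant for both bounds on the pieces: 2 comes from near optimality, and $3C$ from writing
  -- a piece as $f$ minus the other one.
  obtain ⟨B₁, hB₁⟩ := P.N₀_le (3 * C + 2)
  obtain ⟨B₂, hB₂⟩ := P.ρ_mul_N₁_le (3 * C + 2)
  obtain ⟨B₃, hB₃⟩ := P.S_le_add C
  obtain ⟨B₄, hB₄⟩ := P.S_le_N₀
  obtain ⟨B₅, hB₅⟩ := P.S_le_N₁
  obtain ⟨B₆, hB₆⟩ := P.T_le_Q₀
  have hC1' : (1 : ℝ≥0∞) ≤ C := by exact_mod_cast hC1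
  -- The summand 1 keeps the constant nonzero, which is needed when $S=\infty$ and when dividing by
  -- it.
  refine ⟨max (B₁ + B₂ + 1) (B₃ * (B₄ + B₅)), fun f t => ⟨?_, ?_⟩⟩
  · obtain ⟨k, hk⟩ : ∃ k : V → ℝ → ℝ≥0∞, k = fun f x => K A₀ A₁ (Real.exp x) f := ⟨_, rfl⟩
    have hkK : ∀ f, IsK (k f) := fun f => hk ▸ isK_K A₀ A₁ f
    have hk' : ∀ f, (fun x => K A₀ A₁ (Real.exp x) f) = k f := fun f => by rw [hk]
    simp only [hk'] at hX₀ hX₁ ⊢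
    have hkadd : ∀ f g u, k (f + g) u ≤ C * (k f u + k g u) := fun f g u => by
      rw [hk]; exact hC _ f g
    have hkneg : ∀ f u, k (-f) u ≤ k f u := fun f u => by
      rw [hk]; exact h.K_neg_le _ f
    refine le_trans ?_ (mul_le_mul_left (ENNReal.coe_le_coe.2 (le_max_left _ _)) _)
    -- No decomposition exists when $k=\infty$; but then $T\lesssim Q_0$ forces $S=\infty$.
    by_cases htop : k f t = ∞
    · have hS : P.S (k f) t = ∞ := by
        have h1 := hB₆ (k f) (hkK f) t
        rw [Params.T, htop, ENNReal.mul_top (mul_ne_zero (E_ne_zero _ _) (P.sv_X₀.ne_zero t)),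
          top_le_iff] at h1
        have h2 : P.Q₀ (k f) t = ∞ := by
          by_contra hcon
          exact ENNReal.mul_ne_top ENNReal.coe_ne_top hcon h1
        rw [Params.S, h2]; simp
      rw [hS, ENNReal.mul_top (by simp)]
      exact le_top
    · have htop' : K A₀ A₁ (Real.exp t) f ≠ ∞ := by rw [hk] at htop; exact htop
      obtain ⟨f₀, f₁, hadd, hle⟩ := h.exists_decomposition (Real.exp_pos t) htop'
      have hle' : A₀ f₀ + E 1 t * A₁ f₁ ≤ 2 * k f t := by
        rw [hk, E, one_mul]; exact hle
      have hf₀ : ∀ u, k f₀ u ≤ 2 * k f t := fun u => by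
        have := K_le (A₀ := A₀) (A₁ := A₁) (Real.exp u) f₀ 0
        rw [h.right.map_zero, mul_zero, add_zero, add_zero] at this
        calc k f₀ u ≤ A₀ f₀ := by rw [hk]; exact this
          _ ≤ _ := le_self_add.trans hle'
      have hf₁ : ∀ u, k f₁ u ≤ 2 * (E 1 (u - t) * k f t) := fun u => by
        have := K_le (A₀ := A₀) (A₁ := A₁) (Real.exp u) 0 f₁
        rw [h.left.map_zero, zero_add, zero_add] at this
        calc k f₁ u ≤ E 1 u * A₁ f₁ := by rw [hk, E, one_mul]; exact this
          _ = E 1 (u - t) * (E 1 t * A₁ f₁) := by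
            rw [← mul_assoc, ← E_add_right, sub_add_cancel]
          _ ≤ E 1 (u - t) * (2 * k f t) := mul_le_mul_right (le_add_self.trans hle') _
          _ = _ := by ring
      have hf₀' : ∀ u ≤ t, k f₀ u ≤ 3 * C * k f u := fun u hu => by
        have e : f₀ = f + -f₁ := by rw [hadd]; abel
        have h1 := (hkK f).le u t hu
        rw [show t - u = -(u - t) by ring, E_neg_right] at h1
        calc k f₀ u ≤ C * (k f u + k (-f₁) u) := by rw [e]; exact hkadd _ _ _
          _ ≤ C * (k f u + 2 * (E 1 (u - t) * k f t)) := by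
            gcongr; exact (hkneg _ _).trans (hf₁ u)
          _ ≤ C * (k f u + 2 * (E 1 (u - t) * (E (-1) (u - t) * k f u))) := by gcongr
          _ = C * (k f u + 2 * ((E 1 (u - t) * E (-1) (u - t)) * k f u)) := by ring
          _ = _ := by rw [E_mul_neg]; ring
      have hf₁' : ∀ u ≥ t, k f₁ u ≤ 3 * C * k f u := fun u hu => by
        have e : f₁ = f + -f₀ := by rw [hadd]; abel
        calc k f₁ u ≤ C * (k f u + k (-f₀) u) := by rw [e]; exact hkadd _ _ _
          _ ≤ C * (k f u + 2 * k f t) := by gcongr; exact (hkneg _ _).trans (hf₀ u)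
          _ ≤ C * (k f u + 2 * k f u) := by gcongr; exact (hkK f).mono hu
          _ = _ := by ring
      have m1 : (3 * C : ℝ≥0∞) ≤ ↑(3 * C + 2 : ℝ≥0) := by push_cast; exact le_self_add
      have m2 : (2 : ℝ≥0∞) ≤ ↑(3 * C + 2 : ℝ≥0) := by push_cast; exact le_add_self
      have g₀ : X₀ f₀ ≤ B₁ * (P.P₀ (k f) t + P.Q₀ (k f) t) := by
        rw [hX₀]
        refine hB₁ _ (hkK f) t _ fun u => ?_
        rcases le_total u t with hu | hu
        · rw [min_eq_left hu]; exact (hf₀' u hu).trans (mul_le_mul_left m1 _)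
        · rw [min_eq_right hu]; exact (hf₀ u).trans (mul_le_mul_left m2 _)
      have g₁ : P.ρ t * X₁ f₁ ≤ B₂ * (P.Q₀ (k f) t + P.ρ t * P.R₁ (k f) t) := by
        rw [hX₁]
        exact hB₂ _ (hkK f) t _ (fun u _ => (hf₁ u).trans (mul_le_mul_left m2 _))
          fun u hu => (hf₁' u hu).trans (mul_le_mul_left m1 _)
      calc K X₀ X₁ (Real.exp (P.logρ t)) f ≤ X₀ f₀ + P.ρ t * X₁ f₁ := by
            rw [hadd, ← P.ofReal_exp_logρ]; exact K_le _ _ _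
        _ ≤ B₁ * P.S (k f) t + B₂ * P.S (k f) t + 1 * P.S (k f) t := by
            refine le_trans (add_le_add (g₀.trans (mul_le_mul_right le_self_add _))
              (g₁.trans (mul_le_mul_right ?_ _))) le_self_add
            exact add_le_add_left le_add_self _
        _ = _ := by push_cast; ring
  -- The lower bound tests every decomposition: quasi-subadditivity of $S$, then the limiting norm
  -- of each piece.
  · have hmax : ((max (B₁ + B₂ + 1) (B₃ * (B₄ + B₅)) : ℝ≥0) : ℝ≥0∞) ≠ 0 := by simp
    refine le_mul_K hmax ENNReal.coe_ne_top fun f₀ f₁ hadd => ?_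
    refine le_trans ?_ (mul_le_mul_left (ENNReal.coe_le_coe.2 (le_max_right _ _)) _)
    rw [hX₀, hX₁, P.ofReal_exp_logρ]
    refine (hB₃ _ _ _ (isK_K A₀ A₁ f₀) (isK_K A₀ A₁ f₁)
      (fun u => by rw [hadd]; exact hC _ _ _) t).trans ?_
    rw [ENNReal.coe_mul, mul_assoc]
    refine mul_le_mul_right ?_ _
    rw [mul_add]
    refine add_le_add ((hB₄ _ (isK_K A₀ A₁ f₀) t).trans ?_)
      ((hB₅ _ (isK_K A₀ A₁ f₁) t).trans ?_)
    · exact mul_le_mul_left (by push_cast; exact le_self_add) _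
    · exact mul_le_mul_left (by push_cast; exact le_add_self) _

end Couple

end

noncomputable section

/-! ## Passage to the logarithmic variable -/

theorem lintegral_exp_preimage {I : Set ℝ} (hI : MeasurableSet I) (hpos : I ⊆ Ioi 0)
    (g : ℝ → ℝ≥0∞) :
    ∫⁻ u in I, g u = ∫⁻ x in Real.exp ⁻¹' I, E 1 x * g (Real.exp x) := by
  have h := lintegral_image_eq_lintegral_abs_deriv_mul (f := Real.exp) (f' := Real.exp)
    (Real.continuous_exp.measurable hI) (fun x _ => (Real.hasDerivAt_exp x).hasDerivWithinAt)
    Real.exp_injective.injOn g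
  rw [image_preimage_eq_of_subset (by rwa [Real.range_exp])] at h
  rw [h]
  refine lintegral_congr fun x => ?_
  rw [abs_of_pos (Real.exp_pos x), E, one_mul]

/-- Both `exp` and `log` are differentiable where used, so each maps null sets to null sets. -/
theorem ae_restrict_exp_preimage {I : Set ℝ} (hI : MeasurableSet I) (hpos : I ⊆ Ioi 0)
    (p : ℝ → Prop) : (∀ᵐ u ∂volume.restrict I, p u) ↔
      ∀ᵐ x ∂volume.restrict (Real.exp ⁻¹' I), p (Real.exp x) := by
  have hI' : MeasurableSet (Real.exp ⁻¹' I) := Real.continuous_exp.measurable hI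
  rw [ae_restrict_iff' hI, ae_restrict_iff' hI', ae_iff, ae_iff]
  have hsub : {u | ¬(u ∈ I → p u)} ⊆ Ioi 0 := fun u hu => hpos (Classical.not_imp.1 hu).1
  have hpre : {x | ¬(x ∈ Real.exp ⁻¹' I → p (Real.exp x))} =
      Real.exp ⁻¹' {u | ¬(u ∈ I → p u)} := rfl
  rw [hpre]
  generalize {u | ¬(u ∈ I → p u)} = s at hsub
  constructor
  · intro hs
    have : Real.exp ⁻¹' s = Real.log '' s := by
      ext x
      constructor
      · exact fun hx => ⟨Real.exp x, hx, Real.log_exp x⟩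
      · rintro ⟨u, hu, rfl⟩
        show Real.exp (Real.log u) ∈ s
        rwa [Real.exp_log (hsub hu)]
    rw [this]
    refine addHaar_image_eq_zero_of_differentiableOn_of_addHaar_eq_zero volume (fun u hu => ?_) hs
    exact (Real.differentiableAt_log (ne_of_gt (hsub hu))).differentiableWithinAt
  · intro hs
    have : s = Real.exp '' (Real.exp ⁻¹' s) :=
      (image_preimage_eq_of_subset (by rwa [Real.range_exp])).symm
    rw [this]
    exact addHaar_image_eq_zero_of_differentiableOn_of_addHaar_eq_zero volume
      Real.differentiable_exp.differentiableOn hs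

theorem essSup_exp_preimage {I : Set ℝ} (hI : MeasurableSet I) (hpos : I ⊆ Ioi 0)
    (g : ℝ → ℝ≥0∞) : essSup g (volume.restrict I) =
      essSup (fun x => g (Real.exp x)) (volume.restrict (Real.exp ⁻¹' I)) := by
  rw [essSup_eq_sInf, essSup_eq_sInf]
  congr 1
  ext a
  have := ae_restrict_exp_preimage hI hpos (fun u => g u ≤ a)
  simpa only [ae_iff, not_le, mem_ofPred_eq] using this

/-- The factor $u^{-1/q}$, raised to the power $q$, cancels the Jacobian $e^x$; for $q=\infty$ there
is neither. -/
theorem wnorm_eq {q : ℝ≥0∞} (hq : q ≠ 0) {I : Set ℝ} (hI : MeasurableSet I) (hpos : I ⊆ Ioi 0)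
    (l : ℝ) (w : ℝ → ℝ) (F : ℝ → ℝ≥0∞) :
    wnorm q I l w F = L q (Real.exp ⁻¹' I)
      (fun x => E l x * ENNReal.ofReal (w (Real.exp x)) * F (Real.exp x)) := by
  have hE : ∀ x, ENNReal.ofReal (Real.exp x ^ (l - 1 / q.toReal) * w (Real.exp x)) *
      F (Real.exp x) = E (-(1 / q.toReal)) x *
        (E l x * ENNReal.ofReal (w (Real.exp x)) * F (Real.exp x)) := by
    intro x
    rw [← Real.exp_mul, ENNReal.ofReal_mul (Real.exp_pos _).le, mul_comm x, ← E, sub_eq_add_neg,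
      E_add_left]
    ring
  rw [wnorm]
  change L q I _ = _
  by_cases ht : q = ∞
  · subst ht
    rw [L_top, L_top, essSup_exp_preimage hI hpos]
    simp_rw [hE]
    simp
  · have hq' : 0 < q.toReal := ENNReal.toReal_pos hq ht
    rw [L_eq hq ht, L_eq hq ht, lintegral_exp_preimage hI hpos]
    congr 1
    refine lintegral_congr fun x => ?_
    rw [hE, ENNReal.mul_rpow_of_nonneg _ _ hq'.le, E_rpow, ← mul_assoc, ← E_add_left, mul_neg,
      mul_one_div_cancel hq'.ne']
    simp

theorem exp_preimage_Ioi_zero : Real.exp ⁻¹' Ioi 0 = univ := by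
  ext x; simp [Real.exp_pos]

theorem exp_preimage_Ioo_zero (t : ℝ) : Real.exp ⁻¹' Ioo 0 (Real.exp t) = Iio t := by
  ext x; simp [Real.exp_pos]

theorem exp_preimage_Ioi (t : ℝ) : Real.exp ⁻¹' Ioi (Real.exp t) = Ioi t := by
  ext x; simp

theorem exp_preimage_Ioo (s t : ℝ) : Real.exp ⁻¹' Ioo (Real.exp s) (Real.exp t) = Ioo s t := by
  ext x; simp

section

variable {q : ℝ≥0∞} (l : ℝ) (w : ℝ → ℝ) (F : ℝ → ℝ≥0∞)

theorem wnorm_Ioi_zero (hq : q ≠ 0) : wnorm q (Ioi 0) l w F = L q univ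
    (fun x => E l x * ENNReal.ofReal (w (Real.exp x)) * F (Real.exp x)) := by
  rw [wnorm_eq hq measurableSet_Ioi subset_rfl, exp_preimage_Ioi_zero]

theorem wnorm_Ioo_zero (hq : q ≠ 0) (t : ℝ) : wnorm q (Ioo 0 (Real.exp t)) l w F = L q (Iio t)
    (fun x => E l x * ENNReal.ofReal (w (Real.exp x)) * F (Real.exp x)) := by
  rw [wnorm_eq hq measurableSet_Ioo Ioo_subset_Ioi_self, exp_preimage_Ioo_zero]

theorem wnorm_Ioi (hq : q ≠ 0) (t : ℝ) : wnorm q (Ioi (Real.exp t)) l w F = L q (Ioi t)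
    (fun x => E l x * ENNReal.ofReal (w (Real.exp x)) * F (Real.exp x)) := by
  rw [wnorm_eq hq measurableSet_Ioi (Ioi_subset_Ioi (Real.exp_pos t).le), exp_preimage_Ioi]

theorem wnorm_Ioo (hq : q ≠ 0) (s t : ℝ) : wnorm q (Ioo (Real.exp s) (Real.exp t)) l w F = L q (Ioo s t)
    (fun x => E l x * ENNReal.ofReal (w (Real.exp x)) * F (Real.exp x)) := by
  rw [wnorm_eq hq measurableSet_Ioo
    (Ioo_subset_Ioi_self.trans (Ioi_subset_Ioi (Real.exp_pos s).le)), exp_preimage_Ioo]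

end

/-- The weight `b` in the logarithmic variable. -/
def lw (b : ℝ → ℝ) (x : ℝ) : ℝ≥0∞ := ENNReal.ofReal (b (Real.exp x))

/-- The monotone equivalents are eliminated by applying the equivalence twice: the non-increasing
one bounds the growth of `b`, the non-decreasing one its decay, with squared constants. -/
theorem SlowlyVarying.sv {b : ℝ → ℝ} (h : SlowlyVarying b) : SV (lw b) where
  ne_zero x := (ENNReal.ofReal_pos.2 (h.pos _ (Real.exp_pos x))).ne'
  ne_top _ := ENNReal.ofReal_ne_top
  reg ε hε := by
    obtain ⟨g, _, hg, C, hC, hgC⟩ := h.incr ε hε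
    obtain ⟨g', _, hg', C', hC', hgC'⟩ := h.decr ε hε
    have key : ∀ (M γ x y : ℝ), 0 < M → b (Real.exp x) ≤
        M * Real.exp (γ * (y - x)) * b (Real.exp y) →
        ∀ N : ℝ, M ≤ N → lw b x ≤ ((N.toNNReal : ℝ≥0) : ℝ≥0∞) * E γ (y - x) * lw b y := by
      intro M γ x y hM h1 N hN
      have hb := h.pos _ (Real.exp_pos y)
      rw [lw, lw, E, show ((N.toNNReal : ℝ≥0) : ℝ≥0∞) = ENNReal.ofReal N from rfl,
        ← ENNReal.ofReal_mul (by linarith), ← ENNReal.ofReal_mul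
          (mul_nonneg (by linarith) (Real.exp_pos _).le)]
      exact ENNReal.ofReal_le_ofReal (h1.trans (by gcongr))
    refine ⟨(max (C * C) (C' * C')).toNNReal, fun x y hxy => ⟨?_, ?_⟩⟩
    · have h1 := (hgC' _ (Real.exp_pos y)).1
      have h2 := (hgC' _ (Real.exp_pos x)).2
      have h3 := hg' (mem_Ioi.2 (Real.exp_pos x)) (mem_Ioi.2 (Real.exp_pos y))
        (Real.exp_le_exp.2 hxy)
      simp only [← Real.exp_mul] at h1 h2
      have h4 : Real.exp (y * -ε) * b (Real.exp y) ≤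
          C' * C' * (Real.exp (x * -ε) * b (Real.exp x)) := by
        calc Real.exp (y * -ε) * b (Real.exp y) ≤ C' * g' (Real.exp y) := h1
          _ ≤ C' * (C' * (Real.exp (x * -ε) * b (Real.exp x))) := by gcongr; exact h3.trans h2
          _ = _ := by ring
      have h5 : b (Real.exp y) ≤ C' * C' * Real.exp (-ε * (x - y)) * b (Real.exp x) := by
        calc b (Real.exp y) = Real.exp (y * ε) * (Real.exp (y * -ε) * b (Real.exp y)) := by
              rw [← mul_assoc, ← Real.exp_add]; ring_nf; simp
          _ ≤ Real.exp (y * ε) * (C' * C' * (Real.exp (x * -ε) * b (Real.exp x))) := by gcongr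
          _ = C' * C' * (Real.exp (y * ε) * Real.exp (x * -ε)) * b (Real.exp x) := by ring
          _ = _ := by rw [← Real.exp_add]; ring_nf
      have := key (C' * C') (-ε) y x (by positivity) h5 _ (le_max_right (C * C) _)
      rwa [show x - y = -(y - x) by ring, E_neg_right, neg_neg] at this
    · have h1 := (hgC _ (Real.exp_pos x)).1
      have h2 := (hgC _ (Real.exp_pos y)).2
      have h3 := hg (mem_Ioi.2 (Real.exp_pos x)) (mem_Ioi.2 (Real.exp_pos y))
        (Real.exp_le_exp.2 hxy)
      simp only [← Real.exp_mul] at h1 h2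
      have h4 : Real.exp (x * ε) * b (Real.exp x) ≤
          C * C * (Real.exp (y * ε) * b (Real.exp y)) := by
        calc Real.exp (x * ε) * b (Real.exp x) ≤ C * g (Real.exp x) := h1
          _ ≤ C * (C * (Real.exp (y * ε) * b (Real.exp y))) := by gcongr; exact h3.trans h2
          _ = _ := by ring
      have h5 : b (Real.exp x) ≤ C * C * Real.exp (ε * (y - x)) * b (Real.exp y) := by
        calc b (Real.exp x) = Real.exp (x * -ε) * (Real.exp (x * ε) * b (Real.exp x)) := by
              rw [← mul_assoc, ← Real.exp_add]; ring_nf; simp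
          _ ≤ Real.exp (x * -ε) * (C * C * (Real.exp (y * ε) * b (Real.exp y))) := by gcongr
          _ = C * C * (Real.exp (y * ε) * Real.exp (x * -ε)) * b (Real.exp y) := by ring
          _ = _ := by rw [← Real.exp_add]; ring_nf
      have := key (C * C) ε x y (by positivity) h5 _ (le_max_left _ (C' * C'))
      rwa [neg_neg]

section Spaces

variable {V : Type*} [AddCommGroup V] (A₀ A₁ : V → ℝ≥0∞) (θ : ℝ) {r q s : ℝ≥0∞}
  (a b c : ℝ → ℝ) (f : V)

/-- The K-functional in the logarithmic variable. -/
def kf (f : V) (x : ℝ) : ℝ≥0∞ := K A₀ A₁ (Real.exp x) f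

theorem std_eq (hq : q ≠ 0) : std A₀ A₁ θ q b f =
    L q univ (fun x => E (-θ) x * lw b x * kf A₀ A₁ f x) := wnorm_Ioi_zero _ _ _ hq

theorem spaceL_eq (hr : r ≠ 0) (hq : q ≠ 0) : spaceL A₀ A₁ θ r b q a f =
    L r univ (fun t => lw b t *
      L q (Iio t) (fun u => E (-θ) u * lw a u * kf A₀ A₁ f u)) := by
  rw [spaceL, wnorm_Ioi_zero _ _ _ hr]
  simp_rw [wnorm_Ioo_zero _ _ _ hq, E_zero_left, one_mul]
  rfl

theorem spaceLL_eq (hs : s ≠ 0) (hr : r ≠ 0) (hq : q ≠ 0) : spaceLL A₀ A₁ θ s c r b q a f =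
    L s univ (fun x => lw c x * L r (Iio x) (fun t => lw b t *
      L q (Iio t) (fun u => E (-θ) u * lw a u * kf A₀ A₁ f u))) := by
  rw [spaceLL, wnorm_Ioi_zero _ _ _ hs]
  simp_rw [wnorm_Ioo_zero _ _ _ hr, wnorm_Ioo_zero _ _ _ hq, E_zero_left, one_mul]
  rfl

theorem spaceLR_eq (hs : s ≠ 0) (hr : r ≠ 0) (hq : q ≠ 0) : spaceLR A₀ A₁ θ s c r b q a f =
    L s univ (fun x => lw c x * L r (Ioi x) (fun t => lw b t *
      L q (Ioo x t) (fun u => E (-θ) u * lw a u * kf A₀ A₁ f u))) := by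
  rw [spaceLR, wnorm_Ioi_zero _ _ _ hs]
  simp_rw [wnorm_Ioi _ _ _ hr, wnorm_Ioo _ _ _ hq, E_zero_left, one_mul]
  rfl

theorem wt_Ioi_exp (hq : q ≠ 0) (t : ℝ) : wt q (Ioi (Real.exp t)) b = L q (Ioi t) (lw b) := by
  rw [wt, wnorm_Ioi _ _ _ hq]
  simp_rw [E_zero_left, one_mul, mul_one]
  rfl

theorem wt_Ioo_exp (hq : q ≠ 0) (t : ℝ) : wt q (Ioo 0 (Real.exp t)) b = L q (Iio t) (lw b) := by
  rw [wt, wnorm_Ioo_zero _ _ _ hq]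
  simp_rw [E_zero_left, one_mul, mul_one]
  rfl

theorem wnorm_wt_Ioo_exp (hr : r ≠ 0) (hq : q ≠ 0) (t : ℝ) :
    wnorm r (Ioo 0 (Real.exp t)) 0 b (fun s => wt q (Ioo 0 s) a) =
      L r (Iio t) (fun s => lw b s * L q (Iio s) (lw a)) := by
  rw [wnorm_Ioo_zero _ _ _ hr]
  simp_rw [E_zero_left, one_mul, wt_Ioo_exp _ hq]
  rfl

end Spaces

end

/-! ### The interpolation norm of the limiting couple in terms of `S`. -/

noncomputable section

theorem sameSpace_of_equiv {V : Type*} {X Y M : V → ℝ≥0∞}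
    (h : ∃ D : ℝ≥0, ∀ f, X f ≤ D * M f ∧ M f ≤ D * X f)
    (h' : ∃ D : ℝ≥0, ∀ f, M f ≤ D * Y f ∧ Y f ≤ D * M f) : SameSpace X Y := by
  obtain ⟨D, hD⟩ := h
  obtain ⟨D', hD'⟩ := h'
  have key : ∀ Z Z' : V → ℝ≥0∞, (∀ f, Z' f ≤ ↑(D * D') * Z f) → Embeds Z Z' := fun Z Z' hZ =>
    ⟨fun f hf => (hZ f).trans_lt (ENNReal.mul_lt_top ENNReal.coe_lt_top hf), D * D',
      fun f _ => hZ f⟩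
  refine ⟨key X Y fun f => ?_, key Y X fun f => ?_⟩
  · calc Y f ≤ D' * (D * X f) := (hD' f).2.trans (mul_le_mul_right (hD f).2 _)
      _ = _ := by push_cast; ring
  · calc X f ≤ D * (D' * Y f) := (hD f).1.trans (mul_le_mul_right (hD' f).1 _)
      _ = _ := by push_cast; ring

namespace Params

variable (P : Params)

/-- This identity is the source of the exponent $\eta$ and of the factor
$\chi_0^{1-\theta}\chi_1^{\theta}$ in $a^{\#}$. -/
theorem ρ_rpow_neg_mul (τ t : ℝ) : P.ρ t ^ (-τ) * (E (-P.θ) t * P.X₀ t) =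
    E (-((1 - τ) * P.θ + τ)) t * (P.X₀ t ^ (1 - τ) * P.X₁ t ^ τ) := by
  have h₀ := P.sv_X₀.ne_top t
  have h₁ := P.sv_X₁.inv.ne_top t
  rw [ρ, ENNReal.mul_rpow_of_ne_top (E_ne_top _ _) (ENNReal.mul_ne_top h₀ h₁),
    ENNReal.mul_rpow_of_ne_top h₀ h₁, ENNReal.inv_rpow, ← ENNReal.rpow_neg, neg_neg, E_rpow,
    sub_eq_neg_add 1 τ, ENNReal.rpow_add _ _ (P.sv_X₀.ne_zero t) h₀, ENNReal.rpow_one,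
    show -((-τ + 1) * P.θ + τ) = -τ * (1 - P.θ) + -P.θ by ring, E_add_left]
  ring

/-- The interpolation norm of the couple of limiting spaces. -/
theorem std_equiv {𝕜 : Type*} [RCLike 𝕜] {V : Type*} [AddCommGroup V] [Module 𝕜 V]
    [TopologicalSpace V] [IsTopologicalAddGroup V] [T2Space V] {A₀ A₁ X₀ X₁ : V → ℝ≥0∞}
    (h : IsCompatibleCouple 𝕜 A₀ A₁) (hX₀ : ∀ f, X₀ f = P.N₀ (kf A₀ A₁ f))
    (hX₁ : ∀ f, X₁ f = P.N₁ (kf A₀ A₁ f)) {r : ℝ≥0∞} (hr : r ≠ 0) {a : ℝ → ℝ}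
    (ha : SV (lw a)) (τ : ℝ) :
    ∃ D : ℝ≥0, ∀ f, std X₀ X₁ τ r a f ≤
        D * L r univ (fun t => P.ρ t ^ (-τ) * lw a (P.logρ t) * P.S (kf A₀ A₁ f) t) ∧
      L r univ (fun t => P.ρ t ^ (-τ) * lw a (P.logρ t) * P.S (kf A₀ A₁ f) t) ≤
        D * std X₀ X₁ τ r a f := by
  obtain ⟨δ, D, M, hR⟩ := P.coarseGrowth_logρ
  obtain ⟨B, hB⟩ : ∃ B : ℝ≥0, ∀ f t, kf X₀ X₁ f (P.logρ t) ≤ B * P.S (kf A₀ A₁ f) t ∧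
      P.S (kf A₀ A₁ f) t ≤ B * kf X₀ X₁ f (P.logρ t) := h.K_limiting_equiv P X₀ X₁ hX₀ hX₁
  obtain ⟨C, hC⟩ := ha.reg 1 one_pos
  have hreg : ∀ f, Reg (1 * C * 1) (-τ + -1 + 0) (-τ + 1 + 1)
      (fun x => E (-τ) x * lw a x * kf X₀ X₁ f x) := fun f =>
    ((reg_E (-τ)).mul hC).mul (isK_K X₀ X₁ f).reg
  -- The K-functional is known only at the points $\rho(t)$; sampling the norm along $\log\rho$
  -- changes it by a bounded factor.
  obtain ⟨B', hB'⟩ := hR.L_comp_equiv hr (1 * C * 1) (-τ + -1 + 0) (-τ + 1 + 1)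
  refine ⟨B' * B, fun f => ?_⟩
  obtain ⟨h1, h2⟩ := hB' _ (hreg f)
  simp_rw [P.E_logρ] at h1 h2
  rw [std_eq _ _ _ _ _ hr]
  constructor
  · refine h2.trans ?_
    rw [ENNReal.coe_mul, mul_assoc]
    refine mul_le_mul_right (L_le_mul hr MeasurableSet.univ ENNReal.coe_ne_top fun t _ => ?_) _
    exact (mul_le_mul_right (hB f t).1 _).trans (le_of_eq (by ring))
  · rw [ENNReal.coe_mul, mul_comm (B' : ℝ≥0∞), mul_assoc]
    refine le_trans ?_ (mul_le_mul_right h1 _)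
    refine L_le_mul hr MeasurableSet.univ ENNReal.coe_ne_top fun t _ => ?_
    exact (mul_le_mul_right (hB f t).2 _).trans (le_of_eq (by ring))

end Params

theorem ofReal_mul_toReal {x : ℝ≥0∞} (hx : x ≠ ∞) {c : ℝ} (hc : 0 ≤ c) :
    ENNReal.ofReal (c * x.toReal) = ENNReal.ofReal c * x := by
  rw [ENNReal.ofReal_mul hc, ENNReal.ofReal_toReal hx]

end

end RealInterp

/-! ### Translation of the data and the three cases. -/

theorem theorem34 {𝕜 : Type*} [RCLike 𝕜] {V : Type*} [AddCommGroup V] [Module 𝕜 V]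
    [TopologicalSpace V] [IsTopologicalAddGroup V] [ContinuousSMul 𝕜 V] [T2Space V]
    (A₀ A₁ : V → ℝ≥0∞) (hA : RealInterp.IsCompatibleCouple 𝕜 A₀ A₁)
    (θ₀ : ℝ) (hθ₀ : 0 < θ₀) (hθ₀' : θ₀ < 1)
    (r r₀ q₀ r₁ q₁ : ℝ≥0∞) (hr : 0 < r) (hr₀ : 0 < r₀) (hq₀ : 0 < q₀) (hr₁ : 0 < r₁) (hq₁ : 0 < q₁)
    (a a₀ b₀ a₁ b₁ : ℝ → ℝ) (ha : RealInterp.SlowlyVarying a)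
    (ha₀ : RealInterp.SlowlyVarying a₀) (hb₀ : RealInterp.SlowlyVarying b₀)
    (ha₁ : RealInterp.SlowlyVarying a₁) (hb₁ : RealInterp.SlowlyVarying b₁)
    (h₀ : RealInterp.wt r₀ (Ioi 1) b₀ < ∞)
    (h₁ : RealInterp.wt r₁ (Ioi 1) b₁ < ∞)
    (h₁' : RealInterp.wnorm r₁ (Ioo 0 1) 0 b₁ (fun s => RealInterp.wt q₁ (Ioo 0 s) a₁) < ∞)
    (χ₀ χ₁ ρ : ℝ → ℝ) (hχ₀ : χ₀ = RealInterp.chi₀ r₀ b₀ a₀)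
    (hχ₁ : χ₁ = RealInterp.chi₁ r₁ b₁ q₁ a₁) (hρ : ρ = RealInterp.rho θ₀ χ₀ χ₁)
    (X₀ X₁ : V → ℝ≥0∞) (hX₀ : X₀ = RealInterp.spaceL A₀ A₁ θ₀ r₀ b₀ q₀ a₀)
    (hX₁ : X₁ = RealInterp.spaceL A₀ A₁ 1 r₁ b₁ q₁ a₁) :
    (∀ θ η : ℝ, 0 < θ → θ < 1 → η = (1 - θ) * θ₀ + θ →
      RealInterp.SameSpace (RealInterp.std X₀ X₁ θ r a)
        (RealInterp.std A₀ A₁ η r (RealInterp.sharp θ χ₀ χ₁ ρ a))) ∧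
    (RealInterp.wt r (Ioi 1) a < ∞ →
      RealInterp.SameSpace (RealInterp.std X₀ X₁ 0 r a)
        (RealInterp.inter
          (RealInterp.spaceL A₀ A₁ θ₀ r (RealInterp.bigB₀ r₀ b₀ ρ a) q₀ a₀)
          (RealInterp.spaceLL A₀ A₁ θ₀ r (a ∘ ρ) r₀ b₀ q₀ a₀))) ∧
    (RealInterp.wt r (Ioo 0 1) a < ∞ →
      RealInterp.SameSpace (RealInterp.std X₀ X₁ 1 r a)
        (RealInterp.inter
          (RealInterp.std A₀ A₁ 1 r (RealInterp.sharp 1 χ₀ χ₁ ρ a))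
          (RealInterp.spaceLR A₀ A₁ 1 r (a ∘ ρ) r₁ b₁ q₁ a₁))) := by
  open RealInterp in
  have fin₀ : L r₀ (Ioi 0) (lw b₀) ≠ ∞ := by
    rw [← wt_Ioi_exp _ hr₀.ne', Real.exp_zero]; exact h₀.ne
  have fin₁ : L r₁ (Ioi 0) (lw b₁) ≠ ∞ := by
    rw [← wt_Ioi_exp _ hr₁.ne', Real.exp_zero]; exact h₁.ne
  have fin₁' : L r₁ (Iio 0) (fun s => lw b₁ s * L q₁ (Iio s) (lw a₁)) ≠ ∞ := by
    rw [← wnorm_wt_Ioo_exp _ _ hr₁.ne' hq₁.ne', Real.exp_zero]; exact h₁'.ne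
  obtain ⟨P, hP⟩ : ∃ P : Params, P = ⟨θ₀, hθ₀, hθ₀', r₀, q₀, r₁, q₁, hr₀.ne', hq₀.ne', hr₁.ne',
    hq₁.ne', lw a₀, lw b₀, lw a₁, lw b₁, ha₀.sv, hb₀.sv, ha₁.sv, hb₁.sv, fin₀, fin₁, fin₁'⟩ :=
    ⟨_, rfl⟩
  have eθ : P.θ = θ₀ := by rw [hP]
  have eβ₀ : ∀ t, wt r₀ (Ioi (Real.exp t)) b₀ = P.β₀ t := fun t => by
    rw [wt_Ioi_exp _ hr₀.ne', hP]; rfl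
  have eβ₁ : ∀ t, wt r₁ (Ioi (Real.exp t)) b₁ = P.β₁ t := fun t => by
    rw [wt_Ioi_exp _ hr₁.ne', hP]; rfl
  have eα₁ : ∀ t, wt q₁ (Ioo 0 (Real.exp t)) a₁ = P.α₁ t := fun t => by
    rw [wt_Ioo_exp _ hq₁.ne', hP]; rfl
  have eγ₁ : ∀ t, wnorm r₁ (Ioo 0 (Real.exp t)) 0 b₁ (fun s => wt q₁ (Ioo 0 s) a₁) = P.γ₁ t :=
    fun t => by rw [wnorm_wt_Ioo_exp _ _ hr₁.ne' hq₁.ne', hP]; rfl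
  have eX₀ : ∀ t, lw χ₀ t = P.X₀ t := fun t => by
    rw [lw, hχ₀, chi₀, eβ₀, ofReal_mul_toReal (P.sv_β₀.ne_top t)
      (ha₀.pos _ (Real.exp_pos t)).le, Params.X₀]
    congr 1
    rw [hP]; rfl
  have eX₁ : ∀ t, lw χ₁ t = P.X₁ t := fun t => by
    rw [lw, hχ₁, chi₁, eβ₁, eα₁, eγ₁, ENNReal.ofReal_add ENNReal.toReal_nonneg (by positivity),
      ofReal_mul_toReal (P.sv_α₁.ne_top t) ENNReal.toReal_nonneg,
      ENNReal.ofReal_toReal (P.sv_β₁.ne_top t), ENNReal.ofReal_toReal (P.sv_γ₁.ne_top t),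
      Params.X₁]
  have pX₀ : ∀ t, 0 < χ₀ (Real.exp t) := fun t => by
    have := P.sv_X₀.ne_zero t
    rw [← eX₀, lw] at this
    exact ENNReal.ofReal_pos.1 (pos_iff_ne_zero.2 this)
  have pX₁ : ∀ t, 0 < χ₁ (Real.exp t) := fun t => by
    have := P.sv_X₁.ne_zero t
    rw [← eX₁, lw] at this
    exact ENNReal.ofReal_pos.1 (pos_iff_ne_zero.2 this)
  have eρ : ∀ t, ρ (Real.exp t) = Real.exp (P.logρ t) := fun t => by
    have hpos : 0 < ρ (Real.exp t) := by
      rw [hρ, rho]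
      exact mul_pos (Real.rpow_pos_of_pos (Real.exp_pos t) _) (div_pos (pX₀ t) (pX₁ t))
    have h : ENNReal.ofReal (ρ (Real.exp t)) = ENNReal.ofReal (Real.exp (P.logρ t)) := by
      rw [P.ofReal_exp_logρ, hρ, rho, ENNReal.ofReal_mul (by positivity),
        ENNReal.ofReal_div_of_pos (pX₁ t), Params.ρ, ← eX₀, ← eX₁, eθ, E, ← Real.exp_mul,
        mul_comm t, div_eq_mul_inv]
      rfl
    exact (ENNReal.ofReal_eq_ofReal_iff hpos.le (Real.exp_pos _).le).1 h
  obtain ⟨W, hW⟩ : ∃ W : ℝ → ℝ≥0∞, W = fun t => lw a (P.logρ t) := ⟨_, rfl⟩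
  have eW : ∀ t, ENNReal.ofReal (a (ρ (Real.exp t))) = W t := fun t => by rw [eρ, hW]; rfl
  have svW : SV W := by
    obtain ⟨δ, D, M, hR⟩ := P.coarseGrowth_logρ
    have hD : 0 < D := hR.pos.trans_le hR.le
    rw [hW]
    refine ⟨fun t => ha.sv.ne_zero _, fun t => ha.sv.ne_top _, fun ε hε => ?_⟩
    -- Composition with $\log\rho$ multiplies growth rates by at most $D$, so the rate
    -- $\varepsilon/D$ is requested of `a`.
    obtain ⟨C, hC⟩ := ha.sv.reg (ε / D) (by positivity)
    have h := hR.reg_comp (by positivity) hC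
    rw [div_mul_cancel₀ _ hD.ne'] at h
    exact ⟨_, h⟩
  have eN₀ : ∀ f, X₀ f = P.N₀ (kf A₀ A₁ f) := fun f => by
    rw [hX₀, spaceL_eq _ _ _ _ _ _ hr₀.ne' hq₀.ne', hP]; rfl
  have eN₁ : ∀ f, X₁ f = P.N₁ (kf A₀ A₁ f) := fun f => by
    rw [hX₁, spaceL_eq _ _ _ _ _ _ hr₁.ne' hq₁.ne', hP]; rfl
  -- The target standard space is the weighted norm of the pointwise term; used for $0<\theta<1$ and
  -- again for $\theta=1$.
  have eStd : ∀ (τ η : ℝ), η = (1 - τ) * θ₀ + τ → ∀ f, std A₀ A₁ η r (sharp τ χ₀ χ₁ ρ a) f =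
      L r univ (fun t => P.ρ t ^ (-τ) * W t * P.T (kf A₀ A₁ f) t) := fun τ η hη f => by
    rw [std_eq _ _ _ _ _ hr.ne']
    congr 1
    ext t
    have h := P.ρ_rpow_neg_mul τ t
    rw [eθ, ← hη] at h
    have hs : lw (sharp τ χ₀ χ₁ ρ a) t = P.X₀ t ^ (1 - τ) * P.X₁ t ^ τ * W t := by
      rw [lw, sharp, ENNReal.ofReal_mul (mul_pos (Real.rpow_pos_of_pos (pX₀ t) _)
        (Real.rpow_pos_of_pos (pX₁ t) _)).le,
        ENNReal.ofReal_mul (Real.rpow_pos_of_pos (pX₀ t) _).le,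
        ← ENNReal.ofReal_rpow_of_pos (pX₀ t), ← ENNReal.ofReal_rpow_of_pos (pX₁ t), eW,
        ← eX₀, ← eX₁]
      rfl
    rw [hs, Params.T, eθ]
    calc E (-η) t * (P.X₀ t ^ (1 - τ) * P.X₁ t ^ τ * W t) * kf A₀ A₁ f t
        = (E (-η) t * (P.X₀ t ^ (1 - τ) * P.X₁ t ^ τ)) * W t * kf A₀ A₁ f t := by ring
      _ = _ := by rw [← h]; ring
  have hK : ∀ f, IsK (kf A₀ A₁ f) := isK_K A₀ A₁
  refine ⟨fun θ η hθ hθ' hη => ?_, fun _ => ?_, fun _ => ?_⟩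
  · obtain ⟨D, hD⟩ := P.L_S_equiv_of_lt hr.ne' svW hθ hθ'
    refine sameSpace_of_equiv (P.std_equiv hA eN₀ eN₁ hr.ne' ha.sv θ) ⟨D, fun f => ?_⟩
    rw [eStd θ η hη f]
    have := hD _ (hK f)
    rwa [hW] at this ⊢
  · obtain ⟨D, hD⟩ := P.L_S_equiv_zero hr.ne' svW
    have hstd := P.std_equiv hA eN₀ eN₁ hr.ne' ha.sv 0
    simp only [neg_zero, ENNReal.rpow_zero, one_mul] at hstd
    refine sameSpace_of_equiv hstd ⟨D, fun f => ?_⟩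
    have h := hD _ (hK f)
    have e1 : spaceL A₀ A₁ θ₀ r (bigB₀ r₀ b₀ ρ a) q₀ a₀ f =
        L r univ (fun t => W t * P.Q₀ (kf A₀ A₁ f) t) := by
      rw [spaceL_eq _ _ _ _ _ _ hr.ne' hq₀.ne']
      congr 1
      ext t
      have hF : L q₀ (Iio t) (fun u => E (-θ₀) u * lw a₀ u * kf A₀ A₁ f u) =
        P.F₀ (kf A₀ A₁ f) t := by rw [hP]; rfl
      rw [hF, lw, bigB₀, eβ₀, ENNReal.ofReal_mul ENNReal.toReal_nonneg, eW,
        ENNReal.ofReal_toReal (P.sv_β₀.ne_top t), Params.Q₀]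
      ring
    have e2 : spaceLL A₀ A₁ θ₀ r (a ∘ ρ) r₀ b₀ q₀ a₀ f =
        L r univ (fun t => W t * P.P₀ (kf A₀ A₁ f) t) := by
      rw [spaceLL_eq _ _ _ _ _ _ _ hr.ne' hr₀.ne' hq₀.ne']
      congr 1
      ext t
      rw [lw, Function.comp, eW, hP]; rfl
    rw [inter, e1, e2]
    rwa [hW] at h ⊢
  · obtain ⟨D, hD⟩ := P.L_S_equiv_one hr.ne' svW
    refine sameSpace_of_equiv (P.std_equiv hA eN₀ eN₁ hr.ne' ha.sv 1) ⟨D, fun f => ?_⟩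
    have h := hD _ (hK f)
    have e2 : spaceLR A₀ A₁ 1 r (a ∘ ρ) r₁ b₁ q₁ a₁ f =
        L r univ (fun t => W t * P.R₁ (kf A₀ A₁ f) t) := by
      rw [spaceLR_eq _ _ _ _ _ _ _ hr.ne' hr₁.ne' hq₁.ne']
      congr 1
      ext t
      rw [lw, Function.comp, eW, hP]; rfl
    rw [inter, eStd 1 1 (by ring) f, e2]
    rwa [hW] at h ⊢
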